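/- **Setting.** Let $M$ be a smooth (Hausdorff, second countable, finite-dimensional, boundaryless) manifold, $U\to M$ a smooth vector bundle of finite rank with a smooth Euclidean structure, and $f:U\to TM$ a subriemannian structure, i.e. a smooth vector bundle homomorphism over $\mathrm{id}_M$ that is bracket generating: $\{f\circ s: s \text{ a smooth section of } U\}$ is not contained in a proper involutive $C^\infty(M)$-submodule of the module of smooth vector fields. A Lipschitz curve $\gamma:[0,t]\to M$ is horizontal if $\dot\gamma=f(u)$ a.e. for some measurable bounded $u:[0,t]\to U$ with $u(\tau)\in U_{\gamma(\tau)}$; its length is the infimum of $\int_0^t|u(\tau)|\,d\tau$ over all such $u$. The distance $\delta(q_0,q_1)$ is the infimum of the lengths of horizontal curves from $q_0$ to $q_1$, and $B_{q_0}(t)=\{q:\delta(q_0,q)\le t\}$. A shortest path on $[0,t]$ from $q_0$, parameterized by the length, is a horizontal $\gamma$ with $\gamma(0)=q_0$, $\mathrm{length}(\gamma|_{[0,s]})=s$ for $0\le s\le t$, and $\delta(q_0,\gamma(t))=t$. Represent $f$ by an equivalent free structure: let $\sigma_1,\dots,\sigma_k$ be smooth sections of $U$ such that $(q,a)\mapsto\sum_i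 a_i\sigma_i(q)$ maps $M\times\mathbb R^k$ onto $U$ and $|u|=\min\{|a|:\sum_i a_i\sigma_i(q)=u\}$ for all $u\in U_q$, and put $X_i=f\circ\sigma_i$ (if $U=M\times\mathbb R^k$, one may take $\sigma_i=e_i$). For $u\in L_2^k[0,t]$ let $F^t_{q_0}(u)=q(t)$, where $\dot q=\sum_i u_i(\tau)X_i(q)$, $q(0)=q_0$ (for those $u$ whose solution exists on $[0,t]$), and let $E^t_u=D_uF^t_{q_0}(u^\perp)$, where $u^\perp$ is the orthogonal complement of $u$ in $L_2^k[0,t]$. A non-constant horizontal curve generated from some $q_0$ by a bounded control $u$ on $[0,t]$, $t>0$, is a geodesic if $E^t_u$ is not the whole tangent space at $F^t_{q_0}(u)$; its corank is the codimension of $E^t_u$. A shortest path $\gamma$ on $[0,t]$ parameterized by the length, with control $u$, $|u|=1$ a.e., is normal if $\dot\gamma(t)$ exists (as the one-sided derivative) and $\dot\gamma(t)\notin E^t_u$; otherwise it is abnormal. A co-oriented hyperplane $E_0\subset T_qM$, with positive open half-space $E_+$, is tangent to $B\subset M$ at $q$ if for any smooth $\varphi:(-1,1)\to M$ with $\varphi(0)=q$,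 $\dot\varphi(0)\in E_+$ there is $\varepsilon>0$ such that $\varphi(s)\notin B$ for $s\in(0,\varepsilon)$ and $\varphi(s)\in B$ for $s\in(-\varepsilon,0)$. **Statement.** Assume that all geodesics have corank $1$, that $B_{q_0}(r)$ is compact, and $0<t\le r$. Let $\gamma:[0,t]\to M$ be a normal shortest path from $q_0$, parameterized by the length. If there is another shortest path $\gamma'\ne\gamma$ on $[0,t]$, normal or abnormal, parameterized by the length, from $q_0$ to $\gamma'(t)=\gamma(t)$, then $B_{q_0}(t)$ does not admit a tangent hyperplane at $\gamma(t)$. -/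

import Mathlib

open Set Filter Topology MeasureTheory Bundle Manifold
open scoped ContDiff NNReal ENNReal

noncomputable section

/-! ### Curves and vector fields on a manifold -/

section Manifold

variable {E : Type*} [NormedAddCommGroup E] [NormedSpace ℝ E]
  {H : Type*} [TopologicalSpace H] (I : ModelWithCorners ℝ E H)
  {M : Type*} [TopologicalSpace M] [ChartedSpace H M]

/-- Inside `s`, the curve `γ` has velocity `ξ` at time `τ`. -/
def HasVelocityWithinAt (γ : ℝ → M) (s : Set ℝ) (τ : ℝ) (ξ : TangentSpace I (γ τ)) : Prop :=
  HasMFDerivWithinAt 𝓘(ℝ, ℝ) I γ s τ ((1 : ℝ →L[ℝ] ℝ).smulRight ξ)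

/-- `γ` is a Lipschitz curve on `[0, t]`: it is continuous there and, near each time, Lipschitz
when read in a chart. -/
def IsLipschitzCurve (t : ℝ) (γ : ℝ → M) : Prop :=
  ContinuousOn γ (Icc 0 t) ∧
    ∀ τ₀ ∈ Icc (0 : ℝ) t, ∃ s ∈ 𝓝[Icc 0 t] τ₀, ∃ K : ℝ≥0,
      MapsTo γ s (chartAt H (γ τ₀)).source ∧ LipschitzOnWith K (extChartAt I (γ τ₀) ∘ γ) s

/-- `γ` is an absolutely continuous curve on `[0, t]`: it is continuous there and, near each time,
absolutely continuous when read in a chart. -/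
def IsAbsolutelyContinuousCurve (t : ℝ) (γ : ℝ → M) : Prop :=
  ContinuousOn γ (Icc 0 t) ∧
    ∀ τ₀ ∈ Icc (0 : ℝ) t, ∃ a b : ℝ, a ≤ b ∧ Icc a b ∈ 𝓝[Icc 0 t] τ₀ ∧
      MapsTo γ (Icc a b) (chartAt H (γ τ₀)).source ∧
      AbsolutelyContinuousOnInterval (extChartAt I (γ τ₀) ∘ γ) a b

/-- `V` is a smooth vector field on `M`. -/
def IsSmoothVectorField [IsManifold I ∞ M] (V : ∀ q : M, TangentSpace I q) : Prop :=
  ContMDiff I I.tangent ∞ (fun q => (⟨q, V q⟩ : TangentBundle I M))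

/-- `S` is an involutive `C^∞(M)`-submodule of the module of smooth vector fields on `M`. -/
structure IsInvolutiveSubmodule [IsManifold I ∞ M] (S : Set (∀ q : M, TangentSpace I q)) :
    Prop where
  smooth : ∀ V ∈ S, IsSmoothVectorField I V
  zero_mem : (fun _ => 0) ∈ S
  add_mem : ∀ V ∈ S, ∀ W ∈ S, (fun q => V q + W q) ∈ S
  smul_mem : ∀ a : M → ℝ, ContMDiff I 𝓘(ℝ, ℝ) ∞ a → ∀ V ∈ S, (fun q => a q • V q) ∈ S
  lie_mem : ∀ V ∈ S, ∀ W ∈ S, VectorField.mlieBracket I V W ∈ S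

/-- The co-oriented hyperplane `E₀ = ker α` of `T_q M`, with positive side `E₊ = {α > 0}` and
negative side `E₋ = {α < 0}`, is tangent to `B` at `q`: each smooth curve `φ : (-1, 1) → M` with
`φ 0 = q` whose velocity at `0` lies in `E₊` is, for small times, outside `B` after time `0` and
inside `B` before time `0`. -/
def IsTangentHyperplane (B : Set M) (q : M) (α : TangentSpace I q →ₗ[ℝ] ℝ) : Prop :=
  α ≠ 0 ∧ ∀ φ : ℝ → M, ContMDiffOn 𝓘(ℝ, ℝ) I ∞ φ (Ioo (-1) 1) →
    ∀ ξ : TangentSpace I q, 0 < α ξ →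
      (⟨φ 0, mfderiv 𝓘(ℝ, ℝ) I φ 0 (1 : ℝ)⟩ : TangentBundle I M) = ⟨q, ξ⟩ →
      ∃ ε > 0, ε < 1 ∧ (∀ s ∈ Ioo (0 : ℝ) ε, φ s ∉ B) ∧ (∀ s ∈ Ioo (-ε) 0, φ s ∈ B)

/-- `B` admits a tangent (co-oriented) hyperplane at `q`. -/
def AdmitsTangentHyperplane (B : Set M) (q : M) : Prop :=
  ∃ α : TangentSpace I q →ₗ[ℝ] ℝ, IsTangentHyperplane I B q α

end Manifold

/-! ### Subriemannian structures `f : U → TM` -/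

section Structure

variable {E : Type*} [NormedAddCommGroup E] [NormedSpace ℝ E]
  {H : Type*} [TopologicalSpace H] (I : ModelWithCorners ℝ E H)
  {M : Type*} [TopologicalSpace M] [ChartedSpace H M]
  (F : Type*) [NormedAddCommGroup F] [NormedSpace ℝ F]
  {U : M → Type*} [TopologicalSpace (TotalSpace F U)]
  [∀ q, NormedAddCommGroup (U q)] [∀ q, InnerProductSpace ℝ (U q)]
  [FiberBundle F U]

/-- `s` is a smooth section of the bundle `U`. -/
def IsSmoothSection (s : ∀ q, U q) : Prop :=
  ContMDiff I (I.prod 𝓘(ℝ, F)) ∞ (fun q => (⟨q, s q⟩ : TotalSpace F U))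

/-- The fiberwise linear map `f : U → TM` is bracket generating: the fields `f ∘ s`, with `s` a
smooth section of `U`, are not contained in a proper involutive submodule of the smooth vector
fields. -/
def IsBracketGenerating [IsManifold I ∞ M] (f : ∀ q, U q →ₗ[ℝ] TangentSpace I q) : Prop :=
  ∀ S : Set (∀ q : M, TangentSpace I q), IsInvolutiveSubmodule I S →
    (∀ s : ∀ q, U q, IsSmoothSection I F s → (fun q => f q (s q)) ∈ S) →
    ∀ V : ∀ q : M, TangentSpace I q, IsSmoothVectorField I V → V ∈ S

/-- `f : U → TM` is a subriemannian structure: a smooth homomorphism of vector bundles that is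
bracket generating. -/
structure IsSubriemannianStructure [IsManifold I ∞ M]
    (f : ∀ q, U q →ₗ[ℝ] TangentSpace I q) : Prop where
  smooth : ContMDiff (I.prod 𝓘(ℝ, F)) I.tangent ∞
    (fun p : TotalSpace F U => (⟨p.1, f p.1 p.2⟩ : TangentBundle I M))
  bracketGenerating : IsBracketGenerating I F f

/-- `u : [0, t] → U` is measurable and bounded, and `γ' = f(u)` almost everywhere on `[0, t]`. -/
structure IsHorizontalLift (f : ∀ q, U q →ₗ[ℝ] TangentSpace I q) (t : ℝ) (γ : ℝ → M)
    (u : ∀ τ, U (γ τ)) : Prop where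
  measurable : @Measurable (Icc (0 : ℝ) t) (TotalSpace F U) _ (borel _)
    (fun τ => ⟨γ τ, u τ⟩)
  bounded : ∃ C : ℝ, ∀ τ ∈ Icc (0 : ℝ) t, ‖u τ‖ ≤ C
  velocity : ∀ᵐ τ ∂(volume.restrict (Icc 0 t)),
    HasVelocityWithinAt I γ (Icc 0 t) τ (f (γ τ) (u τ))

/-- `γ` is a horizontal curve on `[0, t]`. -/
def IsHorizontal (f : ∀ q, U q →ₗ[ℝ] TangentSpace I q) (t : ℝ) (γ : ℝ → M) : Prop :=
  IsLipschitzCurve I t γ ∧ ∃ u : ∀ τ, U (γ τ), IsHorizontalLift I F f t γ u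

/-- The subriemannian length of `γ` restricted to `[0, t]`. -/
def subriemannianLength (f : ∀ q, U q →ₗ[ℝ] TangentSpace I q) (t : ℝ) (γ : ℝ → M) : ℝ≥0∞ :=
  ⨅ (u : ∀ τ, U (γ τ)) (_ : IsHorizontalLift I F f t γ u), ∫⁻ τ in Icc 0 t, ‖u τ‖ₑ

/-- The subriemannian (Carnot-Caratheodory) distance; it is `∞` if no horizontal curve connects
the two points. -/
def subriemannianDist (f : ∀ q, U q →ₗ[ℝ] TangentSpace I q) (q₀ q₁ : M) : ℝ≥0∞ :=
  ⨅ (t : ℝ) (_ : 0 ≤ t) (γ : ℝ → M) (_ : IsHorizontal I F f t γ) (_ : γ 0 = q₀) (_ : γ t = q₁),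
    subriemannianLength I F f t γ

/-- The closed subriemannian ball of radius `r` centered at `q₀`. -/
def subriemannianBall (f : ∀ q, U q →ₗ[ℝ] TangentSpace I q) (q₀ : M) (r : ℝ) : Set M :=
  {q | subriemannianDist I F f q₀ q ≤ ENNReal.ofReal r}

/-- `γ` restricted to `[0, t]` is a shortest path starting at `q₀` and parameterized by the
length. -/
structure IsShortestPath (f : ∀ q, U q →ₗ[ℝ] TangentSpace I q) (q₀ : M) (t : ℝ)
    (γ : ℝ → M) : Prop where
  horizontal : IsHorizontal I F f t γ
  start : γ 0 = q₀
  arclength : ∀ s ∈ Icc (0 : ℝ) t, subriemannianLength I F f s γ = ENNReal.ofReal s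
  minimizing : subriemannianDist I F f q₀ (γ t) = subriemannianLength I F f t γ

/-- The sections `σ₁, …, σₖ` of the Euclidean bundle `U` are smooth and the homomorphism
`M × ℝᵏ → U`, `(q, a) ↦ ∑ aᵢ σᵢ(q)`, is onto with `|u| = min {|a| : ∑ aᵢ σᵢ(q) = u}` for all
`u ∈ U_q`. Then `f : U → TM` is equivalent to the free structure on `M × ℝᵏ` given by the fields
`f ∘ σᵢ`. For `U = M × ℝᵏ` itself one can take the standard basis. -/
structure IsFreePresentation {k : ℕ} (σ : Fin k → ∀ q, U q) : Prop where
  smooth : ∀ i, IsSmoothSection I F (σ i)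
  norm_eq_min : ∀ (q : M) (u : U q),
    IsLeast {c : ℝ | ∃ a : EuclideanSpace ℝ (Fin k), ∑ i, a i • σ i q = u ∧ ‖a‖ = c} ‖u‖

end Structure

/-! ### The endpoint map of a free structure, given by vector fields `X₁, …, Xₖ` -/

/-- The Hilbert space `L₂ᵏ[0, t]`. -/
abbrev ControlSpace (k : ℕ) (t : ℝ) : Type :=
  Lp (EuclideanSpace ℝ (Fin k)) 2 (volume.restrict (Icc (0 : ℝ) t))

section Free

variable {E : Type*} [NormedAddCommGroup E] [NormedSpace ℝ E]
  {H : Type*} [TopologicalSpace H] (I : ModelWithCorners ℝ E H)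
  {M : Type*} [TopologicalSpace M] [ChartedSpace H M]
  {k : ℕ} (X : Fin k → ∀ q : M, TangentSpace I q)

/-- `γ` is the solution on `[0, t]` of `γ' = ∑ uᵢ Xᵢ(γ)`, `γ(0) = q₀`. -/
structure IsTrajectory (q₀ : M) (t : ℝ) (u : ControlSpace k t) (γ : ℝ → M) : Prop where
  absolutelyContinuous : IsAbsolutelyContinuousCurve I t γ
  start : γ 0 = q₀
  velocity : ∀ᵐ τ ∂(volume.restrict (Icc 0 t)),
    HasVelocityWithinAt I γ (Icc 0 t) τ (∑ i, u τ i • X i (γ τ))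

open Classical in
/-- The endpoint map `F^t_{q₀} : u ↦ γ(t)`, where `γ` is the solution of `γ' = ∑ uᵢ Xᵢ(γ)`,
`γ(0) = q₀`. It is defined on the set of the `u` whose solution exists on `[0, t]`; elsewhere it
has the arbitrary value `q₀`. -/
def endpointMap (q₀ : M) (t : ℝ) (u : ControlSpace k t) : M :=
  if h : ∃ γ : ℝ → M, IsTrajectory I X q₀ t u γ then h.choose t else q₀

/-- The subspace `E^t_u = D_u F^t_{q₀}(u^⊥)` of the tangent space at `F^t_{q₀}(u)`. -/
def endpointSubspace (q₀ : M) (t : ℝ) (u : ControlSpace k t) :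
    Submodule ℝ (TangentSpace I (endpointMap I X q₀ t u)) :=
  Submodule.map (mfderiv 𝓘(ℝ, ControlSpace k t) I (endpointMap I X q₀ t) u).toLinearMap
    (ℝ ∙ u)ᗮ

/-- The bounded control `u` generates, from `q₀`, a geodesic on `[0, t]`: a non-constant horizontal
curve with `D_u F^t_{q₀}(u^⊥)` different from the whole tangent space. -/
def GeneratesGeodesic (q₀ : M) (t : ℝ) (u : ControlSpace k t) : Prop :=
  (∃ C : ℝ, ∀ᵐ τ ∂(volume.restrict (Icc 0 t)), ‖u τ‖ ≤ C) ∧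
  (∃ γ : ℝ → M, IsTrajectory I X q₀ t u γ ∧ ∃ τ ∈ Icc (0 : ℝ) t, γ τ ≠ q₀) ∧
  endpointSubspace I X q₀ t u ≠ ⊤

/-- All geodesics have corank one. -/
def AllGeodesicsHaveCorankOne : Prop :=
  ∀ (q₀ : M) (t : ℝ) (u : ControlSpace k t), 0 < t → GeneratesGeodesic I X q₀ t u →
    Module.finrank ℝ
      (TangentSpace I (endpointMap I X q₀ t u) ⧸ endpointSubspace I X q₀ t u) = 1

/-- The path `γ` on `[0, t]`, parameterized by the length, is normal: for its control `u`,
`|u| = 1`, the velocity `γ'(t)` exists and does not belong to `E^t_u`. (As points of the tangent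
bundle, `(γ t, ξ)` and `(F^t_{q₀}(u), η)` are compared.) -/
def IsNormalPath (q₀ : M) (t : ℝ) (γ : ℝ → M) : Prop :=
  ∃ u : ControlSpace k t, (∀ᵐ τ ∂(volume.restrict (Icc 0 t)), ‖u τ‖ = 1) ∧
    IsTrajectory I X q₀ t u γ ∧ endpointMap I X q₀ t u = γ t ∧
    ∃ ξ : TangentSpace I (γ t), HasVelocityWithinAt I γ (Icc 0 t) t ξ ∧
      ∀ η ∈ endpointSubspace I X q₀ t u,
        (⟨γ t, ξ⟩ : TangentBundle I M) ≠ ⟨endpointMap I X q₀ t u, η⟩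

end Free

end

set_option synthInstance.maxHeartbeats 400000
set_option linter.unusedSectionVars false

noncomputable section

/-! ### Superposition operators on spaces of continuous functions -/

section Superposition

universe v w

variable {K : Type v} [TopologicalSpace K] [CompactSpace K]
  {E : Type w} [NormedAddCommGroup E] [NormedSpace ℝ E]

/-- The pointwise application of a bilinear map to continuous functions, as a bilinear map. -/
def pointwiseBilinₗ (K : Type v) [TopologicalSpace K] [CompactSpace K]
    {W E G : Type*} [NormedAddCommGroup W] [NormedSpace ℝ W] [NormedAddCommGroup E]
    [NormedSpace ℝ E] [NormedAddCommGroup G] [NormedSpace ℝ G] (B : W →L[ℝ] E →L[ℝ] G) :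
    C(K, W) →ₗ[ℝ] C(K, E) →ₗ[ℝ] C(K, G) :=
  LinearMap.mk₂ ℝ (fun (A : C(K, W)) (h : C(K, E)) =>
      (⟨fun s => B (A s) (h s), by fun_prop⟩ : C(K, G)))
    (fun _ _ _ => by ext; simp) (fun _ _ _ => by ext; simp)
    (fun _ _ _ => by ext; simp) (fun _ _ _ => by ext; simp)

theorem norm_pointwiseBilinₗ_le {W E G : Type*} [NormedAddCommGroup W] [NormedSpace ℝ W]
    [NormedAddCommGroup E] [NormedSpace ℝ E] [NormedAddCommGroup G] [NormedSpace ℝ G]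
    (B : W →L[ℝ] E →L[ℝ] G) (A : C(K, W)) (h : C(K, E)) :
    ‖pointwiseBilinₗ K B A h‖ ≤ ‖B‖ * ‖A‖ * ‖h‖ := by
  refine (ContinuousMap.norm_le _ (by positivity)).2 fun s => ?_
  refine (B.le_opNorm₂ (A s) (h s)).trans ?_
  gcongr
  exacts [A.norm_coe_le_norm s, h.norm_coe_le_norm s]

/-- The pointwise application of a bilinear map to continuous functions. -/
def pointwiseBilin (K : Type v) [TopologicalSpace K] [CompactSpace K]
    {W E G : Type*} [NormedAddCommGroup W] [NormedSpace ℝ W] [NormedAddCommGroup E]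
    [NormedSpace ℝ E] [NormedAddCommGroup G] [NormedSpace ℝ G] (B : W →L[ℝ] E →L[ℝ] G) :
    C(K, W) →L[ℝ] C(K, E) →L[ℝ] C(K, G) :=
  LinearMap.mkContinuous₂ (pointwiseBilinₗ K B) ‖B‖ (norm_pointwiseBilinₗ_le B)

theorem contDiff_pointwiseBilin_comp {W E G D : Type*} [NormedAddCommGroup W] [NormedSpace ℝ W]
    [NormedAddCommGroup E] [NormedSpace ℝ E] [NormedAddCommGroup G] [NormedSpace ℝ G]
    [NormedAddCommGroup D] [NormedSpace ℝ D] {n : ℕ∞ω}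
    (B : W →L[ℝ] E →L[ℝ] G) {f : D → C(K, W)} (hf : ContDiff ℝ n f) :
    ContDiff ℝ n fun x => pointwiseBilin K B (f x) :=
  (pointwiseBilin K B).contDiff.comp hf

/-- Pointwise application of a continuous family of operators to a continuous function. -/
def pointwiseApply (K : Type v) [TopologicalSpace K] [CompactSpace K]
    (E : Type w) [NormedAddCommGroup E] [NormedSpace ℝ E]
    (G : Type w) [NormedAddCommGroup G] [NormedSpace ℝ G] :
    C(K, E →L[ℝ] G) →L[ℝ] C(K, E) →L[ℝ] C(K, G) :=
  pointwiseBilin K (ContinuousLinearMap.id ℝ (E →L[ℝ] G))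

theorem hasFDerivAt_superposition {G : Type w} [NormedAddCommGroup G] [NormedSpace ℝ G]
    {X : E → G} (hX : ContDiff ℝ 1 X) (x : C(K, E)) :
    HasFDerivAt (fun y : C(K, E) => (⟨X, hX.continuous⟩ : C(E, G)).comp y)
      (pointwiseApply K E G
        ((⟨fderiv ℝ X, hX.continuous_fderiv one_ne_zero⟩ : C(E, E →L[ℝ] G)).comp x)) x := by
  rw [hasFDerivAt_iff_isLittleO_nhds_zero, Asymptotics.isLittleO_iff]
  intro ε hε
  have hcont : Continuous (fderiv ℝ X) := hX.continuous_fderiv one_ne_zero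
  have hu := (isCompact_range x.continuous).uniformContinuousAt_of_continuousAt (fderiv ℝ X)
    (fun a _ => hcont.continuousAt) (Metric.dist_mem_uniformity hε)
  obtain ⟨δ, hδ, hball⟩ := Metric.mem_uniformity_dist.1 hu
  filter_upwards [Metric.ball_mem_nhds (0 : C(K, E)) hδ] with h hh
  rw [mem_ball_zero_iff] at hh
  refine (ContinuousMap.norm_le _ (by positivity)).2 fun s => ?_
  have key := (convex_ball (x s) δ).norm_image_sub_le_of_norm_hasFDerivWithin_le' (f := X)
    (f' := fderiv ℝ X) (φ := fderiv ℝ X (x s)) (C := ε) (x := x s) (y := x s + h s)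
    (fun z _ => ((hX.differentiable one_ne_zero z).hasFDerivAt).hasFDerivWithinAt)
    (fun z hz => by
      have := @hball (x s) z (by rw [dist_comm]; exact hz) (mem_range_self s)
      rw [← dist_eq_norm, dist_comm]; exact this.le)
    (Metric.mem_ball_self hδ)
    (by
      rw [Metric.mem_ball, dist_eq_norm, add_sub_cancel_left]
      exact (h.norm_coe_le_norm s).trans_lt hh)
  rw [add_sub_cancel_left] at key
  exact key.trans (mul_le_mul_of_nonneg_left (h.norm_coe_le_norm s) hε.le)

theorem contDiff_superposition {G : Type w} [NormedAddCommGroup G] [NormedSpace ℝ G]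
    {X : E → G} (hX : ContDiff ℝ ∞ X) :
    ContDiff ℝ ∞ (fun y : C(K, E) => (⟨X, hX.continuous⟩ : C(E, G)).comp y) := by
  rw [contDiff_infty]
  intro n
  induction n generalizing G with
  | zero =>
    have h1 : ContDiff ℝ 1 X := hX.of_le (by norm_cast)
    exact contDiff_zero.2
      (continuous_iff_continuousAt.2 fun x => (hasFDerivAt_superposition h1 x).continuousAt)
  | succ n ih =>
    have h1 : ContDiff ℝ 1 X := hX.of_le (by norm_cast)
    have hd : ContDiff ℝ ∞ (fderiv ℝ X) := hX.fderiv_right (by norm_cast)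
    rw [Nat.cast_add, Nat.cast_one, contDiff_succ_iff_hasFDerivAt]
    exact ⟨fun x => pointwiseApply K E G ((⟨fderiv ℝ X, hd.continuous⟩ : C(E, E →L[ℝ] G)).comp x),
      contDiff_pointwiseBilin_comp _ (ih hd), fun x => hasFDerivAt_superposition h1 x⟩

end Superposition

/-! ### The Volterra operator -/

section Volterra

universe w

variable {E : Type w} [NormedAddCommGroup E] [NormedSpace ℝ E] {k : ℕ} {t : ℝ}

theorem intervalIntegrable_clm_apply {V : Type*} [NormedAddCommGroup V] [NormedSpace ℝ V]
    {A : ℝ → V →L[ℝ] E} {u : ℝ → V} {c d : ℝ}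
    (hA : ContinuousOn A (uIcc c d)) (hu : IntervalIntegrable u volume c d) :
    IntervalIntegrable (fun s => A s (u s)) volume c d := by
  rw [intervalIntegrable_iff] at hu ⊢
  obtain ⟨C, hC⟩ := isCompact_uIcc.exists_bound_of_continuousOn hA
  refine Integrable.mono' (hu.norm.const_mul C) ?_ ?_
  · have h1 : AEStronglyMeasurable A (volume.restrict (uIoc c d)) :=
      ((hA.mono uIoc_subset_uIcc).aestronglyMeasurable measurableSet_uIoc)
    exact (ContinuousLinearMap.id ℝ (V →L[ℝ] E)).aestronglyMeasurable_comp₂ h1 hu.1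
  · filter_upwards [ae_restrict_mem measurableSet_uIoc] with s hs
    exact (A s).le_of_opNorm_le (hC s (uIoc_subset_uIcc hs)) _

theorem ControlSpace.integrableOn (u : ControlSpace k t) : IntegrableOn u (Icc 0 t) :=
  (Lp.memLp u).integrable (by norm_num)

theorem ControlSpace.intervalIntegrable (u : ControlSpace k t) {c d : ℝ} (hc : c ∈ Icc 0 t)
    (hd : d ∈ Icc 0 t) : IntervalIntegrable u volume c d :=
  (u.integrableOn.mono_set (uIcc_subset_Icc hc hd)).intervalIntegrable

theorem ControlSpace.integral_norm_le (u : ControlSpace k t) {c d : ℝ} (hc : c ∈ Icc 0 t)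
    (hd : d ∈ Icc 0 t) (hcd : c ≤ d) : ∫ s in c..d, ‖u s‖ ≤ √(d - c) * ‖u‖ := by
  have hsub : Icc c d ⊆ Icc 0 t := Icc_subset_Icc hc.1 hd.2
  have hmem : MemLp u 2 (volume.restrict (Icc c d)) :=
    (Lp.memLp u).mono_measure (Measure.restrict_mono_set _ hsub)
  have h1 := eLpNorm_le_eLpNorm_mul_rpow_measure_univ (p := 1) (q := 2)
    (μ := volume.restrict (Icc c d)) (by norm_num) hmem.1
  have h2 : eLpNorm u 2 (volume.restrict (Icc c d)) ≤ eLpNorm u 2 (volume.restrict (Icc 0 t)) :=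
    eLpNorm_mono_measure _ (Measure.restrict_mono_set _ hsub)
  rw [eLpNorm_one_eq_lintegral_enorm] at h1
  rw [intervalIntegral.integral_of_le hcd, ← integral_Icc_eq_integral_Ioc,
    integral_norm_eq_lintegral_enorm hmem.1]
  refine (ENNReal.toReal_mono ?_ (h1.trans (mul_le_mul_left h2 _))).trans ?_
  · exact ENNReal.mul_ne_top (Lp.memLp u).2.ne (by simp; norm_num)
  · rw [ENNReal.toReal_mul, mul_comm, ← Lp.norm_def]
    gcongr
    rw [Measure.restrict_apply_univ, Real.volume_Icc, Real.sqrt_eq_rpow,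
      ← ENNReal.toReal_rpow, ENNReal.toReal_ofReal (sub_nonneg.2 hcd)]
    norm_num

variable {a b : ℝ}

variable {W : Type*} [NormedAddCommGroup W] [NormedSpace ℝ W]

theorem intervalIntegrable_IccExtend (B : W →L[ℝ] EuclideanSpace ℝ (Fin k) →L[ℝ] E) (hab : a ≤ b) (h : Icc a b ⊆ Icc 0 t) (u : ControlSpace k t)
    (Y : C(Icc a b, W)) {c d : ℝ} (hc : c ∈ Icc a b) (hd : d ∈ Icc a b) :
    IntervalIntegrable (fun s => B (IccExtend hab Y s) (u s)) volume c d :=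
  intervalIntegrable_clm_apply (B.continuous.comp (Y.continuous.Icc_extend' (h := hab))).continuousOn
    (u.intervalIntegrable (h hc) (h hd))

/-- The primitive of `Y u`, as a continuous function on `[a, b]`. -/
def volterraFun (B : W →L[ℝ] EuclideanSpace ℝ (Fin k) →L[ℝ] E) (hab : a ≤ b) (h : Icc a b ⊆ Icc 0 t) (u : ControlSpace k t)
    (Y : C(Icc a b, W)) : C(Icc a b, E) where
  toFun τ := ∫ s in a..τ, B (IccExtend hab Y s) (u s)
  continuous_toFun := by
    have := intervalIntegral.continuousOn_primitive_interval'
      (intervalIntegrable_IccExtend B hab h u Y (left_mem_Icc.2 hab) (right_mem_Icc.2 hab))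
      (left_mem_uIcc)
    rw [uIcc_of_le hab] at this
    exact this.domRestrict

theorem volterraFun_apply (B : W →L[ℝ] EuclideanSpace ℝ (Fin k) →L[ℝ] E) (hab : a ≤ b) (h : Icc a b ⊆ Icc 0 t) (u : ControlSpace k t)
    (Y : C(Icc a b, W)) (τ : Icc a b) :
    volterraFun B hab h u Y τ = ∫ s in a..τ, B (IccExtend hab Y s) (u s) := rfl

theorem norm_volterraFun_le (B : W →L[ℝ] EuclideanSpace ℝ (Fin k) →L[ℝ] E) (hab : a ≤ b) (h : Icc a b ⊆ Icc 0 t) (u : ControlSpace k t)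
    (Y : C(Icc a b, W)) : ‖volterraFun B hab h u Y‖ ≤ (∫ s in a..b, ‖u s‖) * (‖B‖ * ‖Y‖) := by
  have hu := u.intervalIntegrable (h (left_mem_Icc.2 hab)) (h (right_mem_Icc.2 hab))
  have h0 : 0 ≤ ∫ s in a..b, ‖u s‖ :=
    intervalIntegral.integral_nonneg hab fun _ _ => norm_nonneg _
  refine (ContinuousMap.norm_le _ (by positivity)).2 fun τ => ?_
  rw [volterraFun_apply]
  have hu' := u.intervalIntegrable (h (left_mem_Icc.2 hab)) (h τ.2)
  calc ‖∫ s in a..τ, B (IccExtend hab Y s) (u s)‖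
      ≤ ∫ s in a..τ, ‖u s‖ * (‖B‖ * ‖Y‖) := by
        refine intervalIntegral.norm_integral_le_of_norm_le τ.2.1 ?_ (hu'.norm.mul_const _)
        refine Eventually.of_forall fun s _ => ?_
        rw [mul_comm]
        refine (B.le_opNorm₂ _ _).trans ?_
        gcongr
        exact Y.norm_coe_le_norm _
    _ = (∫ s in a..τ, ‖u s‖) * (‖B‖ * ‖Y‖) := intervalIntegral.integral_mul_const _ _
    _ ≤ (∫ s in a..b, ‖u s‖) * (‖B‖ * ‖Y‖) := by
        gcongr
        exact intervalIntegral.integral_mono_interval le_rfl τ.2.1 τ.2.2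
          (Eventually.of_forall fun _ => norm_nonneg _) hu.norm

theorem ae_uIoc_of_ae_Icc {p : ℝ → Prop} (hp : ∀ᵐ s ∂(volume.restrict (Icc 0 t)), p s) {c d : ℝ}
    (hc : c ∈ Icc 0 t) (hd : d ∈ Icc 0 t) : ∀ᵐ s, s ∈ uIoc c d → p s := by
  rw [ae_restrict_iff' measurableSet_Icc] at hp
  filter_upwards [hp] with s hs hs'
  exact hs (uIcc_subset_Icc hc hd (uIoc_subset_uIcc hs'))

/-- The Volterra operator `(u, Y) ↦ ∫ Y u`, as a bilinear map. -/
def volterraₗ (B : W →L[ℝ] EuclideanSpace ℝ (Fin k) →L[ℝ] E) (hab : a ≤ b) (h : Icc a b ⊆ Icc 0 t) :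
    ControlSpace k t →ₗ[ℝ] C(Icc a b, W) →ₗ[ℝ] C(Icc a b, E) :=
  LinearMap.mk₂ ℝ (fun (u : ControlSpace k t) (Y : C(Icc a b, W)) => volterraFun B hab h u Y)
    (fun u u' Y => by
      ext τ
      have hc := h (left_mem_Icc.2 hab)
      rw [ContinuousMap.add_apply, volterraFun_apply, volterraFun_apply, volterraFun_apply,
        ← intervalIntegral.integral_add
          (intervalIntegrable_IccExtend B hab h u Y (left_mem_Icc.2 hab) τ.2)
          (intervalIntegrable_IccExtend B hab h u' Y (left_mem_Icc.2 hab) τ.2)]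
      refine intervalIntegral.integral_congr_ae ?_
      filter_upwards [ae_uIoc_of_ae_Icc (Lp.coeFn_add u u') hc (h τ.2)] with s hs hs'
      rw [hs hs', Pi.add_apply, map_add])
    (fun c u Y => by
      ext τ
      have hc := h (left_mem_Icc.2 hab)
      rw [ContinuousMap.smul_apply, volterraFun_apply, volterraFun_apply,
        ← intervalIntegral.integral_smul]
      refine intervalIntegral.integral_congr_ae ?_
      filter_upwards [ae_uIoc_of_ae_Icc (Lp.coeFn_smul c u) hc (h τ.2)] with s hs hs'
      rw [hs hs', Pi.smul_apply, map_smul])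
    (fun u Y Y' => by
      ext τ
      rw [ContinuousMap.add_apply, volterraFun_apply, volterraFun_apply, volterraFun_apply,
        ← intervalIntegral.integral_add
          (intervalIntegrable_IccExtend B hab h u Y (left_mem_Icc.2 hab) τ.2)
          (intervalIntegrable_IccExtend B hab h u Y' (left_mem_Icc.2 hab) τ.2)]
      simp [IccExtend])
    (fun c u Y => by
      ext τ
      rw [ContinuousMap.smul_apply, volterraFun_apply, volterraFun_apply,
        ← intervalIntegral.integral_smul]
      simp [IccExtend])

/-- The Volterra operator `(u, Y) ↦ ∫ Y u`. -/
def volterra (B : W →L[ℝ] EuclideanSpace ℝ (Fin k) →L[ℝ] E) (hab : a ≤ b) (h : Icc a b ⊆ Icc 0 t) :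
    ControlSpace k t →L[ℝ] C(Icc a b, W) →L[ℝ] C(Icc a b, E) :=
  LinearMap.mkContinuous₂ (volterraₗ B hab h) (√(b - a) * ‖B‖)
    (fun u Y => by
      refine (norm_volterraFun_le B hab h u Y).trans ?_
      rw [mul_right_comm (√(b - a)), mul_assoc (√(b - a) * ‖u‖)]
      gcongr
      exact u.integral_norm_le (h (left_mem_Icc.2 hab)) (h (right_mem_Icc.2 hab)) hab)

theorem norm_volterra_le (B : W →L[ℝ] EuclideanSpace ℝ (Fin k) →L[ℝ] E) (hab : a ≤ b) (h : Icc a b ⊆ Icc 0 t) (u : ControlSpace k t)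
    (Y : C(Icc a b, W)) : ‖volterra B hab h u Y‖ ≤ (∫ s in a..b, ‖u s‖) * (‖B‖ * ‖Y‖) :=
  norm_volterraFun_le B hab h u Y

end Volterra

/-! ### Smooth dependence of the solutions of a control system in a vector space -/

section LocalSolution

universe w

variable {E : Type w} [NormedAddCommGroup E] [NormedSpace ℝ E] {k : ℕ} {t a b : ℝ}

/-- The inclusion of constant functions. -/
def constCLM (K : Type*) [TopologicalSpace K] [CompactSpace K] (E : Type*) [NormedAddCommGroup E]
    [NormedSpace ℝ E] : E →L[ℝ] C(K, E) :=
  LinearMap.mkContinuous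
    { toFun := fun e => ContinuousMap.const K e
      map_add' := fun _ _ => rfl
      map_smul' := fun _ _ => rfl } 1
    (fun e => (ContinuousMap.norm_le _ (by positivity)).2 fun _ => by rw [one_mul]; exact le_rfl)

/-- A general form of the implicit function argument: `x = L p + A p.2 (N x)`. -/
theorem exists_contDiffAt_fixedPoint {P Q C W : Type*} [NormedAddCommGroup P] [NormedSpace ℝ P]
    [CompleteSpace P] [NormedAddCommGroup Q] [NormedSpace ℝ Q] [CompleteSpace Q]
    [NormedAddCommGroup C] [NormedSpace ℝ C] [CompleteSpace C]
    [NormedAddCommGroup W] [NormedSpace ℝ W]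
    (L : P →L[ℝ] C) (A : Q →L[ℝ] W →L[ℝ] C) {N : C → W} (hN : ContDiff ℝ ∞ N) {N' : C →L[ℝ] W}
    {p : P} {q : Q} {x : C} (hN' : HasFDerivAt N N' x) (hx : x = L p + A q (N x))
    (hsmall : ‖(A q).comp N'‖ < 1) :
    ∃ S : P × Q → C, ContDiffAt ℝ ∞ S (p, q) ∧ S (p, q) = x ∧
      (∀ᶠ z in 𝓝 (p, q), S z = L z.1 + A z.2 (N (S z))) ∧
      ∀ v, fderiv ℝ S (p, q) (0, v) = A v (N x) + A q (N' (fderiv ℝ S (p, q) (0, v))) := by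
  set G : (P × Q) × C → C := fun z => z.2 - (L z.1.1 + A z.1.2 (N z.2)) with hG
  have hGc : ContDiff ℝ ∞ G := by
    have h1 : ContDiff ℝ ∞ fun z : (P × Q) × C => A z.1.2 (N z.2) :=
      (A.contDiff.comp (contDiff_snd.comp contDiff_fst)).clm_apply (hN.comp contDiff_snd)
    have h2 : ContDiff ℝ ∞ fun z : (P × Q) × C => L z.1.1 :=
      L.contDiff.comp (contDiff_fst.comp contDiff_fst)
    exact contDiff_snd.sub (h2.add h1)
  have hne : (∞ : ℕ∞ω) ≠ 0 := by simp
  have hpart : fderiv ℝ G ((p, q), x) ∘L .inr ℝ (P × Q) C =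
      ContinuousLinearMap.id ℝ C - (A q).comp N' := by
    have h1 : HasFDerivAt (fun y : C => G ((p, q), y))
        (fderiv ℝ G ((p, q), x) ∘L .inr ℝ (P × Q) C) x :=
      ((hGc.differentiable hne _).hasFDerivAt).comp x (hasFDerivAt_prodMk_right (p, q) x)
    have h2 : HasFDerivAt (fun y : C => G ((p, q), y))
        (ContinuousLinearMap.id ℝ C - (A q).comp N') x :=
      (hasFDerivAt_id x).sub (((A q).hasFDerivAt.comp x hN').const_add (L p))
    exact h1.unique h2
  have hinv : (fderiv ℝ G ((p, q), x) ∘L .inr ℝ (P × Q) C).IsInvertible := by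
    rw [hpart]
    exact ⟨ContinuousLinearEquiv.ofUnit (Units.oneSub _ hsmall), rfl⟩
  have hGat : ContDiffAt ℝ ∞ G ((p, q), x) := hGc.contDiffAt
  have hG0 : G ((p, q), x) = 0 := sub_eq_zero.2 hx
  refine ⟨hGat.implicitFunction hne hinv, hGat.contDiffAt_implicitFunction hne hinv,
    hGat.implicitFunction_apply_self hne hinv, ?_, ?_⟩
  · filter_upwards [hGat.eventually_apply_implicitFunction hne hinv] with z hz
    rw [hG0] at hz
    exact sub_eq_zero.1 hz
  · set S := hGat.implicitFunction hne hinv with hS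
    have hSx : S (p, q) = x := hGat.implicitFunction_apply_self hne hinv
    have hSd : HasFDerivAt S (fderiv ℝ S (p, q)) (p, q) :=
      ((hGat.contDiffAt_implicitFunction hne hinv).differentiableAt hne).hasFDerivAt
    have hev : S =ᶠ[𝓝 (p, q)] fun z => L z.1 + A z.2 (N (S z)) := by
      filter_upwards [hGat.eventually_apply_implicitFunction hne hinv] with z hz
      rw [hG0] at hz
      exact sub_eq_zero.1 hz
    have hR := ((L.hasFDerivAt.comp (p, q) hasFDerivAt_fst).add
      ((A.hasFDerivAt.comp (p, q) hasFDerivAt_snd).clm_apply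
        (HasFDerivAt.comp (p, q) (hSx.symm ▸ hN') hSd)))
    have := hSd.unique (hR.congr_of_eventuallyEq hev)
    intro v
    conv_lhs => rw [this]
    simp [hSx, add_comm]

theorem norm_volterra_le_of_forall_le {W : Type*} [NormedAddCommGroup W] [NormedSpace ℝ W]
    {B : W →L[ℝ] EuclideanSpace ℝ (Fin k) →L[ℝ] E} (hB : ‖B‖ ≤ 1) (hab : a ≤ b) (h : Icc a b ⊆ Icc 0 t)
    (u : ControlSpace k t) (Y : C(Icc a b, W)) {D : ℝ} (hD : 0 ≤ D) (hY : ∀ τ, ‖Y τ‖ ≤ D) :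
    ‖volterra B hab h u Y‖ ≤ (∫ s in a..b, ‖u s‖) * D := by
  have hu0 : 0 ≤ ∫ s in a..b, ‖u s‖ :=
    intervalIntegral.integral_nonneg hab fun _ _ => norm_nonneg _
  refine (norm_volterra_le B hab h u Y).trans ?_
  gcongr
  refine (mul_le_of_le_one_left (norm_nonneg _) hB).trans ?_
  exact (ContinuousMap.norm_le _ hD).2 hY

variable [CompleteSpace E]

theorem exists_contDiffAt_solutionMap {X : E → EuclideanSpace ℝ (Fin k) →L[ℝ] E} (hX : ContDiff ℝ ∞ X)
    (hab : a ≤ b) (h : Icc a b ⊆ Icc 0 t) (u : ControlSpace k t) (x : C(Icc a b, E)) (p : E)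
    (hsol : ∀ τ : Icc a b, x τ = p + ∫ s in a..τ, X (IccExtend hab x s) (u s)) {C : ℝ}
    (hC : ∀ τ, ‖fderiv ℝ X (x τ)‖ ≤ C) (hsmall : (∫ s in a..b, ‖u s‖) * C < 1) :
    ∃ S : E × ControlSpace k t → C(Icc a b, E), ContDiffAt ℝ ∞ S (p, u) ∧ S (p, u) = x ∧
      (∀ᶠ z in 𝓝 (p, u), ∀ τ : Icc a b,
        S z τ = z.1 + ∫ s in a..τ, X (IccExtend hab (S z) s) (z.2 s)) ∧
      ∀ v : ControlSpace k t, ∀ τ : Icc a b, fderiv ℝ S (p, u) (0, v) τ =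
        (∫ s in a..τ, X (IccExtend hab x s) (v s)) +
        ∫ s in a..τ, fderiv ℝ X (IccExtend hab x s)
          (IccExtend hab (fderiv ℝ S (p, u) (0, v)) s) (u s) := by
  have hX1 : ContDiff ℝ 1 X := hX.of_le (by norm_cast)
  have hN := contDiff_superposition (K := Icc a b) hX
  have hN' := hasFDerivAt_superposition (K := Icc a b) hX1 x
  have hid : ‖ContinuousLinearMap.id ℝ (EuclideanSpace ℝ (Fin k) →L[ℝ] E)‖ ≤ 1 := ContinuousLinearMap.norm_id_le
  have hC0 : 0 ≤ C := le_trans (norm_nonneg (fderiv ℝ X (x ⟨a, left_mem_Icc.2 hab⟩))) (hC _)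
  have hu0 : 0 ≤ ∫ s in a..b, ‖u s‖ :=
    intervalIntegral.integral_nonneg hab fun _ _ => norm_nonneg _
  obtain ⟨S, h1, h2, h3, h4⟩ := exists_contDiffAt_fixedPoint (constCLM (Icc a b) E)
    (volterra (ContinuousLinearMap.id ℝ (EuclideanSpace ℝ (Fin k) →L[ℝ] E)) hab h) hN hN' (p := p) (q := u)
    (by ext τ; exact hsol τ)
    (by
      refine lt_of_le_of_lt (ContinuousLinearMap.opNorm_le_bound _ (by positivity) fun y => ?_)
        hsmall
      rw [mul_assoc]
      exact norm_volterra_le_of_forall_le hid hab h u _ (by positivity) fun τ =>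
        ContinuousLinearMap.le_of_opNorm_le_of_le _ (hC τ) (y.norm_coe_le_norm τ))
  refine ⟨S, h1, h2, ?_, ?_⟩
  · filter_upwards [h3] with z hz τ
    conv_lhs => rw [hz]
    rfl
  · intro v τ
    conv_lhs => rw [h4]
    rfl

end LocalSolution

/-! ### Short-time estimates for solutions and their variations -/

section Estimates

variable {E V : Type*} [NormedAddCommGroup E] [NormedSpace ℝ E]
  [NormedAddCommGroup V] [NormedSpace ℝ V] {a b C : ℝ}

theorem norm_le_two_mul_of_absorb {y : ℝ → E} (hy : ContinuousOn y (Icc a b)) {K : ℝ}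
    (h : ∀ M, (∀ s ∈ Icc a b, ‖y s‖ ≤ M) → ∀ τ ∈ Icc a b, ‖y τ‖ ≤ K + M / 2) :
    ∀ τ ∈ Icc a b, ‖y τ‖ ≤ 2 * K := by
  intro τ hτ
  obtain ⟨s, hs, hmax⟩ := isCompact_Icc.exists_isMaxOn ⟨τ, hτ⟩ hy.norm
  have h1 := h ‖y s‖ (fun r hr => hmax hr) s hs
  have h2 : ‖y τ‖ ≤ ‖y s‖ := hmax hτ
  linarith

theorem norm_integral_le_of_ae_le_mul_norm_add {f : ℝ → E} {w : ℝ → V}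
    (hw : IntervalIntegrable w volume a b) {P Q : ℝ} (hP : 0 ≤ P) (hQ : 0 ≤ Q)
    (hf : ∀ᵐ s, s ∈ Ioc a b → ‖f s‖ ≤ P * ‖w s‖ + Q) {c d : ℝ} (hac : a ≤ c) (hcd : c ≤ d)
    (hdb : d ≤ b) : ‖∫ s in c..d, f s‖ ≤ P * (∫ s in a..b, ‖w s‖) + Q * (b - a) := by
  have hsub : uIcc c d ⊆ uIcc a b := by
    rw [uIcc_of_le hcd, uIcc_of_le (hac.trans (hcd.trans hdb))]
    exact Icc_subset_Icc hac hdb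
  have hw' : IntervalIntegrable w volume c d := hw.mono_set hsub
  calc ‖∫ s in c..d, f s‖ ≤ ∫ s in c..d, (P * ‖w s‖ + Q) := by
        refine intervalIntegral.norm_integral_le_of_norm_le hcd ?_
          ((hw'.norm.const_mul P).add intervalIntegrable_const)
        filter_upwards [hf] with s hs hs'
        exact hs ⟨hac.trans_lt hs'.1, hs'.2.trans hdb⟩
    _ = P * (∫ s in c..d, ‖w s‖) + Q * (d - c) := by
        rw [intervalIntegral.integral_add (hw'.norm.const_mul P) intervalIntegrable_const,
          intervalIntegral.integral_const_mul, intervalIntegral.integral_const, smul_eq_mul,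
          mul_comm Q]
    _ ≤ P * (∫ s in a..b, ‖w s‖) + Q * (b - a) := by
        gcongr
        exact intervalIntegral.integral_mono_interval hac hcd hdb
          (Eventually.of_forall fun _ => norm_nonneg _) hw.norm

/-- `x` solves `x' = X(x) u` on `[a, b]`, in integrated form. -/
def IsIntegralSolution (X : E → V →L[ℝ] E) (u : ℝ → V) (a b : ℝ) (x : ℝ → E) : Prop :=
  ContinuousOn x (Icc a b) ∧ ∀ τ ∈ Icc a b, x τ = x a + ∫ s in a..τ, X (x s) (u s)

/-- `y` solves the linearization along `x` of `x' = X(x) u` in the direction of the control `v`. -/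
def IsVariation (X : E → V →L[ℝ] E) (u : ℝ → V) (x : ℝ → E) (v : ℝ → V) (a b : ℝ)
    (y : ℝ → E) : Prop :=
  ContinuousOn y (Icc a b) ∧ ∀ τ ∈ Icc a b,
    y τ = (∫ s in a..τ, X (x s) (v s)) + ∫ s in a..τ, fderiv ℝ X (x s) (y s) (u s)

/-- The constant `C` bounds `X`, its derivative, and their Lipschitz constants. -/
structure IsC2Bound (X : E → V →L[ℝ] E) (C : ℝ) : Prop where
  contDiff : ContDiff ℝ 1 X
  nonneg : 0 ≤ C
  norm_le : ∀ x, ‖X x‖ ≤ C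
  norm_fderiv_le : ∀ x, ‖fderiv ℝ X x‖ ≤ C
  norm_sub_le : ∀ x y, ‖X x - X y‖ ≤ C * ‖x - y‖
  norm_fderiv_sub_le : ∀ x y, ‖fderiv ℝ X x - fderiv ℝ X y‖ ≤ C * ‖x - y‖

variable {X : E → V →L[ℝ] E} {u u' v : ℝ → V} {x x' y y' : ℝ → E}

theorem intervalIntegrable_field (hX : Continuous X) (hx : ContinuousOn x (Icc a b))
    (hu : IntervalIntegrable u volume a b) {c d : ℝ} (hc : c ∈ Icc a b) (hd : d ∈ Icc a b) :
    IntervalIntegrable (fun s => X (x s) (u s)) volume c d := by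
  have hsub : uIcc c d ⊆ Icc a b := uIcc_subset_Icc hc hd
  exact intervalIntegrable_clm_apply ((hX.comp_continuousOn hx).mono hsub)
    (hu.mono_set (by rwa [uIcc_of_le (hc.1.trans hc.2)]))

theorem IsIntegralSolution.sub_eq (hX : Continuous X) (hx : IsIntegralSolution X u a b x)
    (hu : IntervalIntegrable u volume a b) {c d : ℝ} (hc : c ∈ Icc a b) (hd : d ∈ Icc a b) :
    x d - x c = ∫ s in c..d, X (x s) (u s) := by
  have ha : a ∈ Icc a b := left_mem_Icc.2 (hc.1.trans hc.2)
  rw [hx.2 d hd, hx.2 c hc, add_sub_add_left_eq_sub,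
    intervalIntegral.integral_interval_sub_left (intervalIntegrable_field hX hx.1 hu ha hd)
      (intervalIntegrable_field hX hx.1 hu ha hc)]

theorem IsVariation.norm_le (hC : IsC2Bound X C) (hy : IsVariation X u x v a b y)
    (hv : IntervalIntegrable v volume a b) (hu1 : ∀ᵐ s, s ∈ Ioc a b → ‖u s‖ ≤ 1)
    (hsmall : C * (b - a) ≤ 1 / 2) :
    ∀ τ ∈ Icc a b, ‖y τ‖ ≤ 2 * (C * ∫ s in a..b, ‖v s‖) := by
  refine norm_le_two_mul_of_absorb hy.1 fun M hM τ hτ => ?_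
  have hM0 : 0 ≤ M := (norm_nonneg _).trans (hM τ hτ)
  have hab : a ≤ b := hτ.1.trans hτ.2
  rw [hy.2 τ hτ]
  have h1 : ‖∫ s in a..τ, X (x s) (v s)‖ ≤ C * (∫ s in a..b, ‖v s‖) + 0 * (b - a) :=
    norm_integral_le_of_ae_le_mul_norm_add hv hC.nonneg le_rfl
      (Eventually.of_forall fun s _ => by
        rw [add_zero]; exact (X (x s)).le_of_opNorm_le (hC.norm_le _) _) le_rfl hτ.1 hτ.2
  have h2 : ‖∫ s in a..τ, fderiv ℝ X (x s) (y s) (u s)‖ ≤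
      0 * (∫ s in a..b, ‖v s‖) + (C * M) * (b - a) := by
    refine norm_integral_le_of_ae_le_mul_norm_add hv le_rfl (by have := hC.nonneg; positivity) ?_
      le_rfl hτ.1 hτ.2
    filter_upwards [hu1] with s hs hs'
    rw [zero_mul, zero_add]
    have := (fderiv ℝ X (x s)).le_of_opNorm_le_of_le (hC.norm_fderiv_le _)
      (hM s ⟨hs'.1.le, hs'.2⟩)
    simpa using ContinuousLinearMap.le_of_opNorm_le_of_le _ this (hs hs')
  have h3 : C * M * (b - a) ≤ M / 2 := by nlinarith
  refine (norm_add_le _ _).trans ?_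
  linarith

theorem IsVariation.norm_endpoint_sub_le (hC : IsC2Bound X C) (hx : IsIntegralSolution X u a b x)
    [CompleteSpace V] [CompleteSpace E]
    (hy : IsVariation X u x v a b y) (hab : a ≤ b)
    (hu : IntervalIntegrable u volume a b) (hv : IntervalIntegrable v volume a b)
    (hu1 : ∀ᵐ s, s ∈ Ioc a b → ‖u s‖ ≤ 1) (hsmall : C * (b - a) ≤ 1 / 2) :
    ‖y b - X (x b) (∫ s in a..b, v s)‖ ≤ 3 * C ^ 2 * (b - a) * ∫ s in a..b, ‖v s‖ := by
  have hb : b ∈ Icc a b := right_mem_Icc.2 hab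
  have hC0 := hC.nonneg
  have hba : 0 ≤ b - a := sub_nonneg.2 hab
  have hV0 : 0 ≤ ∫ s in a..b, ‖v s‖ :=
    intervalIntegral.integral_nonneg hab fun _ _ => norm_nonneg _
  have hxb : ∀ s ∈ Icc a b, ‖x s - x b‖ ≤ C * (b - a) := by
    intro s hs
    rw [norm_sub_rev, hx.sub_eq hC.contDiff.continuous hu hs hb]
    have := norm_integral_le_of_ae_le_mul_norm_add (f := fun s => X (x s) (u s)) hv le_rfl
      hC0 (by
        filter_upwards [hu1] with r hr hr'
        rw [zero_mul, zero_add]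
        simpa using ContinuousLinearMap.le_of_opNorm_le_of_le _ (hC.norm_le (x r)) (hr hr'))
      hs.1 hs.2 le_rfl
    linarith
  have hyb := hy.norm_le hC hv hu1 hsmall
  have hI1 : IntervalIntegrable (fun s => X (x s) (v s)) volume a b :=
    intervalIntegrable_clm_apply (by
      rw [uIcc_of_le hab]; exact hC.contDiff.continuous.comp_continuousOn hx.1) hv
  have h1 : ‖∫ s in a..b, (X (x s) (v s) - X (x b) (v s))‖ ≤
      (C * (C * (b - a))) * (∫ s in a..b, ‖v s‖) + 0 * (b - a) := by
    refine norm_integral_le_of_ae_le_mul_norm_add hv (by positivity) le_rfl ?_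
      le_rfl hab le_rfl
    refine Eventually.of_forall fun s hs => ?_
    rw [add_zero, ← sub_apply]
    refine ContinuousLinearMap.le_of_opNorm_le _ ((hC.norm_sub_le _ _).trans ?_) _
    gcongr
    exact hxb s ⟨hs.1.le, hs.2⟩
  have h2 : ‖∫ s in a..b, fderiv ℝ X (x s) (y s) (u s)‖ ≤
      0 * (∫ s in a..b, ‖v s‖) + (C * (2 * (C * ∫ s in a..b, ‖v s‖))) * (b - a) := by
    refine norm_integral_le_of_ae_le_mul_norm_add hv le_rfl (by positivity) ?_
      le_rfl hab le_rfl
    filter_upwards [hu1] with s hs hs'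
    rw [zero_mul, zero_add]
    have := (fderiv ℝ X (x s)).le_of_opNorm_le_of_le (hC.norm_fderiv_le _)
      (hyb s ⟨hs'.1.le, hs'.2⟩)
    simpa using ContinuousLinearMap.le_of_opNorm_le_of_le _ this (hs hs')
  have h3 : y b - X (x b) (∫ s in a..b, v s) =
      (∫ s in a..b, (X (x s) (v s) - X (x b) (v s))) +
        ∫ s in a..b, fderiv ℝ X (x s) (y s) (u s) := by
    rw [hy.2 b hb, intervalIntegral.integral_sub hI1
      (intervalIntegrable_clm_apply continuousOn_const hv),
      (X (x b)).intervalIntegral_comp_comm hv]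
    abel
  rw [h3]
  refine (norm_add_le _ _).trans ?_
  nlinarith

theorem IsIntegralSolution.norm_sub_le (hC : IsC2Bound X C) (hx : IsIntegralSolution X u a b x)
    (hx' : IsIntegralSolution X u' a b x') (hxb : x b = x' b)
    (hu : IntervalIntegrable u volume a b) (hu' : IntervalIntegrable u' volume a b)
    (hu1' : ∀ᵐ s, s ∈ Ioc a b → ‖u' s‖ ≤ 1) (hsmall : C * (b - a) ≤ 1 / 2) :
    ∀ τ ∈ Icc a b, ‖x τ - x' τ‖ ≤ 2 * (C * ∫ s in a..b, ‖u s - u' s‖) := by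
  refine norm_le_two_mul_of_absorb (y := fun τ => x τ - x' τ) (hx.1.sub hx'.1)
    fun M hM τ hτ => ?_
  have hM0 : 0 ≤ M := (norm_nonneg _).trans (hM τ hτ)
  have hab : a ≤ b := hτ.1.trans hτ.2
  have hC0 := hC.nonneg
  have hb : b ∈ Icc a b := right_mem_Icc.2 hab
  have hXc := hC.contDiff.continuous
  have h1 : x τ - x' τ = -∫ s in τ..b, (X (x s) (u s) - X (x' s) (u' s)) := by
    rw [intervalIntegral.integral_sub
      (intervalIntegrable_field hXc hx.1 hu hτ hb)
      (intervalIntegrable_field hXc hx'.1 hu' hτ hb),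
      ← hx.sub_eq hXc hu hτ hb, ← hx'.sub_eq hXc hu' hτ hb, hxb]
    abel
  rw [h1, norm_neg]
  have h2 := norm_integral_le_of_ae_le_mul_norm_add
    (f := fun s => X (x s) (u s) - X (x' s) (u' s)) (hu.sub hu') hC0 (Q := C * M) (by positivity)
    (by
      filter_upwards [hu1'] with s hs hs'
      have e : X (x s) (u s) - X (x' s) (u' s) =
          X (x s) (u s - u' s) + (X (x s) - X (x' s)) (u' s) := by
        simp
      rw [e]
      refine (norm_add_le _ _).trans (add_le_add ?_ ?_)
      · exact (X (x s)).le_of_opNorm_le (hC.norm_le _) _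
      · have := (hC.norm_sub_le (x s) (x' s)).trans
          (mul_le_mul_of_nonneg_left (hM s ⟨hs'.1.le, hs'.2⟩) hC0)
        simpa using ContinuousLinearMap.le_of_opNorm_le_of_le _ this (hs hs')) hτ.1 hτ.2 le_rfl
  have h3 : C * M * (b - a) ≤ M / 2 := by nlinarith
  linarith

theorem IsVariation.norm_sub_le (hC : IsC2Bound X C) (hx : IsIntegralSolution X u a b x)
    (hx' : IsIntegralSolution X u' a b x') (hxb : x b = x' b)
    (hu : IntervalIntegrable u volume a b) (hu' : IntervalIntegrable u' volume a b)
    (hu1 : ∀ᵐ s, s ∈ Ioc a b → ‖u s‖ ≤ 1)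
    (hu1' : ∀ᵐ s, s ∈ Ioc a b → ‖u' s‖ ≤ 1) (hsmall : C * (b - a) ≤ 1 / 2)
    (hv : ∀ᵐ s, s ∈ Ioc a b → v s = u s - u' s)
    (hy : IsVariation X u x v a b y) (hy' : IsVariation X u' x' v a b y') :
    ∀ τ ∈ Icc a b, ‖y τ - y' τ‖ ≤ 2 * (6 * C ^ 2 * (∫ s in a..b, ‖u s - u' s‖) ^ 2) := by
  refine norm_le_two_mul_of_absorb (y := fun τ => y τ - y' τ) (hy.1.sub hy'.1)
    fun M hM τ hτ => ?_
  have hM0 : 0 ≤ M := (norm_nonneg _).trans (hM τ hτ)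
  have hab : a ≤ b := hτ.1.trans hτ.2
  have hC0 := hC.nonneg
  have hXc := hC.contDiff.continuous
  have hDc : Continuous (fderiv ℝ X) := hC.contDiff.continuous_fderiv one_ne_zero
  have hw : IntervalIntegrable (fun s => u s - u' s) volume a b := hu.sub hu'
  set W := ∫ s in a..b, ‖u s - u' s‖ with hW
  have hW0 : 0 ≤ W := intervalIntegral.integral_nonneg hab fun _ _ => norm_nonneg _
  have hvi : IntervalIntegrable v volume a b := by
    refine hw.congr_ae ?_
    rw [uIoc_of_le hab]
    exact (ae_restrict_iff' measurableSet_Ioc).2 (hv.mono fun s hs hs' => (hs hs').symm)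
  have hvW : ∫ s in a..b, ‖v s‖ = W := by
    refine intervalIntegral.integral_congr_ae ?_
    rw [uIoc_of_le hab]
    exact hv.mono fun s hs hs' => by rw [hs hs']
  have hd := hx.norm_sub_le hC hx' hxb hu hu' hu1' hsmall
  have hyb' := hy'.norm_le hC hvi hu1' hsmall
  rw [hvW] at hyb'
  have hsub : uIcc a τ ⊆ Icc a b := by rw [uIcc_of_le hτ.1]; exact Icc_subset_Icc le_rfl hτ.2
  have hsub' : uIcc a τ ⊆ uIcc a b := by rwa [uIcc_of_le hab]
  have hvτ := hvi.mono_set hsub'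
  have i1 : IntervalIntegrable (fun s => X (x s) (v s)) volume a τ :=
    intervalIntegrable_clm_apply ((hXc.comp_continuousOn hx.1).mono hsub) hvτ
  have i1' : IntervalIntegrable (fun s => X (x' s) (v s)) volume a τ :=
    intervalIntegrable_clm_apply ((hXc.comp_continuousOn hx'.1).mono hsub) hvτ
  have i2 : IntervalIntegrable (fun s => fderiv ℝ X (x s) (y s) (u s)) volume a τ :=
    intervalIntegrable_clm_apply
      (((hDc.comp_continuousOn hx.1).clm_apply hy.1).mono hsub) (hu.mono_set hsub')
  have i2' : IntervalIntegrable (fun s => fderiv ℝ X (x' s) (y' s) (u' s)) volume a τ :=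
    intervalIntegrable_clm_apply
      (((hDc.comp_continuousOn hx'.1).clm_apply hy'.1).mono hsub) (hu'.mono_set hsub')
  have h1 : y τ - y' τ = ∫ s in a..τ, ((X (x s) (v s) + fderiv ℝ X (x s) (y s) (u s)) -
      (X (x' s) (v s) + fderiv ℝ X (x' s) (y' s) (u' s))) := by
    rw [hy.2 τ hτ, hy'.2 τ hτ, ← intervalIntegral.integral_add i1 i2,
      ← intervalIntegral.integral_add i1' i2', ← intervalIntegral.integral_sub (i1.add i2)
      (i1'.add i2')]
  rw [h1]
  have h2 := norm_integral_le_of_ae_le_mul_norm_add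
    (f := fun s => (X (x s) (v s) + fderiv ℝ X (x s) (y s) (u s)) -
      (X (x' s) (v s) + fderiv ℝ X (x' s) (y' s) (u' s))) hw
    (P := C * (2 * (C * W)) + C * (2 * (C * W)))
    (Q := C * M + C * (2 * (C * W)) * (2 * (C * W))) (by positivity) (by positivity)
    (by
      filter_upwards [hu1, hu1', hv] with s hs1 hs1' hsv hs
      rw [hsv hs]
      have hs' : s ∈ Icc a b := ⟨hs.1.le, hs.2⟩
      have e : (X (x s) (u s - u' s) + fderiv ℝ X (x s) (y s) (u s)) -
          (X (x' s) (u s - u' s) + fderiv ℝ X (x' s) (y' s) (u' s)) =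
          ((X (x s) - X (x' s)) (u s - u' s) + fderiv ℝ X (x s) (y' s) (u s - u' s)) +
          (fderiv ℝ X (x s) (y s - y' s) (u s) +
            (fderiv ℝ X (x s) - fderiv ℝ X (x' s)) (y' s) (u' s)) := by
        simp only [map_sub, sub_apply]
        abel
      rw [e, add_mul]
      refine (norm_add_le _ _).trans (add_le_add ((norm_add_le _ _).trans (add_le_add ?_ ?_))
        ((norm_add_le _ _).trans (add_le_add ?_ ?_)))
      · exact ContinuousLinearMap.le_of_opNorm_le _ ((hC.norm_sub_le _ _).trans
          (mul_le_mul_of_nonneg_left (hd s hs') hC0)) _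
      · exact ContinuousLinearMap.le_of_opNorm_le _ (ContinuousLinearMap.le_of_opNorm_le_of_le _
          (hC.norm_fderiv_le _) (hyb' s hs')) _
      · have := (fderiv ℝ X (x s)).le_of_opNorm_le_of_le (hC.norm_fderiv_le _) (hM s hs')
        simpa using ContinuousLinearMap.le_of_opNorm_le_of_le _ this (hs1 hs)
      · have := ContinuousLinearMap.le_of_opNorm_le_of_le _ ((hC.norm_fderiv_sub_le _ _).trans
          (mul_le_mul_of_nonneg_left (hd s hs') hC0)) (hyb' s hs')
        simpa using ContinuousLinearMap.le_of_opNorm_le_of_le _ this (hs1' hs)) le_rfl hτ.1 hτ.2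
  rw [← hW] at h2
  have h3 : C * M * (b - a) ≤ M / 2 := by nlinarith
  have h4 : C * (2 * (C * W)) * (2 * (C * W)) * (b - a) ≤ 2 * (C ^ 2 * W ^ 2) := by
    have : C * (2 * (C * W)) * (2 * (C * W)) * (b - a) = 4 * (C ^ 2 * W ^ 2) * (C * (b - a)) := by
      ring
    rw [this]
    have : 0 ≤ C ^ 2 * W ^ 2 := by positivity
    nlinarith
  refine h2.trans ?_
  nlinarith

/-- Two solutions of the same system that agree at `a` agree on a short interval. -/
theorem IsIntegralSolution.eqOn (hC : IsC2Bound X C) (hx : IsIntegralSolution X u a b x)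
    (hx' : IsIntegralSolution X u a b x') (hxa : x a = x' a)
    (hu : IntervalIntegrable u volume a b) (hsmall : C * (∫ s in a..b, ‖u s‖) ≤ 1 / 2) :
    ∀ τ ∈ Icc a b, x τ = x' τ := by
  suffices ∀ τ ∈ Icc a b, ‖x τ - x' τ‖ ≤ 2 * 0 by
    intro τ hτ
    have := this τ hτ
    rw [mul_zero] at this
    exact sub_eq_zero.1 (norm_le_zero_iff.1 this)
  refine norm_le_two_mul_of_absorb (y := fun τ => x τ - x' τ) (hx.1.sub hx'.1)
    fun M hM τ hτ => ?_
  have hM0 : 0 ≤ M := (norm_nonneg _).trans (hM τ hτ)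
  have hab : a ≤ b := hτ.1.trans hτ.2
  have hC0 := hC.nonneg
  have hXc := hC.contDiff.continuous
  have ha : a ∈ Icc a b := left_mem_Icc.2 hab
  have h1 : x τ - x' τ = ∫ s in a..τ, (X (x s) (u s) - X (x' s) (u s)) := by
    rw [intervalIntegral.integral_sub
      (intervalIntegrable_field hXc hx.1 hu ha hτ)
      (intervalIntegrable_field hXc hx'.1 hu ha hτ),
      hx.2 τ hτ, hx'.2 τ hτ, hxa]
    abel
  rw [h1]
  have h2 := norm_integral_le_of_ae_le_mul_norm_add
    (f := fun s => X (x s) (u s) - X (x' s) (u s)) hu (P := C * M) (by positivity) le_rfl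
    (Eventually.of_forall fun s hs => by
      rw [add_zero, ← sub_apply]
      exact ContinuousLinearMap.le_of_opNorm_le _ ((hC.norm_sub_le _ _).trans
        (mul_le_mul_of_nonneg_left (hM s ⟨hs.1.le, hs.2⟩) hC0)) _) le_rfl hτ.1 hτ.2
  nlinarith

/-- A `C¹` function of compact support is bounded and Lipschitz, and has bounded derivative. -/
theorem exists_bound_of_contDiff_of_hasCompactSupport {G : Type*} [NormedAddCommGroup G]
    [NormedSpace ℝ G] {f : E → G} (hf : ContDiff ℝ 1 f) (hs : HasCompactSupport f) :
    ∃ C, 0 ≤ C ∧ (∀ x, ‖f x‖ ≤ C) ∧ (∀ x, ‖fderiv ℝ f x‖ ≤ C) ∧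
      ∀ x y, ‖f x - f y‖ ≤ C * ‖x - y‖ := by
  obtain ⟨C₀, hC₀⟩ := hs.exists_bound_of_continuous hf.continuous
  obtain ⟨C₁, hC₁⟩ := (hs.fderiv (𝕜 := ℝ)).exists_bound_of_continuous
    (hf.continuous_fderiv one_ne_zero)
  refine ⟨max |C₀| |C₁|, by positivity,
    fun x => (hC₀ x).trans ((le_abs_self _).trans (le_max_left _ _)),
    fun x => (hC₁ x).trans ((le_abs_self _).trans (le_max_right _ _)), fun x y => ?_⟩
  exact convex_univ.norm_image_sub_le_of_norm_fderiv_le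
    (fun z _ => hf.differentiable one_ne_zero z)
    (fun z _ => (hC₁ z).trans ((le_abs_self _).trans (le_max_right _ _)))
    (mem_univ y) (mem_univ x)

/-- A smooth field of compact support has a `C²` bound. -/
theorem exists_isC2Bound {X : E → V →L[ℝ] E} (hX : ContDiff ℝ ∞ X)
    (hs : HasCompactSupport X) : ∃ C, IsC2Bound X C := by
  have h1 : ContDiff ℝ 1 X := hX.of_le (by norm_cast)
  have h2 : ContDiff ℝ 1 (fderiv ℝ X) := hX.fderiv_right (by norm_cast)
  obtain ⟨C, hC, hC0, hC1, hC2⟩ := exists_bound_of_contDiff_of_hasCompactSupport h1 hs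
  obtain ⟨D, hD, hD0, hD1, hD2⟩ :=
    exists_bound_of_contDiff_of_hasCompactSupport h2 (hs.fderiv (𝕜 := ℝ))
  exact ⟨max C D, h1, hC.trans (le_max_left _ _), fun x => (hC0 x).trans (le_max_left _ _),
    fun x => (hC1 x).trans (le_max_left _ _),
    fun x y => (hC2 x y).trans (mul_le_mul_of_nonneg_right (le_max_left _ _) (norm_nonneg _)),
    fun x y => (hD2 x y).trans (mul_le_mul_of_nonneg_right (le_max_right _ _) (norm_nonneg _))⟩

end Estimates

/-! ### Absolutely continuous curves in a vector space -/

section AbsolutelyContinuous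

variable {E G : Type*} [NormedAddCommGroup E] [NormedSpace ℝ E] [NormedAddCommGroup G]
  [NormedSpace ℝ G] {a b : ℝ}

theorem AbsolutelyContinuousOnInterval.of_dist_le {A B : Type*} [PseudoMetricSpace A]
    [PseudoMetricSpace B] {f : ℝ → A} {g : ℝ → B} (hf : AbsolutelyContinuousOnInterval f a b)
    (K : ℝ≥0) (h : ∀ x ∈ uIcc a b, ∀ y ∈ uIcc a b, dist (g x) (g y) ≤ K * dist (f x) (f y)) :
    AbsolutelyContinuousOnInterval g a b := by
  rw [absolutelyContinuousOnInterval_iff] at hf ⊢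
  intro ε hε
  obtain ⟨δ, hδ, hf⟩ := hf (ε / (K + 1)) (by positivity)
  refine ⟨δ, hδ, fun P hP hlen => ?_⟩
  have h1 := hf P hP hlen
  calc ∑ i ∈ Finset.range P.1, dist (g (P.2 i).1) (g (P.2 i).2)
      ≤ ∑ i ∈ Finset.range P.1, (K : ℝ) * dist (f (P.2 i).1) (f (P.2 i).2) :=
        Finset.sum_le_sum fun i hi => h _ (hP.1 i hi).1 _ (hP.1 i hi).2
    _ = K * ∑ i ∈ Finset.range P.1, dist (f (P.2 i).1) (f (P.2 i).2) := by rw [Finset.mul_sum]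
    _ ≤ K * (ε / (K + 1)) := by gcongr
    _ < (K + 1) * (ε / (K + 1)) := by gcongr; linarith
    _ = ε := by field

theorem AbsolutelyContinuousOnInterval.comp_contDiffOn {x : ℝ → E} {g : E → G} {O : Set E}
    (hx : AbsolutelyContinuousOnInterval x a b) (hO : IsOpen O) (hg : ContDiffOn ℝ 1 g O)
    (hmem : ∀ τ ∈ uIcc a b, x τ ∈ O) : AbsolutelyContinuousOnInterval (g ∘ x) a b := by
  have hcpt : IsCompact (x '' uIcc a b) := isCompact_uIcc.image_of_continuousOn hx.continuousOn
  obtain ⟨K, hK⟩ := LocallyLipschitzOn.exists_lipschitzOnWith_of_compact (f := g) hcpt (by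
    rintro _ ⟨τ, hτ, rfl⟩
    obtain ⟨K, s, hs, hl⟩ :=
      (hg.contDiffAt (hO.mem_nhds (hmem τ hτ))).exists_lipschitzOnWith
    exact ⟨K, s, mem_nhdsWithin_of_mem_nhds hs, hl⟩)
  exact hx.of_dist_le K fun r hr s hs =>
    hK.dist_le_mul _ (mem_image_of_mem x hr) _ (mem_image_of_mem x hs)

theorem absolutelyContinuousOnInterval_of_eq_integral {x h : ℝ → E}
    (hh : IntervalIntegrable h volume a b) (hab : a ≤ b)
    (hx : ∀ τ ∈ Icc a b, x τ = x a + ∫ s in a..τ, h s) : AbsolutelyContinuousOnInterval x a b := by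
  refine (hh.norm.absolutelyContinuousOnInterval_intervalIntegral (c := a)
    left_mem_uIcc).of_dist_le 1 fun r hr s hs => ?_
  rw [uIcc_of_le hab] at hr hs
  have hi : ∀ e ∈ Icc a b, IntervalIntegrable h volume a e := fun e he =>
    hh.mono_set (by rw [uIcc_of_le hab, uIcc_of_le he.1]; exact Icc_subset_Icc le_rfl he.2)
  rw [hx r hr, hx s hs, dist_add_left, dist_eq_norm, dist_eq_norm, NNReal.coe_one, one_mul,
    intervalIntegral.integral_interval_sub_left (hi r hr) (hi s hs),
    intervalIntegral.integral_interval_sub_left (hi r hr).norm (hi s hs).norm, Real.norm_eq_abs]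
  exact intervalIntegral.norm_integral_le_abs_integral_norm

theorem ae_hasDerivAt_of_eq_integral [CompleteSpace E] {x h : ℝ → E}
    (hh : IntervalIntegrable h volume a b)
    (hx : ∀ τ ∈ Icc a b, x τ = x a + ∫ s in a..τ, h s) :
    ∀ᵐ τ, τ ∈ Ioo a b → HasDerivAt x (h τ) τ := by
  filter_upwards [hh.ae_hasDerivAt_integral] with τ hτ hτ'
  have hab : a ≤ b := hτ'.1.le.trans hτ'.2.le
  have h1 := (hτ (by rw [uIcc_of_le hab]; exact ⟨hτ'.1.le, hτ'.2.le⟩) a left_mem_uIcc).const_add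
    (x a)
  refine h1.congr_of_eventuallyEq ?_
  filter_upwards [isOpen_Ioo.mem_nhds hτ'] with s hs
  exact hx s ⟨hs.1.le, hs.2.le⟩

theorem AbsolutelyContinuousOnInterval.sub_eq_integral {F h : ℝ → ℝ}
    (hF : AbsolutelyContinuousOnInterval F a b) (hab : a ≤ b)
    (hd : ∀ᵐ τ, τ ∈ Ioo a b → HasDerivAt F (h τ) τ) : F b - F a = ∫ s in a..b, h s := by
  rw [← hF.integral_deriv_eq_sub]
  refine intervalIntegral.integral_congr_ae ?_
  have hne : ∀ᵐ τ : ℝ, τ ≠ b := by simp [ae_iff, measure_singleton]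
  filter_upwards [hd, hne] with τ hτ hτb hτ'
  rw [uIoc_of_le hab] at hτ'
  exact (hτ ⟨hτ'.1, lt_of_le_of_ne hτ'.2 hτb⟩).deriv

/-- A function that is locally constant on `[a, b]` is constant there. -/
theorem eq_of_locally_eq_on_Icc {D : ℝ → ℝ}
    (h : ∀ τ ∈ Icc a b, ∀ᶠ s in 𝓝[Icc a b] τ, D s = D τ) : ∀ τ ∈ Icc a b, D τ = D a := by
  refine constant_of_has_deriv_right_zero (fun τ hτ => ?_) (fun τ hτ => ?_)
  · exact (continuousWithinAt_const (b := D τ)).congr_of_eventuallyEq (h τ hτ) rfl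
  · have h1 : ∀ᶠ s in 𝓝[Ici τ] τ, D s = D τ := by
      have : 𝓝[Ici τ] τ = 𝓝[Icc τ b] τ := (nhdsWithin_Icc_eq_nhdsGE hτ.2).symm
      rw [this]
      exact nhdsWithin_mono _ (Icc_subset_Icc hτ.1 le_rfl) (h τ ⟨hτ.1, hτ.2.le⟩)
    exact (hasDerivWithinAt_const τ (Ici τ) (D τ)).congr_of_eventuallyEq h1 rfl

end AbsolutelyContinuous

/-! ### Smooth vector fields acting on functions -/

section Fields

variable {E : Type*} [NormedAddCommGroup E] [NormedSpace ℝ E]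
  {H : Type*} [TopologicalSpace H] {I : ModelWithCorners ℝ E H}
  {M : Type*} [TopologicalSpace M] [ChartedSpace H M] [IsManifold I ∞ M]

theorem IsSmoothVectorField.contMDiffOn_mfderiv_apply {G : Type*} [NormedAddCommGroup G]
    [NormedSpace ℝ G] {V : ∀ q : M, TangentSpace I q} (hV : IsSmoothVectorField I V)
    {g : M → G} {s : Set M} (hs : IsOpen s) (hg : ContMDiffOn I 𝓘(ℝ, G) ∞ g s) :
    ContMDiffOn I 𝓘(ℝ, G) ∞ (fun q => (mfderiv I 𝓘(ℝ, G) g q (V q) : G)) s := by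
  have h1 := hg.contMDiffOn_tangentMapWithin (m := ∞) (by norm_cast) hs.uniqueMDiffOn
  have h2 : ContMDiffOn I 𝓘(ℝ, G).tangent ∞
      (fun q => tangentMapWithin I 𝓘(ℝ, G) g s ⟨q, V q⟩) s :=
    h1.comp hV.contMDiffOn fun q hq => hq
  have h3 := (contMDiff_snd_tangentBundle_modelSpace G 𝓘(ℝ, G) (n := ∞)).comp_contMDiffOn h2
  refine h3.congr fun q hq => ?_
  simp only [Function.comp, tangentMapWithin]
  rw [mfderivWithin_of_isOpen hs hq]

end Fields

/-! ### Control systems read in a chart -/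

section ChartField

variable {E : Type*} [NormedAddCommGroup E] [NormedSpace ℝ E] [FiniteDimensional ℝ E]
  {H : Type*} [TopologicalSpace H] {I : ModelWithCorners ℝ E H} [I.Boundaryless]
  {M : Type*} [TopologicalSpace M] [ChartedSpace H M] [IsManifold I ∞ M] [T2Space M]
  {k : ℕ} {X : Fin k → ∀ q : M, TangentSpace I q}

/-- The vector `∑ aᵢ Xᵢ(q)`. -/
def fieldSum (X : Fin k → ∀ q : M, TangentSpace I q) (q : M) (a : EuclideanSpace ℝ (Fin k)) : TangentSpace I q :=
  ∑ i, a i • X i q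

/-- The `i`-th field read in the chart at `p`. -/
def chartRep (X : Fin k → ∀ q : M, TangentSpace I q) (p : M) (i : Fin k) (q : M) : E :=
  mfderiv I 𝓘(ℝ, E) (extChartAt I p) q (X i q)

theorem contDiffOn_chartRep_symm (hX : ∀ i, IsSmoothVectorField I (X i)) (p : M) (i : Fin k) :
    ContDiffOn ℝ ∞ (fun z => chartRep X p i ((extChartAt I p).symm z)) (extChartAt I p).target := by
  have h1 : ContMDiffOn I 𝓘(ℝ, E) ∞ (chartRep X p i) (chartAt H p).source :=
    (hX i).contMDiffOn_mfderiv_apply (chartAt H p).open_source contMDiffOn_extChartAt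
  refine contMDiffOn_iff_contDiffOn.1 (h1.comp (contMDiffOn_extChartAt_symm p) fun z hz => ?_)
  rw [← extChartAt_source I]
  exact (extChartAt I p).map_target hz

/-- The fields `X₁, …, Xₖ` read in the chart at `p` and cut off by a bump function. -/
def chartField (X : Fin k → ∀ q : M, TangentSpace I q) {p : M} (f : SmoothBumpFunction I p)
    (z : E) : EuclideanSpace ℝ (Fin k) →L[ℝ] E :=
  ∑ i, (EuclideanSpace.proj i : EuclideanSpace ℝ (Fin k) →L[ℝ] ℝ).smulRight
    (f.toContDiffBump z • chartRep X p i ((extChartAt I p).symm z))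

theorem contDiff_chartField (hX : ∀ i, IsSmoothVectorField I (X i)) {p : M}
    (f : SmoothBumpFunction I p) : ContDiff ℝ ∞ (chartField X f) := by
  have hsub : Metric.closedBall (extChartAt I p p) f.rOut ⊆ (extChartAt I p).target := by
    have := f.closedBall_subset
    rwa [I.range_eq_univ, inter_univ] at this
  have h1 : ∀ i, ContDiff ℝ ∞
      (fun z => f.toContDiffBump z • chartRep X p i ((extChartAt I p).symm z)) := by
    intro i
    rw [contDiff_iff_contDiffAt]
    intro z
    by_cases hz : z ∈ (extChartAt I p).target
    · exact f.toContDiffBump.contDiff.contDiffAt.smul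
        ((contDiffOn_chartRep_symm hX p i).contDiffAt ((isOpen_extChartAt_target p).mem_nhds hz))
    · have hz' : z ∈ (Metric.closedBall (extChartAt I p p) f.rOut)ᶜ := fun h => hz (hsub h)
      refine (contDiffAt_const (c := (0 : E))).congr_of_eventuallyEq ?_
      filter_upwards [Metric.isClosed_closedBall.isOpen_compl.mem_nhds hz'] with w hw
      rw [f.toContDiffBump.zero_of_le_dist, zero_smul]
      exact (not_le.1 (fun h => hw h)).le
  unfold chartField
  refine ContDiff.sum fun i _ => ?_
  exact (ContinuousLinearMap.smulRightL ℝ (EuclideanSpace ℝ (Fin k)) E (EuclideanSpace.proj i)).contDiff.comp (h1 i)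

theorem hasCompactSupport_chartField {p : M} (f : SmoothBumpFunction I p) :
    HasCompactSupport (chartField X f) := by
  refine f.toContDiffBump.hasCompactSupport.mono fun z hz => ?_
  contrapose! hz
  rw [Function.notMem_support] at hz ⊢
  simp only [chartField, hz, zero_smul, ContinuousLinearMap.smulRight_zero, Finset.sum_const_zero]

/-- The neighborhood of `p` on which the bump function `f` is `1`. -/
def bumpNhd {p : M} (f : SmoothBumpFunction I p) : Set M :=
  (chartAt H p).source ∩ extChartAt I p ⁻¹' Metric.ball (extChartAt I p p) f.rIn

theorem isOpen_bumpNhd {p : M} (f : SmoothBumpFunction I p) : IsOpen (bumpNhd f) :=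
  isOpen_extChartAt_preimage p Metric.isOpen_ball

theorem mem_bumpNhd {p : M} (f : SmoothBumpFunction I p) : p ∈ bumpNhd f :=
  ⟨mem_chart_source H p, Metric.mem_ball_self f.rIn_pos⟩

theorem ball_subset_target {p : M} (f : SmoothBumpFunction I p) :
    Metric.ball (extChartAt I p p) f.rIn ⊆ (extChartAt I p).target := by
  have := f.closedBall_subset
  rw [I.range_eq_univ, inter_univ] at this
  exact (Metric.ball_subset_closedBall.trans
    (Metric.closedBall_subset_closedBall f.rIn_lt_rOut.le)).trans this

theorem symm_mem_bumpNhd {p : M} (f : SmoothBumpFunction I p) {z : E}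
    (hz : z ∈ Metric.ball (extChartAt I p p) f.rIn) : (extChartAt I p).symm z ∈ bumpNhd f := by
  have ht := ball_subset_target f hz
  refine ⟨?_, ?_⟩
  · rw [← extChartAt_source I]; exact (extChartAt I p).map_target ht
  · rw [mem_preimage, (extChartAt I p).right_inv ht]; exact hz

theorem chartField_apply_of_mem {p : M} (f : SmoothBumpFunction I p) {q : M} (hq : q ∈ bumpNhd f)
    (a : EuclideanSpace ℝ (Fin k)) : chartField X f (extChartAt I p q) a =
      mfderiv I 𝓘(ℝ, E) (extChartAt I p) q (fieldSum X q a) := by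
  have hq1 : q ∈ (extChartAt I p).source := by rw [extChartAt_source]; exact hq.1
  have h1 : f.toContDiffBump (extChartAt I p q) = 1 :=
    f.toContDiffBump.one_of_mem_closedBall (Metric.ball_subset_closedBall hq.2)
  simp only [chartField, h1, one_smul, (extChartAt I p).left_inv hq1, fieldSum, map_sum, map_smul]
  rw [sum_apply]
  rfl

/-- The derivative of `g` at `q` in the direction `∑ aᵢ Xᵢ(q)`. -/
def dirDeriv (X : Fin k → ∀ q : M, TangentSpace I q) (g : M → ℝ) (q : M)
    (a : EuclideanSpace ℝ (Fin k)) : ℝ :=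
  mfderiv I 𝓘(ℝ, ℝ) g q (fieldSum X q a)

/-! ### Solutions of control systems on a manifold, tested against smooth functions -/

/-- `γ` solves `γ' = ∑ uᵢ Xᵢ(γ)` on `[a, b]`, in the integrated form tested against smooth
functions. -/
structure IsSol (X : Fin k → ∀ q : M, TangentSpace I q) (u : ℝ → EuclideanSpace ℝ (Fin k)) (a b : ℝ) (γ : ℝ → M) :
    Prop where
  continuousOn : ContinuousOn γ (Icc a b)
  sub_eq : ∀ g : M → ℝ, ContMDiff I 𝓘(ℝ, ℝ) ∞ g → ∀ τ ∈ Icc a b,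
    g (γ τ) - g (γ a) = ∫ s in a..τ, dirDeriv X g (γ s) (u s)

variable {u u' : ℝ → EuclideanSpace ℝ (Fin k)} {a b c d : ℝ} {γ γ' : ℝ → M}

theorem intervalIntegrable_dirDeriv (hX : ∀ i, IsSmoothVectorField I (X i))
    (hγ : ContinuousOn γ (Icc a b)) (hu : IntervalIntegrable u volume a b) {g : M → ℝ}
    (hg : ContMDiff I 𝓘(ℝ, ℝ) ∞ g) (hc : c ∈ Icc a b) (hd : d ∈ Icc a b) :
    IntervalIntegrable
      (fun s => dirDeriv X g (γ s) (u s)) volume c d := by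
  let D : Fin k → M → ℝ := fun i q => mfderiv I 𝓘(ℝ, ℝ) g q (X i q)
  have hcont : ∀ i, Continuous (D i) := fun i =>
    (contMDiffOn_univ.1 ((hX i).contMDiffOn_mfderiv_apply isOpen_univ hg.contMDiffOn)).continuous
  have hsub : uIcc c d ⊆ Icc a b := uIcc_subset_Icc hc hd
  have hu' : IntervalIntegrable u volume c d :=
    hu.mono_set (by rwa [uIcc_of_le (hc.1.trans hc.2)])
  have h1 : ∀ i, IntervalIntegrable (fun s => u s i * D i (γ s)) volume c d := by
    intro i
    refine IntervalIntegrable.mul_continuousOn ?_ ((hcont i).comp_continuousOn (hγ.mono hsub))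
    exact ⟨(EuclideanSpace.proj i : EuclideanSpace ℝ (Fin k) →L[ℝ] ℝ).integrable_comp hu'.1,
      (EuclideanSpace.proj i : EuclideanSpace ℝ (Fin k) →L[ℝ] ℝ).integrable_comp hu'.2⟩
  have h2 : (fun s => dirDeriv X g (γ s) (u s)) = ∑ i, fun s => u s i * D i (γ s) := by
    ext s
    rw [dirDeriv, fieldSum, map_sum, Finset.sum_apply]
    simp only [map_smul]
    rfl
  rw [h2]
  exact IntervalIntegrable.sum _ fun i _ => h1 i

theorem IsSol.restrict (hX : ∀ i, IsSmoothVectorField I (X i)) (hγ : IsSol X u a b γ)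
    (hu : IntervalIntegrable u volume a b) (hc : c ∈ Icc a b) (hd : d ∈ Icc a b) :
    IsSol X u c d γ := by
  refine ⟨hγ.continuousOn.mono (Icc_subset_Icc hc.1 hd.2), fun g hg τ hτ => ?_⟩
  have ha : a ∈ Icc a b := left_mem_Icc.2 (hc.1.trans hc.2)
  have hτ' : τ ∈ Icc a b := ⟨hc.1.trans hτ.1, hτ.2.trans hd.2⟩
  have h1 := hγ.sub_eq g hg τ hτ'
  have h2 := hγ.sub_eq g hg c hc
  rw [← intervalIntegral.integral_interval_sub_left
    (intervalIntegrable_dirDeriv hX hγ.continuousOn hu hg ha hτ')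
    (intervalIntegrable_dirDeriv hX hγ.continuousOn hu hg ha hc), ← h1, ← h2]
  ring

theorem IsSol.congr (hγ : IsSol X u a b γ) (huu : ∀ᵐ s, s ∈ Ioc a b → u s = u' s)
    (hγγ : ∀ s ∈ Icc a b, γ s = γ' s) : IsSol X u' a b γ' := by
  refine ⟨hγ.continuousOn.congr fun s hs => (hγγ s hs).symm, fun g hg τ hτ => ?_⟩
  rw [← hγγ τ hτ, ← hγγ a (left_mem_Icc.2 (hτ.1.trans hτ.2)), hγ.sub_eq g hg τ hτ]
  refine intervalIntegral.integral_congr_ae ?_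
  filter_upwards [huu] with s hs hs'
  rw [uIoc_of_le hτ.1] at hs'
  rw [hs ⟨hs'.1, hs'.2.trans hτ.2⟩, hγγ s ⟨hs'.1.le, hs'.2.trans hτ.2⟩]

theorem IsSol.concat (hX : ∀ i, IsSmoothVectorField I (X i)) (hab : a ≤ b) (hbc : b ≤ c)
    (hu : IntervalIntegrable u volume a c)
    (hγ : IsSol X u a b γ) (hγ' : IsSol X u b c γ') (hb : γ b = γ' b) :
    IsSol X u a c (fun s => if s ≤ b then γ s else γ' s) := by
  set γ'' : ℝ → M := fun s => if s ≤ b then γ s else γ' s with hdef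
  have e1 : ∀ s ∈ Icc a b, γ s = γ'' s := fun s hs => (if_pos hs.2).symm
  have e2 : ∀ s ∈ Icc b c, γ' s = γ'' s := by
    intro s hs
    rcases hs.1.eq_or_lt with rfl | h
    · rw [← hb]; exact (if_pos le_rfl).symm
    · exact (if_neg (not_le.2 h)).symm
  have s1 : IsSol X u a b γ'' := hγ.congr (Eventually.of_forall fun _ _ => rfl) e1
  have s2 : IsSol X u b c γ'' := hγ'.congr (Eventually.of_forall fun _ _ => rfl) e2
  have hcont : ContinuousOn γ'' (Icc a c) := by
    rw [← Icc_union_Icc_eq_Icc hab hbc]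
    exact s1.continuousOn.union_of_isClosed s2.continuousOn isClosed_Icc isClosed_Icc
  refine ⟨hcont, fun g hg τ hτ => ?_⟩
  rcases le_total τ b with h | h
  · exact s1.sub_eq g hg τ ⟨hτ.1, h⟩
  · have ha : a ∈ Icc a c := left_mem_Icc.2 (hab.trans hbc)
    have hb' : b ∈ Icc a c := ⟨hab, hbc⟩
    rw [← intervalIntegral.integral_add_adjacent_intervals
      (intervalIntegrable_dirDeriv hX hcont hu hg ha hb')
      (intervalIntegrable_dirDeriv hX hcont hu hg hb' hτ),
      ← s1.sub_eq g hg b (right_mem_Icc.2 hab), ← s2.sub_eq g hg τ ⟨h, hτ.2⟩]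
    ring

theorem isSol_const (a : ℝ) (u : ℝ → EuclideanSpace ℝ (Fin k)) (q : M) : IsSol X u a a (fun _ => q) :=
  ⟨continuousOn_const, fun g _ τ hτ => by
    rw [Icc_self, mem_singleton_iff] at hτ
    rw [hτ, sub_self, intervalIntegral.integral_same]⟩

theorem IsSol.isIntegralSolution_chart (hX : ∀ i, IsSmoothVectorField I (X i))
    (hγ : IsSol X u a b γ) (hu : IntervalIntegrable u volume a b) {p : M}
    (f : SmoothBumpFunction I p) (hmem : ∀ s ∈ Icc a b, γ s ∈ bumpNhd f) :
    IsIntegralSolution (chartField X f) u a b (extChartAt I p ∘ γ) := by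
  have hcont : ContinuousOn (extChartAt I p ∘ γ) (Icc a b) :=
    (continuousOn_extChartAt p).comp hγ.continuousOn fun s hs => by
      rw [extChartAt_source]; exact (hmem s hs).1
  refine ⟨hcont, fun τ hτ => ?_⟩
  have hsub : uIcc a τ ⊆ Icc a b := uIcc_subset_Icc (left_mem_Icc.2 (hτ.1.trans hτ.2)) hτ
  have hint := intervalIntegrable_field (contDiff_chartField hX f).continuous hcont hu
    (left_mem_Icc.2 (hτ.1.trans hτ.2)) hτ
  rw [← sub_eq_iff_eq_add', SeparatingDual.eq_iff_forall_dual_eq (R := ℝ)]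
  intro ℓ
  rw [← ℓ.intervalIntegral_comp_comm hint, map_sub]
  have hg : ContMDiff I 𝓘(ℝ, ℝ) ∞ (fun q => f q • ℓ (extChartAt I p q)) :=
    f.contMDiff_smul (ℓ.contMDiff.comp_contMDiffOn contMDiffOn_extChartAt)
  have hev : ∀ q ∈ bumpNhd f, (fun q => f q • ℓ (extChartAt I p q)) =ᶠ[𝓝 q]
      fun q => ℓ (extChartAt I p q) := by
    intro q hq
    filter_upwards [f.eventuallyEq_one_of_dist_lt hq.1 hq.2] with r hr
    rw [hr, Pi.one_apply, one_smul]
  have h1 := hγ.sub_eq _ hg τ hτ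
  rw [(hev _ (hmem τ hτ)).eq_of_nhds,
    (hev _ (hmem a (left_mem_Icc.2 (hτ.1.trans hτ.2)))).eq_of_nhds] at h1
  refine h1.trans (intervalIntegral.integral_congr fun s hs => ?_)
  have hq := hmem s (hsub hs)
  have h2 : HasMFDerivAt I 𝓘(ℝ, ℝ) (fun q => f q • ℓ (extChartAt I p q)) (γ s)
      ((ℓ : E →L[ℝ] ℝ).comp (mfderiv I 𝓘(ℝ, E) (extChartAt I p) (γ s))) := by
    refine HasMFDerivAt.congr_of_eventuallyEq ?_ (hev _ hq)
    exact (ℓ.hasMFDerivAt (x := extChartAt I p (γ s))).comp (γ s)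
      (mdifferentiableAt_extChartAt hq.1).hasMFDerivAt
  simp only [Function.comp]
  rw [dirDeriv, h2.mfderiv, chartField_apply_of_mem f hq]
  rfl

end ChartField

/-! ### Solutions on a manifold: charts, uniqueness, trajectories -/

theorem exists_Icc_mem_nhdsWithin_Icc {a b τ₀ : ℝ} (hτ : τ₀ ∈ Icc a b) {N : Set ℝ}
    (hN : N ∈ 𝓝[Icc a b] τ₀) :
    ∃ c d, c ≤ d ∧ τ₀ ∈ Icc c d ∧ Icc c d ∈ 𝓝[Icc a b] τ₀ ∧ Icc c d ⊆ N ∧ Icc c d ⊆ Icc a b := by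
  obtain ⟨ε, hε, h⟩ := Metric.mem_nhdsWithin_iff.1 hN
  have hmem : τ₀ ∈ Icc (max a (τ₀ - ε / 2)) (min b (τ₀ + ε / 2)) :=
    ⟨max_le hτ.1 (by linarith), le_min hτ.2 (by linarith)⟩
  have hsub : Icc (max a (τ₀ - ε / 2)) (min b (τ₀ + ε / 2)) ⊆ Icc a b :=
    Icc_subset_Icc (le_max_left _ _) (min_le_left _ _)
  refine ⟨max a (τ₀ - ε / 2), min b (τ₀ + ε / 2), hmem.1.trans hmem.2, hmem, ?_, ?_, hsub⟩
  · filter_upwards [self_mem_nhdsWithin, mem_nhdsWithin_of_mem_nhds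
      (Icc_mem_nhds (by linarith : τ₀ - ε / 2 < τ₀) (by linarith : τ₀ < τ₀ + ε / 2))] with s h1 h2
    exact ⟨max_le h1.1 h2.1, le_min h1.2 h2.2⟩
  · intro s hs
    refine h ⟨?_, hsub hs⟩
    rw [Metric.mem_ball, Real.dist_eq, abs_lt]
    have h1 := (le_max_right _ _).trans hs.1
    have h2 := hs.2.trans (min_le_right _ _)
    constructor <;> linarith

section Solutions

variable {E : Type*} [NormedAddCommGroup E] [NormedSpace ℝ E] [FiniteDimensional ℝ E]
  {H : Type*} [TopologicalSpace H] {I : ModelWithCorners ℝ E H} [I.Boundaryless]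
  {M : Type*} [TopologicalSpace M] [ChartedSpace H M] [IsManifold I ∞ M] [T2Space M]
  {k : ℕ} {X : Fin k → ∀ q : M, TangentSpace I q}
  {u u' : ℝ → EuclideanSpace ℝ (Fin k)} {a b c d : ℝ} {γ γ' : ℝ → M}

theorem hasMFDerivAt_extChartAt_symm {p : M} {z : E} (hz : z ∈ (extChartAt I p).target) :
    HasMFDerivAt 𝓘(ℝ, E) I (extChartAt I p).symm z
      (mfderivWithin 𝓘(ℝ, E) I (extChartAt I p).symm (range I) z) := by
  rw [← hasMFDerivWithinAt_univ, ← I.range_eq_univ]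
  exact (mdifferentiableWithinAt_extChartAt_symm hz).hasMFDerivWithinAt

theorem hasVelocityWithinAt_of_chart {p : M} {S : Set ℝ} {τ : ℝ} (hτ : τ ∈ S)
    (hmem : ∀ s ∈ S, γ s ∈ (chartAt H p).source) {ξ : TangentSpace I (γ τ)} {w : E}
    (hw : w = mfderiv I 𝓘(ℝ, E) (extChartAt I p) (γ τ) ξ)
    (h : HasDerivWithinAt (extChartAt I p ∘ γ) w S τ) :
    HasVelocityWithinAt I γ S τ ξ := by
  have hsrc : ∀ s ∈ S, γ s ∈ (extChartAt I p).source := fun s hs => by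
    rw [extChartAt_source]; exact hmem s hs
  have h1 := hasMFDerivAt_extChartAt_symm ((extChartAt I p).map_source (hsrc τ hτ))
  have h2 : HasMFDerivWithinAt 𝓘(ℝ, ℝ) 𝓘(ℝ, E) (extChartAt I p ∘ γ) S τ _ :=
    h.hasFDerivWithinAt.hasMFDerivWithinAt
  have h3 := HasMFDerivAt.comp_hasMFDerivWithinAt τ (g := (extChartAt I p).symm) h1 h2
  have h4 : ∀ s ∈ S, γ s = ((extChartAt I p).symm ∘ (extChartAt I p ∘ γ)) s := fun s hs =>
    ((extChartAt I p).left_inv (hsrc s hs)).symm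
  have h5 := h3.congr_of_eventuallyEq
    (eventually_nhdsWithin_of_forall h4) (h4 τ hτ)
  have h6 := mfderivWithin_extChartAt_symm_comp_mfderiv_extChartAt' (hsrc τ hτ)
  have h7 : mfderivWithin 𝓘(ℝ, E) I (extChartAt I p).symm (range I) (extChartAt I p (γ τ)) w = ξ := by
    rw [hw]; exact DFunLike.congr_fun h6 ξ
  have h8 : (1 : ℝ →L[ℝ] ℝ).smulRight ξ =
      (mfderivWithin 𝓘(ℝ, E) I (extChartAt I p).symm (range I) (extChartAt I p (γ τ))).comp
        (ContinuousLinearMap.toSpanSingleton ℝ w) := by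
    refine ContinuousLinearMap.ext_ring ?_
    refine (one_smul ℝ ξ).trans (h7.symm.trans ?_)
    exact congrArg (mfderivWithin 𝓘(ℝ, E) I (extChartAt I p).symm (range I)
      (extChartAt I p (γ τ))) (one_smul ℝ w).symm
  unfold HasVelocityWithinAt
  rw [h8]
  exact h5

theorem HasVelocityWithinAt.hasDerivWithinAt_comp {S : Set ℝ} {τ : ℝ} {ξ : TangentSpace I (γ τ)}
    (h : HasVelocityWithinAt I γ S τ ξ) {G : Type*} [NormedAddCommGroup G] [NormedSpace ℝ G]
    {g : M → G} (hg : MDifferentiableAt I 𝓘(ℝ, G) g (γ τ)) {w : G}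
    (hw : mfderiv I 𝓘(ℝ, G) g (γ τ) ξ = w) : HasDerivWithinAt (g ∘ γ) w S τ := by
  have h1 := HasMFDerivAt.comp_hasMFDerivWithinAt τ hg.hasMFDerivAt h
  have h2 : HasFDerivWithinAt (g ∘ γ) (ContinuousLinearMap.toSpanSingleton ℝ w) S τ := by
    refine (hasMFDerivWithinAt_iff_hasFDerivWithinAt.1 h1).congr_fderiv ?_
    refine ContinuousLinearMap.ext_ring ?_
    refine Eq.trans ?_ (one_smul ℝ w).symm
    rw [← hw]
    exact congrArg (mfderiv I 𝓘(ℝ, G) g (γ τ)) (one_smul ℝ ξ)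
  simpa using h2.hasDerivWithinAt

theorem IsIntegralSolution.isSol (hX : ∀ i, IsSmoothVectorField I (X i)) {p : M}
    (f : SmoothBumpFunction I p) {x : ℝ → E}
    (hx : IsIntegralSolution (chartField X f) u a b x)
    (hu : IntervalIntegrable u volume a b)
    (hmem : ∀ s ∈ Icc a b, x s ∈ Metric.ball (extChartAt I p p) f.rIn) :
    IsSol X u a b ((extChartAt I p).symm ∘ x) := by
  have htgt := fun s hs => ball_subset_target f (hmem s hs)
  refine ⟨(continuousOn_extChartAt_symm p).comp hx.1 htgt, fun g hg τ hτ => ?_⟩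
  have hsub : Icc a τ ⊆ Icc a b := Icc_subset_Icc le_rfl hτ.2
  have ha : a ∈ Icc a b := left_mem_Icc.2 (hτ.1.trans hτ.2)
  have hint := intervalIntegrable_field (contDiff_chartField hX f).continuous hx.1 hu ha hτ
  have hac : AbsolutelyContinuousOnInterval x a τ :=
    absolutelyContinuousOnInterval_of_eq_integral hint hτ.1 fun s hs => hx.2 s (hsub hs)
  have hgs : ContDiffOn ℝ ∞ (g ∘ (extChartAt I p).symm) (extChartAt I p).target :=
    contMDiffOn_iff_contDiffOn.1 (hg.comp_contMDiffOn (contMDiffOn_extChartAt_symm p))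
  have hF := hac.comp_contDiffOn (isOpen_extChartAt_target p) (hgs.of_le (by norm_cast))
    (fun s hs => htgt s (hsub (by rwa [uIcc_of_le hτ.1] at hs)))
  refine hF.sub_eq_integral hτ.1 ?_
  filter_upwards [ae_hasDerivAt_of_eq_integral hint fun s hs => hx.2 s (hsub hs)] with s hs hs'
  have hsI := hsub (Ioo_subset_Icc_self hs')
  have h1 := hs hs'
  have hz := htgt s hsI
  have hq := symm_mem_bumpNhd f (hmem s hsI)
  have h2 : HasVelocityWithinAt I ((extChartAt I p).symm ∘ x) (Icc a b) s
      (fieldSum X ((extChartAt I p).symm (x s)) (u s)) := by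
    have h3 := chartField_apply_of_mem (X := X) f hq (u s)
    rw [(extChartAt I p).right_inv hz] at h3
    exact hasVelocityWithinAt_of_chart (p := p) hsI
      (fun r hr => (symm_mem_bumpNhd f (hmem r hr)).1) h3
      (h1.hasDerivWithinAt.congr (fun r hr => (extChartAt I p).right_inv (htgt r hr))
        ((extChartAt I p).right_inv hz))
  have h3 := h2.hasDerivWithinAt_comp (hg.mdifferentiable (by norm_num) _) rfl
  exact h3.hasDerivAt (Icc_mem_nhds hs'.1 (hs'.2.trans_le hτ.2))

/-- Solutions are determined by their initial point. -/
theorem IsSol.eqOn (hX : ∀ i, IsSmoothVectorField I (X i)) (hγ : IsSol X u a b γ)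
    (hγ' : IsSol X u a b γ') (hu : IntervalIntegrable u volume a b) (ha : γ a = γ' a) :
    EqOn γ γ' (Icc a b) := by
  rcases le_or_gt a b with hab | hab
  swap
  · rw [Icc_eq_empty (not_le.2 hab)]; exact eqOn_empty _ _
  have hcl : IsClosed ({τ | γ τ = γ' τ} ∩ Icc a b) := by
    have h := (hγ.continuousOn.prodMk hγ'.continuousOn).preimage_isClosed_of_isClosed
      isClosed_Icc (isClosed_diagonal (X := M))
    rw [inter_comm]
    exact h
  refine hcl.Icc_subset_of_forall_exists_gt ha fun τ hτ y hy => ?_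
  obtain ⟨hτe, hτI⟩ := hτ
  have hτe : γ τ = γ' τ := hτe
  have hτI' : τ ∈ Icc a b := Ico_subset_Icc_self hτI
  obtain ⟨f⟩ : Nonempty (SmoothBumpFunction I (γ τ)) := inferInstance
  obtain ⟨C, hC⟩ := exists_isC2Bound (contDiff_chartField hX f) (hasCompactSupport_chartField f)
  have hN : bumpNhd f ∈ 𝓝 (γ τ) := (isOpen_bumpNhd f).mem_nhds (mem_bumpNhd f)
  have hp : Tendsto (fun s => C * ∫ r in τ..s, ‖u r‖) (𝓝[Icc a b] τ) (𝓝 (C * ∫ r in τ..τ, ‖u r‖)) := by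
    have h := intervalIntegral.continuousOn_primitive_interval' (b₁ := a) (b₂ := b) (a := τ)
      hu.norm (by rwa [uIcc_of_le hab])
    rw [uIcc_of_le hab] at h
    exact (h τ hτI').const_mul C
  rw [intervalIntegral.integral_same, mul_zero] at hp
  have hev : ∀ᶠ s in 𝓝[Icc a b] τ, γ s ∈ bumpNhd f ∧ γ' s ∈ bumpNhd f ∧
      C * (∫ r in τ..s, ‖u r‖) ≤ 1 / 2 := by
    filter_upwards [hγ.continuousOn τ hτI' hN, hγ'.continuousOn τ hτI' (by rwa [← hτe]),
      hp.eventually (ge_mem_nhds (by norm_num : (0:ℝ) < 1 / 2))] with s h1 h2 h3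
    exact ⟨h1, h2, h3⟩
  obtain ⟨ε, hε, h⟩ := Metric.mem_nhdsWithin_iff.1 hev
  set s := min (min y b) (τ + ε / 2) with hs
  have hτs : τ < s := lt_min (lt_min hy hτI.2) (by linarith)
  have hsy : s ≤ y := (min_le_left _ _).trans (min_le_left _ _)
  have hsb : s ≤ b := (min_le_left _ _).trans (min_le_right _ _)
  have hsε : s ≤ τ + ε / 2 := min_le_right _ _
  have hsI : s ∈ Icc a b := ⟨hτI.1.trans hτs.le, hsb⟩
  have hball : ∀ r ∈ Icc τ s, r ∈ Metric.ball τ ε ∩ Icc a b := fun r hr => by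
    refine ⟨?_, hτI.1.trans hr.1, hr.2.trans hsb⟩
    rw [Metric.mem_ball, Real.dist_eq, abs_lt]
    constructor <;> linarith [hr.1, hr.2]
  have hus : IntervalIntegrable u volume τ s := hu.mono_set (by
    rw [uIcc_of_le hab, uIcc_of_le hτs.le]; exact Icc_subset_Icc hτI.1 hsb)
  have e1 := (hγ.restrict hX hu hτI' hsI).isIntegralSolution_chart hX hus f
    fun r hr => (h (hball r hr)).1
  have e2 := (hγ'.restrict hX hu hτI' hsI).isIntegralSolution_chart hX hus f
    fun r hr => (h (hball r hr)).2.1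
  have hs1 : s ∈ Icc τ s := right_mem_Icc.2 hτs.le
  have e3 := e1.eqOn hC e2 (by simp only [Function.comp, hτe]) hus (h (hball s hs1)).2.2 s hs1
  refine ⟨s, ?_, hτs, hsy⟩
  have m1 : γ s ∈ (extChartAt I (γ τ)).source := by
    rw [extChartAt_source]; exact (h (hball s hs1)).1.1
  have m2 : γ' s ∈ (extChartAt I (γ τ)).source := by
    rw [extChartAt_source]; exact (h (hball s hs1)).2.1.1
  exact (extChartAt I (γ τ)).injOn m1 m2 e3

variable {q₀ : M} {t : ℝ}

theorem IsTrajectory.isSol (hX : ∀ i, IsSmoothVectorField I (X i)) {u : ControlSpace k t}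
    (h : IsTrajectory I X q₀ t u γ) : IsSol X u 0 t γ := by
  refine ⟨h.absolutelyContinuous.1, fun g hg => ?_⟩
  intro τ hτ
  have ht : (0 : ℝ) ≤ t := hτ.1.trans hτ.2
  have h0 : (0 : ℝ) ∈ Icc 0 t := left_mem_Icc.2 ht
  have hu := ControlSpace.intervalIntegrable u h0 (right_mem_Icc.2 ht)
  have hi : ∀ {c d}, c ∈ Icc 0 t → d ∈ Icc 0 t → IntervalIntegrable
      (fun s => dirDeriv X g (γ s) (u s)) volume c d := fun hc hd =>
    intervalIntegrable_dirDeriv hX h.absolutelyContinuous.1 hu hg hc hd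
  suffices hD : ∀ τ ∈ Icc 0 t, (fun τ => g (γ τ) - ∫ s in (0:ℝ)..τ, dirDeriv X g (γ s) (u s)) τ =
      (fun τ => g (γ τ) - ∫ s in (0:ℝ)..τ, dirDeriv X g (γ s) (u s)) 0 by
    have := hD τ hτ
    simp only [intervalIntegral.integral_same] at this
    linarith
  refine eq_of_locally_eq_on_Icc fun τ₀ hτ₀ => ?_
  obtain ⟨c, d, hcd, hN, hmap, hac⟩ := h.absolutelyContinuous.2 τ₀ hτ₀
  have hgs : ContDiffOn ℝ ∞ (g ∘ (extChartAt I (γ τ₀)).symm) (extChartAt I (γ τ₀)).target :=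
    contMDiffOn_iff_contDiffOn.1 (hg.comp_contMDiffOn (contMDiffOn_extChartAt_symm _))
  have hsrc : ∀ s ∈ Icc c d, γ s ∈ (extChartAt I (γ τ₀)).source := fun s hs => by
    rw [extChartAt_source]; exact hmap hs
  have hF := hac.comp_contDiffOn (isOpen_extChartAt_target _) (hgs.of_le (by norm_cast))
    (fun s hs => (extChartAt I (γ τ₀)).map_source (hsrc s (by rwa [uIcc_of_le hcd] at hs)))
  have hF' : AbsolutelyContinuousOnInterval (g ∘ γ) c d :=
    hF.of_dist_le 1 fun r hr s hs => by
      rw [uIcc_of_le hcd] at hr hs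
      simp only [Function.comp, (extChartAt I (γ τ₀)).left_inv (hsrc r hr),
        (extChartAt I (γ τ₀)).left_inv (hsrc s hs), NNReal.coe_one, one_mul, le_refl]
  have key : ∀ r ∈ Icc c d ∩ Icc 0 t, ∀ s ∈ Icc c d ∩ Icc 0 t, r ≤ s →
      g (γ s) - g (γ r) = ∫ s in r..s, dirDeriv X g (γ s) (u s) := by
    intro r hr s hs hrs
    refine AbsolutelyContinuousOnInterval.sub_eq_integral (F := g ∘ γ) (hF'.mono ?_) hrs ?_
    · rw [uIcc_of_le hcd, uIcc_of_le hrs]; exact Icc_subset_Icc hr.1.1 hs.1.2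
    · filter_upwards [(ae_restrict_iff' measurableSet_Icc).1 h.velocity] with e he he'
      have h3 := (he ⟨hr.2.1.trans he'.1.le, he'.2.le.trans hs.2.2⟩).hasDerivWithinAt_comp
        (hg.mdifferentiable (by norm_num) _) rfl
      exact h3.hasDerivAt (Icc_mem_nhds (hr.2.1.trans_lt he'.1) (he'.2.trans_le hs.2.2))
  have hτc : τ₀ ∈ Icc c d := mem_of_mem_nhdsWithin hτ₀ hN
  filter_upwards [hN, self_mem_nhdsWithin] with s hs hs'
  have hsplit := intervalIntegral.integral_interval_sub_left (hi h0 hs') (hi h0 hτ₀)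
  rcases le_total τ₀ s with hle | hle
  · have := key τ₀ ⟨hτc, hτ₀⟩ s ⟨hs, hs'⟩ hle
    rw [← hsplit] at this
    linarith
  · have := key s ⟨hs, hs'⟩ τ₀ ⟨hτc, hτ₀⟩ hle
    rw [intervalIntegral.integral_symm, ← hsplit] at this
    linarith

/-- Around each time, a solution is a solution in a chart. -/
theorem IsSol.exists_chart (hX : ∀ i, IsSmoothVectorField I (X i)) (hγ : IsSol X u a b γ)
    (hu : IntervalIntegrable u volume a b) {τ₀ : ℝ} (hτ : τ₀ ∈ Icc a b)
    (f : SmoothBumpFunction I (γ τ₀)) :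
    ∃ c d, c ≤ d ∧ τ₀ ∈ Icc c d ∧ Icc c d ∈ 𝓝[Icc a b] τ₀ ∧ Icc c d ⊆ Icc a b ∧
      (∀ s ∈ Icc c d, γ s ∈ bumpNhd f) ∧ IntervalIntegrable u volume c d ∧
      IsIntegralSolution (chartField X f) u c d (extChartAt I (γ τ₀) ∘ γ) := by
  obtain ⟨c, d, hcd, hτcd, hN, hsub1, hsub⟩ := exists_Icc_mem_nhdsWithin_Icc hτ
    (hγ.continuousOn τ₀ hτ ((isOpen_bumpNhd f).mem_nhds (mem_bumpNhd f)))
  have hud : IntervalIntegrable u volume c d := hu.mono_set (by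
    rw [uIcc_of_le hcd, uIcc_of_le (hτ.1.trans hτ.2)]; exact hsub)
  exact ⟨c, d, hcd, hτcd, hN, hsub, hsub1, hud,
    (hγ.restrict hX hu (hsub (left_mem_Icc.2 hcd))
      (hsub (right_mem_Icc.2 hcd))).isIntegralSolution_chart hX hud f hsub1⟩

theorem IsSol.ae_hasVelocityWithinAt (hX : ∀ i, IsSmoothVectorField I (X i))
    (hγ : IsSol X u a b γ) (hu : IntervalIntegrable u volume a b) :
    ∀ᵐ τ ∂(volume.restrict (Icc a b)), HasVelocityWithinAt I γ (Icc a b) τ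
      (fieldSum X (γ τ) (u τ)) := by
  rw [ae_restrict_iff' measurableSet_Icc, ae_iff]
  refine measure_null_of_locally_null _ fun τ₀ hτ₀ => ?_
  obtain ⟨hτI, -⟩ : τ₀ ∈ Icc a b ∧ _ := Classical.not_imp.1 hτ₀
  obtain ⟨f⟩ : Nonempty (SmoothBumpFunction I (γ τ₀)) := inferInstance
  obtain ⟨c, d, hcd, -, hN, hsub, hmem, hud, hx⟩ := hγ.exists_chart hX hu hτI f
  set B := {τ | ¬(τ ∈ Icc a b → HasVelocityWithinAt I γ (Icc a b) τ (fieldSum X (γ τ) (u τ)))}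
    with hB
  have hBI : B ⊆ Icc a b := fun τ hτ => (Classical.not_imp.1 hτ).1
  refine ⟨Icc c d ∩ B, inter_mem (nhdsWithin_mono _ hBI hN) self_mem_nhdsWithin, ?_⟩
  have h1 := ae_hasDerivAt_of_eq_integral (intervalIntegrable_field
    (contDiff_chartField hX f).continuous hx.1 hud (left_mem_Icc.2 hcd) (right_mem_Icc.2 hcd)) hx.2
  have h2 : ∀ᵐ τ : ℝ, τ ≠ c := by simp [ae_iff, measure_singleton]
  have h3 : ∀ᵐ τ : ℝ, τ ≠ d := by simp [ae_iff, measure_singleton]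
  have h4 : ∀ᵐ τ : ℝ, τ ∉ Icc c d ∩ B := by
    filter_upwards [h1, h2, h3] with τ h1 h2 h3 hτ
    have hτo : τ ∈ Ioo c d := ⟨lt_of_le_of_ne hτ.1.1 (Ne.symm h2), lt_of_le_of_ne hτ.1.2 h3⟩
    refine hτ.2 fun _ => ?_
    have h5 : HasVelocityWithinAt I γ (Icc c d) τ (fieldSum X (γ τ) (u τ)) := by
      exact hasVelocityWithinAt_of_chart (p := γ τ₀) hτ.1 (fun r hr => (hmem r hr).1)
        (chartField_apply_of_mem f (hmem τ hτ.1) _) (h1 hτo).hasDerivWithinAt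
    exact (HasMFDerivWithinAt.hasMFDerivAt h5 (Icc_mem_nhds hτo.1 hτo.2)).hasMFDerivWithinAt
  have h5 := ae_iff.1 h4
  simpa only [not_not, ofPred_mem_eq] using h5

theorem IsSol.isTrajectory (hX : ∀ i, IsSmoothVectorField I (X i)) {u : ControlSpace k t}
    (ht : 0 ≤ t) (h : IsSol X u 0 t γ) (h0 : γ 0 = q₀) : IsTrajectory I X q₀ t u γ := by
  have hu := ControlSpace.intervalIntegrable u (left_mem_Icc.2 ht) (right_mem_Icc.2 ht)
  refine ⟨⟨h.continuousOn, fun τ₀ hτ => ?_⟩, h0, h.ae_hasVelocityWithinAt hX hu⟩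
  obtain ⟨f⟩ : Nonempty (SmoothBumpFunction I (γ τ₀)) := inferInstance
  obtain ⟨c, d, hcd, -, hN, hsub, hmem, hud, hx⟩ := h.exists_chart hX hu hτ f
  refine ⟨c, d, hcd, hN, fun s hs => (hmem s hs).1, ?_⟩
  exact absolutelyContinuousOnInterval_of_eq_integral (intervalIntegrable_field
    (contDiff_chartField hX f).continuous hx.1 hud (left_mem_Icc.2 hcd) (right_mem_Icc.2 hcd)) hcd
    hx.2

theorem IsSol.isLipschitzCurve (hX : ∀ i, IsSmoothVectorField I (X i))
    (h : IsSol X u 0 t γ) (hu : IntervalIntegrable u volume 0 t) {R : ℝ}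
    (hR : ∀ᵐ s, s ∈ Icc 0 t → ‖u s‖ ≤ R) : IsLipschitzCurve I t γ := by
  refine ⟨h.continuousOn, fun τ₀ hτ => ?_⟩
  obtain ⟨f⟩ : Nonempty (SmoothBumpFunction I (γ τ₀)) := inferInstance
  obtain ⟨C, hC⟩ := exists_isC2Bound (contDiff_chartField hX f) (hasCompactSupport_chartField f)
  obtain ⟨c, d, hcd, -, hN, hsub, hmem, hud, hx⟩ := h.exists_chart hX hu hτ f
  refine ⟨Icc c d, hN, (C * R).toNNReal, fun s hs => (hmem s hs).1, ?_⟩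
  refine LipschitzOnWith.of_dist_le_mul fun r hr s hs => ?_
  rw [dist_eq_norm, hx.sub_eq (contDiff_chartField hX f).continuous hud hs hr, Real.dist_eq]
  refine (intervalIntegral.norm_integral_le_of_norm_le_const_ae ?_).trans
    (mul_le_mul_of_nonneg_right (Real.le_coe_toNNReal (C * R)) (abs_nonneg _))
  filter_upwards [hR] with e he he'
  have he2 : e ∈ Icc c d := uIcc_subset_Icc hs hr (uIoc_subset_uIcc he')
  have h1 := he (hsub he2)
  exact (ContinuousLinearMap.le_opNorm _ _).trans
    (mul_le_mul (hC.norm_le _) h1 (norm_nonneg _) hC.nonneg)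

end Solutions

/-! ### Smooth dependence of solutions on the initial point and the control -/

/-- A transitive property of intervals that holds locally holds on `[a, b]`. -/
theorem Icc_induction {P : ℝ → ℝ → Prop} {a b : ℝ} (hab : a ≤ b)
    (htrans : ∀ x y z, a ≤ x → x ≤ y → y ≤ z → z ≤ b → P x y → P y z → P x z)
    (hloc : ∀ τ ∈ Icc a b, ∃ N ∈ 𝓝[Icc a b] τ, ∀ x ∈ N, ∀ y ∈ N, x ∈ Icc a b → y ∈ Icc a b →
      x ≤ y → P x y) : P a b := by
  have ha : a ∈ Icc a b := left_mem_Icc.2 hab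
  have haa : P a a := by
    obtain ⟨N, hN, h⟩ := hloc a ha
    exact h a (mem_of_mem_nhdsWithin ha hN) a (mem_of_mem_nhdsWithin ha hN) ha ha le_rfl
  set S := {τ | τ ∈ Icc a b ∧ P a τ} with hS
  have hSne : S.Nonempty := ⟨a, ha, haa⟩
  have hSb : BddAbove S := ⟨b, fun τ hτ => hτ.1.2⟩
  set c := sSup S with hc
  have hcI : c ∈ Icc a b := ⟨le_csSup hSb ⟨ha, haa⟩, csSup_le hSne fun τ hτ => hτ.1.2⟩
  obtain ⟨N, hN, h⟩ := hloc c hcI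
  have hcN := mem_of_mem_nhdsWithin hcI hN
  obtain ⟨ε, hε, hball⟩ := Metric.mem_nhdsWithin_iff.1 hN
  have hPc : P a c := by
    obtain ⟨τ, hτ, hlt⟩ := exists_lt_of_lt_csSup hSne (by linarith : c - ε < sSup S)
    have hτc : τ ≤ c := le_csSup hSb hτ
    refine htrans a τ c le_rfl hτ.1.1 hτc hcI.2 hτ.2 (h τ (hball ⟨?_, hτ.1⟩) c hcN hτ.1 hcI hτc)
    rw [Metric.mem_ball, Real.dist_eq, abs_lt]
    constructor <;> linarith
  rcases hcI.2.eq_or_lt with hcb | hcb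
  · rwa [hcb] at hPc
  exfalso
  set d := min b (c + ε / 2) with hd
  have hcd : c < d := lt_min hcb (by linarith)
  have hdI : d ∈ Icc a b := ⟨hcI.1.trans hcd.le, min_le_left _ _⟩
  have hdN : d ∈ N := hball ⟨by
    rw [Metric.mem_ball, Real.dist_eq, abs_lt]
    have : d ≤ c + ε / 2 := min_le_right _ _
    constructor <;> linarith, hdI⟩
  have hPd := htrans a c d le_rfl hcI.1 hcd.le hdI.2 hPc (h c hcN d hdN hcI hdI hcd.le)
  exact absurd (le_csSup hSb ⟨hdI, hPd⟩) (not_le.2 hcd)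

section Flow

variable {E : Type*} [NormedAddCommGroup E] [NormedSpace ℝ E] [FiniteDimensional ℝ E]
  {H : Type*} [TopologicalSpace H] {I : ModelWithCorners ℝ E H} [I.Boundaryless]
  {M : Type*} [TopologicalSpace M] [ChartedSpace H M] [IsManifold I ∞ M] [T2Space M]
  {k : ℕ} {X : Fin k → ∀ q : M, TangentSpace I q} {a b c : ℝ} {γ : ℝ → M} {t C : ℝ}

open Classical in
/-- The value at time `b` of the solution of `γ' = ∑ uᵢ Xᵢ(γ)` with `γ(a) = x`, if there is one. -/
def flowMap (X : Fin k → ∀ q : M, TangentSpace I q) (a b : ℝ)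
    (u : ℝ → EuclideanSpace ℝ (Fin k)) (x : M) : M :=
  if h : ∃ γ : ℝ → M, IsSol X u a b γ ∧ γ a = x then h.choose b else x

theorem flowMap_eq (hX : ∀ i, IsSmoothVectorField I (X i)) {u : ℝ → EuclideanSpace ℝ (Fin k)}
    (hu : IntervalIntegrable u volume a b) (hab : a ≤ b) (hγ : IsSol X u a b γ) {x : M}
    (hx : γ a = x) : flowMap X a b u x = γ b := by
  have h : ∃ γ : ℝ → M, IsSol X u a b γ ∧ γ a = x := ⟨γ, hγ, hx⟩
  rw [flowMap, dif_pos h]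
  exact h.choose_spec.1.eqOn hX hγ hu (h.choose_spec.2.trans hx.symm) (right_mem_Icc.2 hab)

theorem flowMap_congr {u u' : ℝ → EuclideanSpace ℝ (Fin k)}
    (h : ∀ᵐ s, s ∈ Ioc a b → u s = u' s) : flowMap X a b u = flowMap X a b u' := by
  have h1 : IsSol X u a b = IsSol X u' a b := funext fun γ => propext
    ⟨fun hγ => hγ.congr h fun _ _ => rfl,
      fun hγ => hγ.congr (h.mono fun s hs hs' => (hs hs').symm) fun _ _ => rfl⟩
  unfold flowMap
  rw [h1]

theorem endpointMap_eq_of_isSol (hX : ∀ i, IsSmoothVectorField I (X i)) {u : ControlSpace k t}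
    (ht : 0 ≤ t) {q₀ : M} (hγ : IsSol X u 0 t γ) (h0 : γ 0 = q₀) :
    endpointMap I X q₀ t u = γ t := by
  have h : ∃ γ : ℝ → M, IsTrajectory I X q₀ t u γ := ⟨γ, hγ.isTrajectory hX ht h0⟩
  rw [endpointMap, dif_pos h]
  exact (h.choose_spec.isSol hX).eqOn hX hγ
    (ControlSpace.intervalIntegrable u (left_mem_Icc.2 ht) (right_mem_Icc.2 ht))
    (h.choose_spec.start.trans h0.symm) (right_mem_Icc.2 ht)

/-- Near `(x, u)`, solutions on `[a, b]` exist and depend smoothly on the initial point and the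
control. -/
structure IsFlowRegular (X : Fin k → ∀ q : M, TangentSpace I q) (a b : ℝ) (u : ControlSpace k t)
    (x : M) : Prop where
  exists_isSol : ∀ᶠ z : M × ControlSpace k t in 𝓝 (x, u), ∃ γ, IsSol X z.2 a b γ ∧ γ a = z.1
  contMDiffAt : ContMDiffAt (I.prod 𝓘(ℝ, ControlSpace k t)) I ∞
    (fun z : M × ControlSpace k t => flowMap X a b z.2 z.1) (x, u)

theorem IsFlowRegular.trans (hX : ∀ i, IsSmoothVectorField I (X i)) {u : ControlSpace k t}
    (ha : 0 ≤ a) (hab : a ≤ b) (hbc : b ≤ c) (hct : c ≤ t) {x : M}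
    (h1 : IsFlowRegular X a b u x) (h2 : IsFlowRegular X b c u (flowMap X a b u x)) :
    IsFlowRegular X a c u x := by
  have hi : ∀ v : ControlSpace k t, ∀ {r s}, a ≤ r → r ≤ s → s ≤ c →
      IntervalIntegrable v volume r s := fun v r s h1 h2 h3 =>
    ControlSpace.intervalIntegrable v ⟨ha.trans h1, (h2.trans h3).trans hct⟩
      ⟨(ha.trans h1).trans h2, h3.trans hct⟩
  have hpair : ContMDiffAt (I.prod 𝓘(ℝ, ControlSpace k t)) (I.prod 𝓘(ℝ, ControlSpace k t)) ∞
      (fun z : M × ControlSpace k t => (flowMap X a b z.2 z.1, z.2)) (x, u) :=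
    h1.contMDiffAt.prodMk contMDiffAt_snd
  have hev : ∀ᶠ z : M × ControlSpace k t in 𝓝 (x, u), ∃ γ, IsSol X z.2 a c γ ∧ γ a = z.1 ∧
      γ c = flowMap X b c z.2 (flowMap X a b z.2 z.1) := by
    filter_upwards [h1.exists_isSol, hpair.continuousAt.eventually h2.exists_isSol] with z h3 h4
    obtain ⟨γ₁, hγ₁, hz⟩ := h3
    obtain ⟨γ₂, hγ₂, hz'⟩ := h4
    have h5 := flowMap_eq hX (hi z.2 le_rfl hab hbc) hab hγ₁ hz
    have h6 := flowMap_eq hX (hi z.2 hab hbc le_rfl) hbc hγ₂ hz'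
    refine ⟨_, hγ₁.concat hX hab hbc (hi z.2 le_rfl (hab.trans hbc) le_rfl) hγ₂
      (h5.symm.trans hz'.symm), by rw [if_pos hab, hz], ?_⟩
    rw [h6]
    split_ifs with h7
    · obtain rfl : c = b := le_antisymm h7 hbc
      rw [← h5, hz']
    · rfl
  refine ⟨hev.mono fun z hz => ⟨hz.choose, hz.choose_spec.1, hz.choose_spec.2.1⟩, ?_⟩
  refine (ContMDiffAt.comp (x, u) (g := fun z : M × ControlSpace k t => flowMap X b c z.2 z.1)
    h2.contMDiffAt hpair).congr_of_eventuallyEq (hev.mono fun z hz => ?_)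
  obtain ⟨γ, hγ, hγa, hγc⟩ := hz
  exact (flowMap_eq hX (hi z.2 le_rfl (hab.trans hbc) le_rfl) (hab.trans hbc) hγ hγa).trans hγc

/-- On an interval on which the solution stays in a chart, the flow is regular, and its derivative
with respect to the control is given by variations. -/
theorem IsSol.flow_chart (hX : ∀ i, IsSmoothVectorField I (X i)) {u : ControlSpace k t}
    (hab : a ≤ b) (h : Icc a b ⊆ Icc 0 t) (hγ : IsSol X u a b γ) {p : M}
    (f : SmoothBumpFunction I p) (hC : IsC2Bound (chartField X f) C)
    (hmem : ∀ s ∈ Icc a b, γ s ∈ bumpNhd f) (hsmall : (∫ s in a..b, ‖u s‖) * C < 1) :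
    IsFlowRegular X a b u (γ a) ∧ ∃ L : ControlSpace k t →L[ℝ] E,
      HasFDerivAt (fun v : ControlSpace k t => extChartAt I p (flowMap X a b v (γ a))) L u ∧
      ∀ v : ControlSpace k t, ∃ y,
        IsVariation (chartField X f) u (extChartAt I p ∘ γ) v a b y ∧ y b = L v := by
  have ha : a ∈ Icc a b := left_mem_Icc.2 hab
  have hb : b ∈ Icc a b := right_mem_Icc.2 hab
  have hi : ∀ v : ControlSpace k t, IntervalIntegrable v volume a b := fun v =>
    ControlSpace.intervalIntegrable v (h ha) (h hb)
  have hx := hγ.isIntegralSolution_chart hX (hi u) f hmem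
  let x : C(Icc a b, E) := ⟨fun τ => extChartAt I p (γ τ), hx.1.domRestrict⟩
  have hxe : ∀ s ∈ Icc a b, IccExtend hab x s = extChartAt I p (γ s) := fun s hs => by
    rw [IccExtend_of_mem _ _ hs]; rfl
  have hsol : ∀ τ : Icc a b, x τ = extChartAt I p (γ a) +
      ∫ s in a..τ, chartField X f (IccExtend hab x s) (u s) := by
    intro τ
    refine (hx.2 τ τ.2).trans (congrArg _ (intervalIntegral.integral_congr fun s hs => ?_))
    rw [uIcc_of_le τ.2.1] at hs
    simp only [Function.comp, hxe s ⟨hs.1, hs.2.trans τ.2.2⟩]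
  obtain ⟨S, hS, hSx, hSsol, hSd⟩ := exists_contDiffAt_solutionMap (contDiff_chartField hX f) hab h
    u x _ hsol (fun τ => hC.norm_fderiv_le _) hsmall
  -- near the base point, the solutions stay in the ball where the bump function is one
  have hev : ∀ᶠ z in 𝓝 (extChartAt I p (γ a), u), (∀ τ, S z τ = z.1 +
      ∫ s in a..τ, chartField X f (IccExtend hab (S z) s) (z.2 s)) ∧
      ∀ τ, S z τ ∈ Metric.ball (extChartAt I p p) f.rIn := by
    refine hSsol.and ?_
    have hopen : IsOpen {w : C(Icc a b, E) | MapsTo w univ (Metric.ball (extChartAt I p p) f.rIn)} :=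
      ContinuousMap.isOpen_setOfPred_mapsTo isCompact_univ Metric.isOpen_ball
    have := hS.continuousAt.eventually (hopen.mem_nhds (by
      rw [hSx]; exact fun τ _ => (hmem τ τ.2).2))
    exact this.mono fun z hz τ => hz (mem_univ τ)
  have hsolM : ∀ z, ((∀ τ, S z τ = z.1 +
      ∫ s in a..τ, chartField X f (IccExtend hab (S z) s) (z.2 s)) ∧
      ∀ τ, S z τ ∈ Metric.ball (extChartAt I p p) f.rIn) →
      IsSol X z.2 a b ((extChartAt I p).symm ∘ IccExtend hab (S z)) ∧
        ((extChartAt I p).symm ∘ IccExtend hab (S z)) a = (extChartAt I p).symm z.1 ∧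
        ((extChartAt I p).symm ∘ IccExtend hab (S z)) b = (extChartAt I p).symm (S z ⟨b, hb⟩) := by
    intro z hz
    have hza : S z ⟨a, ha⟩ = z.1 := by
      rw [hz.1 ⟨a, ha⟩, intervalIntegral.integral_same, add_zero]
    have hia : IccExtend hab (S z) a = z.1 := by rw [IccExtend_of_mem _ _ ha, hza]
    refine ⟨IsIntegralSolution.isSol hX f ⟨?_, fun τ hτ => ?_⟩ (hi z.2) fun s hs => ?_, ?_, ?_⟩
    · exact (S z).continuous.Icc_extend'.continuousOn
    · rw [hia, IccExtend_of_mem _ _ hτ]; exact hz.1 ⟨τ, hτ⟩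
    · rw [IccExtend_of_mem _ _ hs]; exact hz.2 _
    · rw [Function.comp, hia]
    · rw [Function.comp, IccExtend_of_mem _ _ hb]
  have hsrc : γ a ∈ (extChartAt I p).source := by rw [extChartAt_source]; exact (hmem a ha).1
  have hchart : ContMDiffAt (I.prod 𝓘(ℝ, ControlSpace k t)) 𝓘(ℝ, E × ControlSpace k t) ∞
      (fun z : M × ControlSpace k t => (extChartAt I p z.1, z.2)) (γ a, u) := by
    have h1 : ContMDiffAt (I.prod 𝓘(ℝ, ControlSpace k t)) 𝓘(ℝ, E) ∞
        (fun z : M × ControlSpace k t => extChartAt I p z.1) (γ a, u) :=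
      ContMDiffAt.comp (γ a, u) (contMDiffAt_extChartAt' (hmem a ha).1) contMDiffAt_fst
    exact h1.prodMk_space contMDiffAt_snd
  have hevM : ∀ᶠ z : M × ControlSpace k t in 𝓝 (γ a, u),
      (∃ γ, IsSol X z.2 a b γ ∧ γ a = z.1) ∧
      flowMap X a b z.2 z.1 = (extChartAt I p).symm (S (extChartAt I p z.1, z.2) ⟨b, hb⟩) := by
    have h1 : ∀ᶠ z : M × ControlSpace k t in 𝓝 (γ a, u), z.1 ∈ (extChartAt I p).source :=
      continuous_fst.continuousAt.eventually ((isOpen_extChartAt_source p).mem_nhds hsrc)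
    filter_upwards [hchart.continuousAt.eventually hev, h1] with z hz hz1
    obtain ⟨h2, h3, h4⟩ := hsolM _ hz
    rw [(extChartAt I p).left_inv hz1] at h3
    exact ⟨⟨_, h2, h3⟩, (flowMap_eq hX (hi z.2) hab h2 h3).trans h4⟩
  let ev : C(Icc a b, E) →L[ℝ] E := ContinuousMap.evalCLM ℝ (⟨b, hb⟩ : Icc a b)
  have hSb : ContDiffAt ℝ ∞ (fun z => S z ⟨b, hb⟩) (extChartAt I p (γ a), u) :=
    ev.contDiff.contDiffAt.comp _ hS
  refine ⟨⟨hevM.mono fun z hz => hz.1, ?_⟩, ?_⟩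
  · have h1 : ContMDiffAt 𝓘(ℝ, E) I ∞ (extChartAt I p).symm
        (S (extChartAt I p (γ a), u) ⟨b, hb⟩) := by
      rw [hSx]
      refine (contMDiffOn_extChartAt_symm p).contMDiffAt ((isOpen_extChartAt_target p).mem_nhds ?_)
      exact ball_subset_target f (hmem b hb).2
    have h2 : ContMDiffAt (I.prod 𝓘(ℝ, ControlSpace k t)) 𝓘(ℝ, E) ∞
        (fun z : M × ControlSpace k t => S (extChartAt I p z.1, z.2) ⟨b, hb⟩) (γ a, u) :=
      ContMDiffAt.comp (γ a, u)
        (g := fun z : E × ControlSpace k t => S z ⟨b, hb⟩) hSb.contMDiffAt hchart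
    exact (ContMDiffAt.comp (γ a, u) h1 h2).congr_of_eventuallyEq (hevM.mono fun z hz => hz.2)
  · have hSd' := (hS.differentiableAt (by norm_num)).hasFDerivAt
    have h1 : HasFDerivAt (fun v : ControlSpace k t => S (extChartAt I p (γ a), v) ⟨b, hb⟩)
        (ev.comp
          ((fderiv ℝ S (extChartAt I p (γ a), u)).comp
            (ContinuousLinearMap.inr ℝ E (ControlSpace k t)))) u :=
      ev.hasFDerivAt.comp u (hSd'.comp u (hasFDerivAt_prodMk_right _ _))
    refine ⟨_, h1.congr_of_eventuallyEq ?_, fun v => ?_⟩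
    · have hc : ContinuousAt (fun v : ControlSpace k t => (γ a, v)) u := by fun_prop
      have hc' : ContinuousAt (fun v : ControlSpace k t => (extChartAt I p (γ a), v)) u := by
        fun_prop
      filter_upwards [hc.eventually hevM, hc'.eventually hev] with v hv hv'
      rw [hv.2, (extChartAt I p).right_inv (ball_subset_target f (hv'.2 _))]
    · refine ⟨IccExtend hab (fderiv ℝ S (extChartAt I p (γ a), u) (0, v)), ⟨?_, fun τ hτ => ?_⟩, ?_⟩
      · exact (ContinuousMap.continuous _).Icc_extend'.continuousOn
      · rw [IccExtend_of_mem _ _ hτ]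
        refine (hSd v ⟨τ, hτ⟩).trans (congrArg₂ _ ?_ ?_) <;>
        · refine intervalIntegral.integral_congr fun s hs => ?_
          rw [uIcc_of_le hτ.1] at hs
          simp only [Function.comp, hxe s ⟨hs.1, hs.2.trans hτ.2⟩]
      · rw [IccExtend_of_mem _ _ hb]; rfl

theorem IsSol.isFlowRegular (hX : ∀ i, IsSmoothVectorField I (X i)) {u : ControlSpace k t}
    (ha : 0 ≤ a) (hab : a ≤ b) (hbt : b ≤ t) (hγ : IsSol X u a b γ) :
    IsFlowRegular X a b u (γ a) := by
  have hi : ∀ {r s}, a ≤ r → r ≤ s → s ≤ b → IntervalIntegrable u volume r s := fun h1 h2 h3 =>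
    ControlSpace.intervalIntegrable u ⟨ha.trans h1, (h2.trans h3).trans hbt⟩
      ⟨(ha.trans h1).trans h2, h3.trans hbt⟩
  refine Icc_induction (P := fun r s => IsFlowRegular X r s u (γ r)) hab ?_ ?_
  · intro r s e h1 h2 h3 h4 h5 h6
    have hγ' := hγ.restrict hX (hi le_rfl hab le_rfl) ⟨h1, (h2.trans h3).trans h4⟩
      ⟨h1.trans h2, h3.trans h4⟩
    refine h5.trans hX (ha.trans h1) h2 h3 (h4.trans hbt) ?_
    rwa [flowMap_eq hX (hi h1 h2 (h3.trans h4)) h2 hγ' rfl]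
  · intro τ hτ
    obtain ⟨f⟩ : Nonempty (SmoothBumpFunction I (γ τ)) := inferInstance
    obtain ⟨C, hC⟩ := exists_isC2Bound (contDiff_chartField hX f) (hasCompactSupport_chartField f)
    obtain ⟨c, d, hcd, hτcd, hN, hsub, hmem, hud, -⟩ :=
      hγ.exists_chart hX (hi le_rfl hab le_rfl) hτ f
    have hp : Tendsto (fun s => (∫ r in τ..s, ‖u r‖) * C) (𝓝[Icc a b] τ)
        (𝓝 ((∫ r in τ..τ, ‖u r‖) * C)) := by
      have h := intervalIntegral.continuousOn_primitive_interval' (b₁ := a) (b₂ := b) (a := τ)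
        (hi le_rfl hab le_rfl).norm (by rwa [uIcc_of_le hab])
      rw [uIcc_of_le hab] at h
      exact (h τ hτ).mul_const C
    rw [intervalIntegral.integral_same, zero_mul] at hp
    refine ⟨_, inter_mem hN (hp.eventually (Ioo_mem_nhds (by norm_num : -(1 / 2 : ℝ) < 0)
      (by norm_num : (0 : ℝ) < 1 / 2))), fun r hr s hs hrI hsI hrs => ?_⟩
    have hsub2 : Icc r s ⊆ Icc c d := Icc_subset_Icc hr.1.1 hs.1.2
    refine (IsSol.flow_chart hX hrs (fun e he => ⟨ha.trans (hsub (hsub2 he)).1,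
      (hsub (hsub2 he)).2.trans hbt⟩) (hγ.restrict hX (hi le_rfl hab le_rfl) hrI hsI) f hC
      (fun e he => hmem e (hsub2 he)) ?_).1
    have hτi : ∀ e ∈ Icc a b, IntervalIntegrable (fun r => ‖u r‖) volume τ e := fun e he =>
      (ControlSpace.intervalIntegrable u ⟨ha.trans hτ.1, hτ.2.trans hbt⟩
        ⟨ha.trans he.1, he.2.trans hbt⟩).norm
    rw [← intervalIntegral.integral_interval_sub_left (hτi s hsI) (hτi r hrI)]
    have h1 : _ < (_ : ℝ) ∧ _ := hr.2
    have h2 : _ < (_ : ℝ) ∧ _ := hs.2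
    linarith [h1.1, h2.2]

/-- The endpoint map read in the chart at `q₁`. -/
def endpointChart (X : Fin k → ∀ q : M, TangentSpace I q) (q₀ : M) (t : ℝ) (q₁ : M)
    (v : ControlSpace k t) : E :=
  extChartAt I q₁ (endpointMap I X q₀ t v)

/-- The flow from time `b` to time `t`, read in the charts at `p` and `q₁`. -/
def tailMap (X : Fin k → ∀ q : M, TangentSpace I q) (b t : ℝ) (u : ℝ → EuclideanSpace ℝ (Fin k))
    (p q₁ : M) (z : E) : E :=
  extChartAt I q₁ (flowMap X b t u ((extChartAt I p).symm z))

variable {q₀ : M}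

/-- The endpoint map is smooth where it is defined. -/
theorem contMDiffAt_endpointMap (hX : ∀ i, IsSmoothVectorField I (X i)) {u : ControlSpace k t}
    (ht : 0 ≤ t) (hγ : IsSol X u 0 t γ) (h0 : γ 0 = q₀) :
    (∀ᶠ v : ControlSpace k t in 𝓝 u, ∃ γ, IsSol X v 0 t γ ∧ γ 0 = q₀) ∧
      ContMDiffAt 𝓘(ℝ, ControlSpace k t) I ∞ (endpointMap I X q₀ t) u := by
  have h := hγ.isFlowRegular hX le_rfl ht le_rfl
  rw [h0] at h
  have hc : ContMDiffAt 𝓘(ℝ, ControlSpace k t) (I.prod 𝓘(ℝ, ControlSpace k t)) ∞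
      (fun v : ControlSpace k t => (q₀, v)) u := contMDiffAt_const.prodMk contMDiffAt_id
  have hev := hc.continuousAt.eventually h.exists_isSol
  refine ⟨hev, (ContMDiffAt.comp u
    (g := fun z : M × ControlSpace k t => flowMap X 0 t z.2 z.1) h.contMDiffAt hc
    ).congr_of_eventuallyEq (hev.mono fun v hv => ?_)⟩
  obtain ⟨γ', h1, h2⟩ := hv
  rw [endpointMap_eq_of_isSol hX ht h1 h2]
  exact (flowMap_eq hX (ControlSpace.intervalIntegrable v (left_mem_Icc.2 ht)
    (right_mem_Icc.2 ht)) ht h1 h2).symm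

theorem contDiffAt_endpointChart (hX : ∀ i, IsSmoothVectorField I (X i)) {u : ControlSpace k t}
    (ht : 0 ≤ t) (hγ : IsSol X u 0 t γ) (h0 : γ 0 = q₀) {q₁ : M} (h1 : γ t = q₁) :
    ContDiffAt ℝ ∞ (endpointChart X q₀ t q₁) u := by
  have h := (contMDiffAt_endpointMap hX ht hγ h0).2
  rw [← contMDiffAt_iff_contDiffAt]
  refine ContMDiffAt.comp u (contMDiffAt_extChartAt' ?_) h
  rw [endpointMap_eq_of_isSol hX ht hγ h0, h1]
  exact mem_chart_source H q₁

theorem mfderiv_apply_eq_fderiv_extChartAt {B : Type*} [NormedAddCommGroup B] [NormedSpace ℝ B]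
    {G : B → M} {u : B} (hG : MDifferentiableAt 𝓘(ℝ, B) I G u) {q : M} (hq : G u = q) (v : B) :
    (mfderiv 𝓘(ℝ, B) I G u v : E) = fderiv ℝ (fun w => extChartAt I q (G w)) u v := by
  subst hq
  have h2 := HasMFDerivAt.comp u (mdifferentiableAt_extChartAt
    (mem_chart_source H (G u))).hasMFDerivAt hG.hasMFDerivAt
  rw [mfderiv_extChartAt_self] at h2
  let D : B →L[ℝ] E := mfderiv 𝓘(ℝ, B) I G u
  have h3 : HasFDerivAt (fun w => extChartAt I (G u) (G w)) D u :=
    hasMFDerivAt_iff_hasFDerivAt.1 h2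
  rw [h3.fderiv]
  rfl

theorem mfderiv_endpointMap_apply (hX : ∀ i, IsSmoothVectorField I (X i)) {u : ControlSpace k t}
    (ht : 0 ≤ t) (hγ : IsSol X u 0 t γ) (h0 : γ 0 = q₀) {q₁ : M}
    (h1 : endpointMap I X q₀ t u = q₁) (v : ControlSpace k t) :
    (mfderiv 𝓘(ℝ, ControlSpace k t) I (endpointMap I X q₀ t) u v : E) =
      fderiv ℝ (endpointChart X q₀ t q₁) u v :=
  mfderiv_apply_eq_fderiv_extChartAt
    ((contMDiffAt_endpointMap hX ht hγ h0).2.mdifferentiableAt (by norm_num)) h1 v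

/-- The derivative of the endpoint map in the direction of a control supported in a short interval
`[a, b]` is the image, under the derivative of the flow from `b` to `t`, of a variation on
`[a, b]`. -/
theorem exists_isVariation_fderiv_endpointChart (hX : ∀ i, IsSmoothVectorField I (X i))
    {u : ControlSpace k t} (ha : 0 ≤ a) (hab : a ≤ b) (hbt : b ≤ t)
    (hγ : IsSol X u 0 t γ) (h0 : γ 0 = q₀) {q₁ : M} (h1 : γ t = q₁) {p : M}
    (f : SmoothBumpFunction I p) (hC : IsC2Bound (chartField X f) C)
    (hmem : ∀ s ∈ Icc a b, γ s ∈ bumpNhd f) (hsmall : (∫ s in a..b, ‖u s‖) * C < 1)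
    (v : ControlSpace k t) (hv : ∀ᵐ s, s ∈ Icc 0 t → s ∉ Ioc a b → v s = 0) :
    ∃ y, IsVariation (chartField X f) u (extChartAt I p ∘ γ) v a b y ∧
      fderiv ℝ (endpointChart X q₀ t q₁) u v =
        fderiv ℝ (tailMap X b t u p q₁) (extChartAt I p (γ b)) (y b) := by
  have ht : 0 ≤ t := (ha.trans hab).trans hbt
  have hi : ∀ (w : ControlSpace k t) {r s}, 0 ≤ r → r ≤ s → s ≤ t →
      IntervalIntegrable w volume r s := fun w r s h1 h2 h3 =>
    ControlSpace.intervalIntegrable w ⟨h1, h2.trans h3⟩ ⟨h1.trans h2, h3⟩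
  have hut := hi u le_rfl ht le_rfl
  have hγ0a := hγ.restrict hX hut ⟨le_rfl, ht⟩ ⟨ha, hab.trans hbt⟩
  have hγab := hγ.restrict hX hut ⟨ha, hab.trans hbt⟩ ⟨ha.trans hab, hbt⟩
  have hγbt := hγ.restrict hX hut ⟨ha.trans hab, hbt⟩ ⟨ht, le_rfl⟩
  obtain ⟨-, L, hL, hLv⟩ := hγab.flow_chart hX hab
    (fun s hs => ⟨ha.trans hs.1, hs.2.trans hbt⟩) f hC hmem hsmall
  obtain ⟨y, hy, hyL⟩ := hLv v
  refine ⟨y, hy, ?_⟩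
  have hbm := hmem b (right_mem_Icc.2 hab)
  have hsrc : γ b ∈ (extChartAt I p).source := by rw [extChartAt_source]; exact hbm.1
  have hub : flowMap X a b u (γ a) = γ b := flowMap_eq hX (hi u ha hab hbt) hab hγab rfl
  -- the tail map is differentiable
  have hreg := hγbt.isFlowRegular hX (ha.trans hab) hbt le_rfl
  have hTail : DifferentiableAt ℝ (tailMap X b t u p q₁) (extChartAt I p (γ b)) := by
    have e1 : ContMDiffAt 𝓘(ℝ, E) I ∞ (extChartAt I p).symm (extChartAt I p (γ b)) :=
      (contMDiffOn_extChartAt_symm p).contMDiffAt ((isOpen_extChartAt_target p).mem_nhds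
        ((extChartAt I p).map_source hsrc))
    have e2 : ContMDiffAt I I ∞ (fun x => flowMap X b t u x)
        ((extChartAt I p).symm (extChartAt I p (γ b))) := by
      rw [(extChartAt I p).left_inv hsrc]
      exact ContMDiffAt.comp (γ b) (g := fun z : M × ControlSpace k t => flowMap X b t z.2 z.1)
        (f := fun x : M => (x, u)) hreg.contMDiffAt (contMDiffAt_id.prodMk contMDiffAt_const)
    have e3 : ContMDiffAt I 𝓘(ℝ, E) ∞ (extChartAt I q₁)
        (flowMap X b t u ((extChartAt I p).symm (extChartAt I p (γ b)))) := by
      refine contMDiffAt_extChartAt' ?_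
      rw [(extChartAt I p).left_inv hsrc,
        flowMap_eq hX (hi u (ha.trans hab) hbt le_rfl) hbt hγbt rfl, h1]
      exact mem_chart_source H q₁
    have e4 : ContMDiffAt 𝓘(ℝ, E) 𝓘(ℝ, E) ∞ (tailMap X b t u p q₁) (extChartAt I p (γ b)) :=
      ContMDiffAt.comp _ e3 (ContMDiffAt.comp _ e2 e1)
    exact (contMDiffAt_iff_contDiffAt.1 e4).differentiableAt (by norm_num)
  have hline : HasDerivAt (fun r : ℝ => u + r • v) v 0 := by
    simpa using ((hasDerivAt_id (0 : ℝ)).smul_const v).const_add u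
  have hlineu : u + (0 : ℝ) • v = u := by rw [zero_smul, add_zero]
  have d1 : HasDerivAt (fun r : ℝ => endpointChart X q₀ t q₁ (u + r • v))
      (fderiv ℝ (endpointChart X q₀ t q₁) u v) 0 := by
    have hF : HasFDerivAt (endpointChart X q₀ t q₁) (fderiv ℝ (endpointChart X q₀ t q₁) u)
        (u + (0 : ℝ) • v) := by
      rw [hlineu]
      exact ((contDiffAt_endpointChart hX ht hγ h0 h1).differentiableAt (by norm_num)).hasFDerivAt
    exact hF.comp_hasDerivAt (0 : ℝ) hline
  have d2 : HasDerivAt (fun r : ℝ => tailMap X b t u p q₁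
      (extChartAt I p (flowMap X a b (u + r • v : ControlSpace k t) (γ a))))
      (fderiv ℝ (tailMap X b t u p q₁) (extChartAt I p (γ b)) (y b)) 0 := by
    have hL' : HasFDerivAt (fun v : ControlSpace k t => extChartAt I p (flowMap X a b v (γ a))) L
        (u + (0 : ℝ) • v) := by rwa [hlineu]
    rw [hyL]
    have hT : HasFDerivAt (tailMap X b t u p q₁)
        (fderiv ℝ (tailMap X b t u p q₁) (extChartAt I p (γ b)))
        (extChartAt I p (flowMap X a b (u + (0 : ℝ) • v : ControlSpace k t) (γ a))) := by
      rw [hlineu, hub]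
      exact hTail.hasFDerivAt
    exact hT.comp_hasDerivAt (0 : ℝ) (hL'.comp_hasDerivAt (0 : ℝ) hline)
  refine d1.unique (d2.congr_of_eventuallyEq ?_)
  -- the solution for the control `u + r v` agrees with `γ` on `[0, a]`, and follows `u` on `[b, t]`
  have hcoe : ∀ r : ℝ, ∀ᵐ s, s ∈ Icc 0 t → (u + r • v : ControlSpace k t) s = u s + r • v s := by
    intro r
    have h1 := (ae_restrict_iff' (measurableSet_Icc (a := (0:ℝ)) (b := t))).1 (Lp.coeFn_add u (r • v))
    have h2 := (ae_restrict_iff' (measurableSet_Icc (a := (0:ℝ)) (b := t))).1 (Lp.coeFn_smul r v)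
    filter_upwards [h1, h2] with s h1 h2 hs
    rw [h1 hs, Pi.add_apply, h2 hs, Pi.smul_apply]
  have hlc : ContinuousAt (fun r : ℝ => u + r • v) 0 := hline.continuousAt
  have hev1 : ∀ᶠ r : ℝ in 𝓝 0, ∃ γ', IsSol X (u + r • v : ControlSpace k t) 0 t γ' ∧ γ' 0 = q₀ := by
    have := (contMDiffAt_endpointMap hX ht hγ h0).1
    rw [← hlineu] at this
    exact hlc.eventually this
  have hev2 : ∀ᶠ r : ℝ in 𝓝 0,
      flowMap X a b (u + r • v : ControlSpace k t) (γ a) ∈ (extChartAt I p).source := by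
    have e1 := (hγab.isFlowRegular hX ha hab hbt).contMDiffAt.continuousAt
    have e2 : ContinuousAt (fun r : ℝ => ((γ a, u + r • v) : M × ControlSpace k t)) 0 :=
      continuousAt_const.prodMk hlc
    have e3 : ContinuousAt (fun r : ℝ => flowMap X a b (u + r • v : ControlSpace k t) (γ a)) 0 :=
      ContinuousAt.comp (g := fun z : M × ControlSpace k t => flowMap X a b z.2 z.1)
        (by rw [hlineu]; exact e1) e2
    have e4 : flowMap X a b (u + (0 : ℝ) • v : ControlSpace k t) (γ a) ∈
        (extChartAt I p).source := by rwa [hlineu, hub]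
    exact e3.eventually ((isOpen_extChartAt_source p).mem_nhds e4)
  filter_upwards [hev1, hev2] with r hr1 hr2
  obtain ⟨γ', hγ', h0'⟩ := hr1
  set w : ControlSpace k t := u + r • v with hw
  have hwt := hi w le_rfl ht le_rfl
  have g1 : γ' a = γ a := by
    have e1 : IsSol X u 0 a γ' := by
      refine (hγ'.restrict hX hwt ⟨le_rfl, ht⟩ ⟨ha, hab.trans hbt⟩).congr ?_ fun _ _ => rfl
      filter_upwards [hcoe r, hv] with s h1 h2 hs
      have hsI : s ∈ Icc 0 t := ⟨hs.1.le, hs.2.trans (hab.trans hbt)⟩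
      rw [h1 hsI, h2 hsI (fun h => absurd hs.2 (not_le.2 h.1)), smul_zero, add_zero]
    exact e1.eqOn hX hγ0a (hi u le_rfl ha (hab.trans hbt)) (h0'.trans h0.symm) (right_mem_Icc.2 ha)
  have g2 : flowMap X a b w (γ a) = γ' b :=
    flowMap_eq hX (hi w ha hab hbt) hab
      (hγ'.restrict hX hwt ⟨ha, hab.trans hbt⟩ ⟨ha.trans hab, hbt⟩) g1
  have g3 : flowMap X b t u (γ' b) = γ' t := by
    have e1 : flowMap X b t u = flowMap X b t w := by
      refine flowMap_congr ?_
      filter_upwards [hcoe r, hv] with s h1 h2 hs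
      have hsI : s ∈ Icc 0 t := ⟨(ha.trans hab).trans hs.1.le, hs.2⟩
      rw [h1 hsI, h2 hsI (fun h => absurd hs.1 (not_lt.2 h.2)), smul_zero, add_zero]
    rw [e1]
    exact flowMap_eq hX (hi w (ha.trans hab) hbt le_rfl) hbt
      (hγ'.restrict hX hwt ⟨ha.trans hab, hbt⟩ ⟨ht, le_rfl⟩) rfl
  rw [tailMap, (extChartAt I p).left_inv hr2, g2, g3, endpointChart,
    endpointMap_eq_of_isSol hX ht hγ' h0']

end Flow

/-! ### Controls of small norm end in the ball; the tangent functional -/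

theorem exists_eq_const_mul_inner {B : Type*} [NormedAddCommGroup B] [InnerProductSpace ℝ B]
    {S : Set B} (hS : Dense S) {u : B} (hu : u ≠ 0) (ℓ : B →L[ℝ] ℝ)
    (h : ∀ v ∈ S, inner ℝ u v < 0 → ℓ v ≤ 0) : ∃ c, 0 ≤ c ∧ ∀ v, ℓ v = c * inner ℝ u v := by
  have h1 : ∀ v, inner ℝ u v < 0 → ℓ v ≤ 0 := by
    intro v hv
    by_contra! hc
    have ho1 : IsOpen {w : B | inner ℝ u w < 0} := isOpen_lt (by fun_prop) continuous_const
    have ho2 : IsOpen {w : B | 0 < ℓ w} := isOpen_lt continuous_const ℓ.continuous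
    have ho : IsOpen {w : B | inner ℝ u w < 0 ∧ 0 < ℓ w} := ho1.inter ho2
    obtain ⟨w, hw, hwS⟩ := hS.inter_open_nonempty _ ho ⟨v, hv, hc⟩
    exact absurd (h w hwS hw.1) (not_le.2 hw.2)
  have hpos : 0 < inner ℝ u u := real_inner_self_pos.2 hu
  have h2 : 0 ≤ ℓ u := by
    have := h1 (-u) (by rw [inner_neg_right]; linarith)
    rw [map_neg] at this
    linarith
  have h3 : ∀ v, inner ℝ u v = 0 → ℓ v ≤ 0 := by
    intro v hv
    refine le_of_forall_pos_le_add fun ε hε => ?_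
    have h4 := h1 (v - (ε / (ℓ u + 1)) • u) (by
      rw [inner_sub_right, inner_smul_right, hv]
      have : 0 < ε / (ℓ u + 1) * inner ℝ u u := by positivity
      linarith)
    rw [map_sub, map_smul, smul_eq_mul] at h4
    have h5 : ε / (ℓ u + 1) * ℓ u ≤ ε := by
      rw [div_mul_eq_mul_div, div_le_iff₀ (by linarith)]
      nlinarith
    linarith
  refine ⟨ℓ u / inner ℝ u u, by positivity, fun v => ?_⟩
  set w := v - (inner ℝ u v / inner ℝ u u) • u with hw
  have hw0 : inner ℝ u w = 0 := by
    rw [hw, inner_sub_right, inner_smul_right]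
    field_simp
    ring
  have h4 : ℓ w = 0 := by
    refine le_antisymm (h3 w hw0) ?_
    have := h3 (-w) (by rw [inner_neg_right, hw0, neg_zero])
    rw [map_neg] at this
    linarith
  rw [hw, map_sub, map_smul, smul_eq_mul, sub_eq_zero] at h4
  rw [h4]
  ring

theorem ControlSpace.dense_bounded (k : ℕ) (t : ℝ) : Dense {v : ControlSpace k t |
    ∃ R : ℝ, ∀ᵐ s ∂(volume.restrict (Icc 0 t)), ‖v s‖ ≤ R} := by
  refine (Lp.simpleFunc.dense (E := EuclideanSpace ℝ (Fin k))
    (μ := volume.restrict (Icc (0 : ℝ) t)) (p := 2) (by norm_num)).mono fun v hv => ?_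
  obtain ⟨R, hR⟩ := (Lp.simpleFunc.toSimpleFunc ⟨v, hv⟩).exists_forall_norm_le
  refine ⟨R, ?_⟩
  filter_upwards [Lp.simpleFunc.toSimpleFunc_eq_toFun ⟨v, hv⟩] with s hs
  have := hR s
  rwa [hs] at this

theorem ControlSpace.norm_sq_eq_of_norm_eq_one {k : ℕ} {t : ℝ} (ht : 0 ≤ t) (u : ControlSpace k t)
    (hu : ∀ᵐ s ∂(volume.restrict (Icc 0 t)), ‖u s‖ = 1) : ‖u‖ ^ 2 = t := by
  rw [← real_inner_self_eq_norm_sq, L2.inner_def]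
  have : ∀ᵐ s ∂(volume.restrict (Icc 0 t)), inner ℝ (u s) (u s) = (1 : ℝ) := by
    filter_upwards [hu] with s hs
    rw [real_inner_self_eq_norm_sq, hs, one_pow]
  rw [integral_congr_ae this]
  simp [ht]

section Ball

variable {E : Type*} [NormedAddCommGroup E] [NormedSpace ℝ E] [FiniteDimensional ℝ E]
  {H : Type*} [TopologicalSpace H] {I : ModelWithCorners ℝ E H} [I.Boundaryless]
  {M : Type*} [TopologicalSpace M] [ChartedSpace H M] [IsManifold I ∞ M] [T2Space M]
  {F : Type*} [NormedAddCommGroup F] [NormedSpace ℝ F] [FiniteDimensional ℝ F]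
  {U : M → Type*} [TopologicalSpace (TotalSpace F U)]
  [∀ q, NormedAddCommGroup (U q)] [∀ q, InnerProductSpace ℝ (U q)]
  [FiberBundle F U] [VectorBundle ℝ F U] [ContMDiffVectorBundle ∞ F U I]
  {f : ∀ q, U q →ₗ[ℝ] TangentSpace I q} {k : ℕ} {σ : Fin k → ∀ q, U q}

theorem IsSubriemannianStructure.isSmoothVectorField (hf : IsSubriemannianStructure I F f)
    (hσ : IsFreePresentation I F σ) (i : Fin k) :
    IsSmoothVectorField I (fun q => f q (σ i q)) :=
  hf.smooth.comp (hσ.smooth i)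

theorem fieldSum_comp (q : M) (a : EuclideanSpace ℝ (Fin k)) :
    fieldSum (fun i q => f q (σ i q)) q a = f q (∑ i, a i • σ i q) := by
  rw [fieldSum, map_sum]
  simp only [map_smul]

theorem IsFreePresentation.norm_sum_le (hσ : IsFreePresentation I F σ) (q : M)
    (a : EuclideanSpace ℝ (Fin k)) : ‖∑ i, a i • σ i q‖ ≤ ‖a‖ :=
  (hσ.norm_eq_min q _).2 ⟨a, rfl, rfl⟩

theorem IsFreePresentation.continuous_sum (hσ : IsFreePresentation I F σ) :
    Continuous (fun z : M × EuclideanSpace ℝ (Fin k) =>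
      (⟨z.1, ∑ i, z.2 i • σ i z.1⟩ : TotalSpace F U)) := by
  rw [continuous_iff_continuousAt]
  intro z₀
  rw [FiberBundle.continuousAt_totalSpace]
  refine ⟨continuous_fst.continuousAt, ?_⟩
  set e := trivializationAt F U z₀.1 with he
  have hb : ∀ᶠ z : M × EuclideanSpace ℝ (Fin k) in 𝓝 z₀, z.1 ∈ e.baseSet :=
    continuous_fst.continuousAt.eventually
      (e.open_baseSet.mem_nhds (FiberBundle.mem_baseSet_trivializationAt' z₀.1))
  have h1 : ∀ i, ContinuousAt (fun q => (e ⟨q, σ i q⟩).2) z₀.1 := fun i =>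
    ((FiberBundle.continuousAt_totalSpace F _).1 (hσ.smooth i).continuous.continuousAt).2
  have h2 : ContinuousAt (fun z : M × EuclideanSpace ℝ (Fin k) =>
      ∑ i, z.2 i • (e ⟨z.1, σ i z.1⟩).2) z₀ := by
    refine tendsto_finsetSum _ fun i _ => ?_
    have h3 : ContinuousAt (fun z : M × EuclideanSpace ℝ (Fin k) => z.2 i) z₀ :=
      ((EuclideanSpace.proj i : EuclideanSpace ℝ (Fin k) →L[ℝ] ℝ).continuous.comp
        continuous_snd).continuousAt
    exact h3.smul ((h1 i).comp (f := Prod.fst) continuous_fst.continuousAt)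
  refine h2.congr (hb.mono fun z hz => ?_)
  simp only
  have h3 : ∀ y : U z.1, (e ⟨z.1, y⟩).2 = e.continuousLinearMapAt ℝ z.1 y := fun y =>
    (e.continuousLinearMapAt_apply_of_mem ℝ hz y).symm
  simp only [h3, map_sum, map_smul]

/-- A solution for a bounded control is horizontal, and no longer than the control. -/
theorem IsSol.exists_isHorizontalLift (hf : IsSubriemannianStructure I F f)
    (hσ : IsFreePresentation I F σ) {t : ℝ} {u : ℝ → EuclideanSpace ℝ (Fin k)} {γ : ℝ → M}
    (hγ : IsSol (fun i q => f q (σ i q)) u 0 t γ) (hui : IntervalIntegrable u volume 0 t)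
    (hum : Measurable u) {R : ℝ} (hR : ∀ᵐ s ∂(volume.restrict (Icc 0 t)), ‖u s‖ ≤ R) :
    ∃ w : ∀ τ, U (γ τ), IsHorizontalLift I F f t γ w ∧
      ∫⁻ τ in Icc 0 t, ‖w τ‖ₑ ≤ ∫⁻ τ in Icc 0 t, ‖u τ‖ₑ := by
  classical
  have hX := hf.isSmoothVectorField hσ
  set u₁ : ℝ → EuclideanSpace ℝ (Fin k) := fun s => if ‖u s‖ ≤ R then u s else 0 with hu₁
  have hu₁m : Measurable u₁ :=
    Measurable.ite (measurableSet_le hum.norm measurable_const) hum measurable_const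
  have hae : ∀ᵐ s ∂(volume.restrict (Icc 0 t)), u s = u₁ s := by
    filter_upwards [hR] with s hs
    rw [hu₁]
    simp only [if_pos hs]
  have hu₁R : ∀ s, ‖u₁ s‖ ≤ max R 0 := by
    intro s
    rw [hu₁]
    simp only
    split_ifs with h
    · exact h.trans (le_max_left _ _)
    · rw [norm_zero]; exact le_max_right _ _
  refine ⟨fun τ => ∑ i, u₁ τ i • σ i (γ τ),
    ⟨?_, ⟨max R 0, fun τ _ => (hσ.norm_sum_le _ _).trans (hu₁R τ)⟩, ?_⟩, ?_⟩
  · let _ : MeasurableSpace (TotalSpace F U) := borel _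
    have : BorelSpace (TotalSpace F U) := ⟨rfl⟩
    have h1 : Continuous (fun z : Icc (0 : ℝ) t × EuclideanSpace ℝ (Fin k) =>
        (⟨γ z.1, ∑ i, z.2 i • σ i (γ z.1)⟩ : TotalSpace F U)) :=
      hσ.continuous_sum.comp ((hγ.continuousOn.domRestrict.comp continuous_fst).prodMk
        continuous_snd)
    exact h1.measurable.comp (measurable_id.prodMk (hu₁m.comp measurable_subtype_coe))
  · filter_upwards [hγ.ae_hasVelocityWithinAt hX hui, hae] with τ h1 h2
    rw [fieldSum_comp, h2] at h1
    exact h1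
  · refine lintegral_mono_ae ?_
    filter_upwards [hae] with τ hτ
    rw [hτ, enorm_le_iff_norm_le]
    exact hσ.norm_sum_le _ _

/-- A trajectory of a bounded control of norm at most `√t` ends in the ball of radius `t`. -/
theorem IsSol.mem_subriemannianBall (hf : IsSubriemannianStructure I F f)
    (hσ : IsFreePresentation I F σ) {t : ℝ} (ht : 0 ≤ t) {u : ControlSpace k t} {γ : ℝ → M}
    (hγ : IsSol (fun i q => f q (σ i q)) u 0 t γ) {R : ℝ}
    (hR : ∀ᵐ s ∂(volume.restrict (Icc 0 t)), ‖u s‖ ≤ R) (hu : ‖u‖ ^ 2 ≤ t) :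
    γ t ∈ subriemannianBall I F f (γ 0) t := by
  have hX := hf.isSmoothVectorField hσ
  have hui := ControlSpace.intervalIntegrable u (left_mem_Icc.2 ht) (right_mem_Icc.2 ht)
  obtain ⟨w, hw, hwu⟩ := hγ.exists_isHorizontalLift hf hσ hui (Lp.stronglyMeasurable u).measurable hR
  have hL : ∫⁻ τ in Icc 0 t, ‖u τ‖ₑ ≤ ENNReal.ofReal t := by
    rw [← ofReal_integral_norm_eq_lintegral_enorm u.integrableOn]
    refine ENNReal.ofReal_le_ofReal ?_
    rw [integral_Icc_eq_integral_Ioc, ← intervalIntegral.integral_of_le ht]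
    refine (u.integral_norm_le (left_mem_Icc.2 ht) (right_mem_Icc.2 ht) ht).trans ?_
    rw [sub_zero]
    have h1 : ‖u‖ ≤ √t := Real.le_sqrt_of_sq_le hu
    calc √t * ‖u‖ ≤ √t * √t := by gcongr
      _ = t := Real.mul_self_sqrt ht
  have hLip : IsLipschitzCurve I t γ :=
    hγ.isLipschitzCurve hX hui ((ae_restrict_iff' measurableSet_Icc).1 hR)
  change subriemannianDist I F f (γ 0) (γ t) ≤ ENNReal.ofReal t
  refine le_trans ?_ (hwu.trans hL)
  refine (iInf₂_le t ht).trans ((iInf₂_le γ ⟨hLip, w, hw⟩).trans ?_)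
  rw [iInf_pos rfl, iInf_pos rfl]
  exact iInf₂_le w hw

theorem totalSpace_mk_eq_of_eq {q q' : M} (h : q = q') {ξ : TangentSpace I q} {w : E}
    (hw : w = ξ) : (⟨q, ξ⟩ : TangentBundle I M) = ⟨q', (w : TangentSpace I q')⟩ := by
  subst h
  rw [hw]

/-- If `B_{q₀}(t)` has a tangent hyperplane at the end of a trajectory of a control of norm one,
then the differential of the endpoint map composed with the tangent functional is a nonnegative
multiple of the scalar product with the control. -/
theorem IsTangentHyperplane.exists_eq_const_mul_inner (hf : IsSubriemannianStructure I F f)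
    (hσ : IsFreePresentation I F σ) {t : ℝ} (ht : 0 < t) {u : ControlSpace k t} {γ : ℝ → M}
    {q₀ q₁ : M} (hγ : IsSol (fun i q => f q (σ i q)) u 0 t γ) (h0 : γ 0 = q₀) (h1 : γ t = q₁)
    (hu : ∀ᵐ s ∂(volume.restrict (Icc 0 t)), ‖u s‖ = 1) {α : E →L[ℝ] ℝ}
    (hα : IsTangentHyperplane I (subriemannianBall I F f q₀ t) q₁
      (α.toLinearMap : TangentSpace I q₁ →ₗ[ℝ] ℝ)) :
    ∃ c, 0 ≤ c ∧ ∀ v, α (fderiv ℝ (endpointChart (fun i q => f q (σ i q)) q₀ t q₁) u v) =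
      c * inner ℝ u v := by
  have hX := hf.isSmoothVectorField hσ
  set X : Fin k → ∀ q : M, TangentSpace I q := fun i q => f q (σ i q) with hXdef
  have hnorm : ‖u‖ ^ 2 = t := u.norm_sq_eq_of_norm_eq_one ht.le hu
  have hu0 : u ≠ 0 := by
    rintro rfl
    rw [norm_zero] at hnorm
    norm_num at hnorm
    linarith
  refine _root_.exists_eq_const_mul_inner (ControlSpace.dense_bounded k t) hu0
    (α.comp (fderiv ℝ (endpointChart X q₀ t q₁) u)) fun v hv hneg => ?_
  obtain ⟨R, hR⟩ := hv
  rw [ContinuousLinearMap.comp_apply]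
  by_contra! hpos
  have hline : HasDerivAt (fun r : ℝ => u + r • v) v 0 := by
    simpa using ((hasDerivAt_id (0 : ℝ)).smul_const v).const_add u
  have hlineu : u + (0 : ℝ) • v = u := by rw [zero_smul, add_zero]
  have hev : ∀ᶠ r : ℝ in 𝓝 0, ∃ γ', IsSol X (u + r • v : ControlSpace k t) 0 t γ' ∧ γ' 0 = q₀ := by
    have := (contMDiffAt_endpointMap hX ht.le hγ h0).1
    rw [← hlineu] at this
    exact hline.continuousAt.eventually this
  obtain ⟨δ, hδ, hball⟩ := Metric.eventually_nhds_iff.1 hev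
  have hsolδ : ∀ s ∈ Ioo (-1 : ℝ) 1, ∃ γ', IsSol X (u + (δ * s) • v : ControlSpace k t) 0 t γ' ∧
      γ' 0 = q₀ := by
    intro s hs
    refine hball ?_
    rw [Real.dist_eq, sub_zero, abs_mul, abs_of_pos hδ]
    have : |s| < 1 := abs_lt.2 hs
    nlinarith
  set φ : ℝ → M := fun s => endpointMap I X q₀ t (u + (δ * s) • v) with hφ
  have hφs : ∀ s ∈ Ioo (-1 : ℝ) 1, ContMDiffAt 𝓘(ℝ, ℝ) I ∞ φ s := by
    intro s hs
    obtain ⟨γ', h1', h2'⟩ := hsolδ s hs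
    have e1 := (contMDiffAt_endpointMap hX ht.le h1' h2').2
    have e2 : ContMDiffAt 𝓘(ℝ, ℝ) 𝓘(ℝ, ControlSpace k t) ∞
        (fun s : ℝ => (u + (δ * s) • v : ControlSpace k t)) s := by
      rw [contMDiffAt_iff_contDiffAt]
      fun_prop
    exact ContMDiffAt.comp s (g := endpointMap I X q₀ t) e1 e2
  have h00 : (0 : ℝ) ∈ Ioo (-1 : ℝ) 1 := by norm_num
  have hend : endpointMap I X q₀ t u = q₁ := by
    rw [endpointMap_eq_of_isSol hX ht.le hγ h0, h1]
  have hφ0 : φ 0 = q₁ := by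
    rw [hφ]
    simp only [mul_zero]
    rw [hlineu, hend]
  have hvel : (mfderiv 𝓘(ℝ, ℝ) I φ 0 (1 : ℝ) : E) =
      δ • fderiv ℝ (endpointChart X q₀ t q₁) u v := by
    refine (mfderiv_apply_eq_fderiv_extChartAt
      ((hφs 0 h00).mdifferentiableAt (by norm_num)) hφ0 (1 : ℝ)).trans ?_
    have hF : HasFDerivAt (endpointChart X q₀ t q₁) (fderiv ℝ (endpointChart X q₀ t q₁) u)
        ((fun s : ℝ => u + (δ * s) • v) 0) := by
      simp only [mul_zero]
      rw [hlineu]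
      exact ((contDiffAt_endpointChart hX ht.le hγ h0 h1).differentiableAt
        (by norm_num)).hasFDerivAt
    have hl : HasDerivAt (fun s : ℝ => u + (δ * s) • v) (δ • v) 0 := by
      simpa using (((hasDerivAt_id (0 : ℝ)).const_mul δ).smul_const v).const_add u
    have := hF.comp_hasDerivAt (0 : ℝ) hl
    rw [map_smul] at this
    exact (fderiv_apply_one_eq_deriv (f := fun w => extChartAt I q₁ (φ w)) (x := 0)).trans this.deriv
  obtain ⟨ε, hε, hε1, hout, -⟩ := hα.2 φ (fun s hs => (hφs s hs).contMDiffWithinAt)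
    (δ • fderiv ℝ (endpointChart X q₀ t q₁) u v : E)
    (by
      have : 0 < α (δ • fderiv ℝ (endpointChart X q₀ t q₁) u v) := by
        rw [map_smul, smul_eq_mul]; positivity
      exact this)
    (totalSpace_mk_eq_of_eq hφ0 hvel.symm)
  -- for small positive times the control has norm at most `√t`
  have hsmall : ∀ᶠ s : ℝ in 𝓝 0, 2 * inner ℝ u v + δ * s * ‖v‖ ^ 2 < 0 := by
    have hc : ContinuousAt (fun s : ℝ => 2 * inner ℝ u v + δ * s * ‖v‖ ^ 2) 0 := by fun_prop
    refine hc.eventually_lt_const ?_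
    simp only [mul_zero, zero_mul, add_zero]
    linarith
  obtain ⟨ε', hε', hsm⟩ := Metric.eventually_nhds_iff.1 hsmall
  set s := min (ε / 2) (ε' / 2) with hs
  have hs0 : 0 < s := lt_min (by linarith) (by linarith)
  have hsε : s ≤ ε / 2 := min_le_left _ _
  have hsε' : s ≤ ε' / 2 := min_le_right _ _
  have hsI : s ∈ Ioo (-1 : ℝ) 1 := ⟨by linarith, by linarith⟩
  refine hout s ⟨hs0, by linarith⟩ ?_
  obtain ⟨γ', hγ', h0'⟩ := hsolδ s hsI
  have hφe : φ s = γ' t := endpointMap_eq_of_isSol hX ht.le hγ' h0'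
  rw [hφe, ← h0']
  refine hγ'.mem_subriemannianBall hf hσ ht.le (R := 1 + |δ * s| * R) ?_ ?_
  · filter_upwards [hu, hR, Lp.coeFn_add u ((δ * s) • v), Lp.coeFn_smul (δ * s) v]
      with e h1 h2 h3 h4
    rw [h3, Pi.add_apply, h4, Pi.smul_apply]
    refine (norm_add_le _ _).trans ?_
    rw [h1, norm_smul, Real.norm_eq_abs]
    gcongr
  · rw [norm_add_sq_real, hnorm, inner_smul_right, norm_smul, mul_pow, Real.norm_eq_abs, sq_abs]
    have h3 : 2 * inner ℝ u v + δ * s * ‖v‖ ^ 2 < 0 := hsm (by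
      rw [Real.dist_eq, sub_zero, abs_of_pos hs0]; linarith)
    have h4 : 0 < δ * s := by positivity
    nlinarith

end Ball

/-! ### Minimal controls -/

section MinimalSelection

variable {Ω : Type*} [MeasurableSpace Ω] {μ : Measure Ω}
  {V : Type*} [NormedAddCommGroup V] [InnerProductSpace ℝ V] [FiniteDimensional ℝ V]

/-- The square integrable functions with values in the subspaces `N ρ`. -/
def l2Subspace (μ : Measure Ω) (N : Ω → Submodule ℝ V) : Submodule ℝ (Lp V 2 μ) where
  carrier := {b | ∀ᵐ ρ ∂μ, b ρ ∈ N ρ}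
  zero_mem' := by
    change ∀ᵐ ρ ∂μ, (0 : Lp V 2 μ) ρ ∈ N ρ
    filter_upwards [Lp.coeFn_zero V 2 μ] with ρ hρ
    rw [hρ]; exact (N ρ).zero_mem
  add_mem' := by
    intro a b (ha : ∀ᵐ ρ ∂μ, a ρ ∈ N ρ) (hb : ∀ᵐ ρ ∂μ, b ρ ∈ N ρ)
    change ∀ᵐ ρ ∂μ, (a + b) ρ ∈ N ρ
    filter_upwards [ha, hb, Lp.coeFn_add a b] with ρ h1 h2 h3
    rw [h3]; exact (N ρ).add_mem h1 h2
  smul_mem' := by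
    intro c a (ha : ∀ᵐ ρ ∂μ, a ρ ∈ N ρ)
    change ∀ᵐ ρ ∂μ, (c • a) ρ ∈ N ρ
    filter_upwards [ha, Lp.coeFn_smul c a] with ρ h1 h3
    rw [h3]; exact (N ρ).smul_mem c h1

theorem mem_l2Subspace {N : Ω → Submodule ℝ V} {b : Lp V 2 μ} :
    b ∈ l2Subspace μ N ↔ ∀ᵐ ρ ∂μ, b ρ ∈ N ρ := Iff.rfl

theorem isClosed_l2Subspace (N : Ω → Submodule ℝ V) :
    IsClosed (l2Subspace μ N : Set (Lp V 2 μ)) := by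
  refine isClosed_of_closure_subset fun b hb => ?_
  obtain ⟨b', hb', hlim⟩ := mem_closure_iff_seq_limit.1 hb
  obtain ⟨ns, -, hns⟩ := (tendstoInMeasure_of_tendsto_Lp hlim).exists_seq_tendsto_ae
  have h1 : ∀ᵐ ρ ∂μ, ∀ n, b' n ρ ∈ N ρ := ae_all_iff.2 fun n => hb' n
  change ∀ᵐ ρ ∂μ, b ρ ∈ N ρ
  filter_upwards [h1, hns] with ρ h2 h3
  exact (N ρ).closed_of_finiteDimensional.mem_of_tendsto h3 (Eventually.of_forall fun n => h2 _)

theorem indicator_mem_l2Subspace {N : Ω → Submodule ℝ V} {d : Lp V 2 μ} {A : Set Ω}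
    (hA : MeasurableSet A) (hd : ∀ᵐ ρ ∂μ, ρ ∈ A → d ρ ∈ N ρ) :
    ((Lp.memLp d).indicator hA).toLp _ ∈ l2Subspace μ N := by
  rw [mem_l2Subspace]
  filter_upwards [hd, ((Lp.memLp d).indicator hA).coeFn_toLp] with ρ h1 h2
  rw [h2]
  by_cases h : ρ ∈ A
  · rw [indicator_of_mem h]; exact h1 h
  · rw [indicator_of_notMem h]; exact (N ρ).zero_mem

/-- Functions orthogonal to `l2Subspace μ N` are pointwise orthogonal to its elements. -/
theorem ae_inner_eq_zero_of_mem_orthogonal {N : Ω → Submodule ℝ V} {a d : Lp V 2 μ}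
    (ha : a ∈ (l2Subspace μ N)ᗮ) (hd : d ∈ l2Subspace μ N) :
    ∀ᵐ ρ ∂μ, inner ℝ (a ρ) (d ρ) = (0 : ℝ) := by
  refine (L2.integrable_inner a d).ae_eq_zero_of_forall_setIntegral_eq_zero fun A hA _ => ?_
  have h1 := (Submodule.mem_orthogonal' _ _).1 ha _
    (indicator_mem_l2Subspace hA ((mem_l2Subspace.1 hd).mono fun ρ h _ => h))
  rw [L2.inner_def] at h1
  rw [← h1, ← integral_indicator hA]
  refine integral_congr_ae ?_
  filter_upwards [((Lp.memLp d).indicator hA).coeFn_toLp] with ρ h2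
  rw [h2]
  by_cases h : ρ ∈ A
  · simp only [indicator_of_mem h]
  · simp only [indicator_of_notMem h, inner_zero_right]

/-- Modulo the subspaces `N ρ`, each square integrable function has a representative of pointwise
minimal norm. -/
theorem exists_minimal_representative (N : Ω → Submodule ℝ V) (u : Lp V 2 μ) :
    ∃ a : Lp V 2 μ, (∀ᵐ ρ ∂μ, u ρ - a ρ ∈ N ρ) ∧ ∀ (b : Lp V 2 μ) (A : Set Ω), MeasurableSet A →
      (∀ᵐ ρ ∂μ, ρ ∈ A → b ρ - a ρ ∈ N ρ) → ∀ᵐ ρ ∂μ, ρ ∈ A → ‖a ρ‖ ≤ ‖b ρ‖ := by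
  set K := l2Subspace μ N with hK
  have : CompleteSpace K := (isClosed_l2Subspace N).completeSpace_coe
  refine ⟨u - K.starProjection u, ?_, fun b A hA hb => ?_⟩
  · have h1 : K.starProjection u ∈ l2Subspace μ N := K.starProjection_apply_mem u
    filter_upwards [mem_l2Subspace.1 h1, Lp.coeFn_sub u (K.starProjection u)] with ρ h2 h3
    rw [h3, Pi.sub_apply, sub_sub_cancel]
    exact h2
  · set a := u - K.starProjection u with ha
    have haK : a ∈ Kᗮ := K.sub_starProjection_mem_orthogonal u
    have hb' : ∀ᵐ ρ ∂μ, ρ ∈ A → (b - a) ρ ∈ N ρ := by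
      filter_upwards [hb, Lp.coeFn_sub b a] with ρ h1 h2
      rw [h2]; exact h1
    filter_upwards [ae_inner_eq_zero_of_mem_orthogonal haK (indicator_mem_l2Subspace hA hb'),
      ((Lp.memLp (b - a)).indicator hA).coeFn_toLp, Lp.coeFn_sub b a] with ρ h1 h2 h3 hρ
    rw [h2, indicator_of_mem hρ, h3, Pi.sub_apply] at h1
    have h4 : ‖b ρ‖ ^ 2 = ‖a ρ‖ ^ 2 + ‖b ρ - a ρ‖ ^ 2 := by
      have := norm_add_sq_real (a ρ) (b ρ - a ρ)
      rw [add_sub_cancel, h1] at this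
      linarith
    exact le_of_sq_le_sq (by nlinarith [sq_nonneg ‖b ρ - a ρ‖]) (norm_nonneg _)

end MinimalSelection

section ShortestPath

variable {E : Type*} [NormedAddCommGroup E] [NormedSpace ℝ E] [FiniteDimensional ℝ E]
  {H : Type*} [TopologicalSpace H] {I : ModelWithCorners ℝ E H} [I.Boundaryless]
  {M : Type*} [TopologicalSpace M] [ChartedSpace H M] [IsManifold I ∞ M] [T2Space M]
  {F : Type*} [NormedAddCommGroup F] [NormedSpace ℝ F] [FiniteDimensional ℝ F]
  {U : M → Type*} [TopologicalSpace (TotalSpace F U)]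
  [∀ q, NormedAddCommGroup (U q)] [∀ q, InnerProductSpace ℝ (U q)]
  [FiberBundle F U] [VectorBundle ℝ F U] [ContMDiffVectorBundle ∞ F U I]
  [IsContMDiffRiemannianBundle I ∞ F U]
  {f : ∀ q, U q →ₗ[ℝ] TangentSpace I q} {k : ℕ} {σ : Fin k → ∀ q, U q}

/-- The coordinates `⟨σᵢ(q), u⟩`. -/
def frameCoord (σ : Fin k → ∀ q, U q) (q : M) (u : U q) : EuclideanSpace ℝ (Fin k) :=
  WithLp.toLp 2 fun i => inner ℝ (σ i q) u

theorem IsFreePresentation.sum_frameCoord (hσ : IsFreePresentation I F σ) (q : M) (u : U q) :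
    ∑ i, frameCoord σ q u i • σ i q = u ∧ ‖frameCoord σ q u‖ = ‖u‖ := by
  obtain ⟨a, hau, han⟩ := (hσ.norm_eq_min q u).1
  have h1 : ∀ a : EuclideanSpace ℝ (Fin k), inner ℝ a (frameCoord σ q u) =
      inner ℝ (∑ i, a i • σ i q) u := by
    intro a
    rw [sum_inner, PiLp.inner_apply]
    refine Finset.sum_congr rfl fun i _ => ?_
    rw [inner_smul_left]
    simp [frameCoord, mul_comm]
  have h2 : ‖frameCoord σ q u‖ ^ 2 ≤ ‖frameCoord σ q u‖ * ‖u‖ := by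
    rw [← real_inner_self_eq_norm_sq, h1]
    exact (real_inner_le_norm _ _).trans
      (mul_le_mul_of_nonneg_right (hσ.norm_sum_le q _) (norm_nonneg _))
  have h3 : ‖frameCoord σ q u‖ ≤ ‖u‖ := by
    by_contra! h
    have := norm_nonneg u
    nlinarith
  have h4 : frameCoord σ q u = a := by
    have h5 : inner ℝ a (frameCoord σ q u) = ‖u‖ ^ 2 := by
      rw [h1, hau, real_inner_self_eq_norm_sq]
    have h6 := norm_sub_sq_real a (frameCoord σ q u)
    rw [h5, han] at h6
    have h7 : ‖a - frameCoord σ q u‖ ^ 2 ≤ 0 := by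
      nlinarith [norm_nonneg (frameCoord σ q u), norm_nonneg u]
    have h8 : ‖a - frameCoord σ q u‖ = 0 := by
      have := sq_nonneg ‖a - frameCoord σ q u‖
      exact pow_eq_zero_iff (two_ne_zero) |>.1 (le_antisymm h7 this)
    exact (sub_eq_zero.1 (norm_eq_zero.1 h8)).symm
  rw [h4]
  exact ⟨hau, han⟩

theorem IsFreePresentation.continuous_frameCoord (hσ : IsFreePresentation I F σ) :
    Continuous (fun z : TotalSpace F U => frameCoord σ z.1 z.2) := by
  refine (PiLp.continuous_toLp 2 _).comp (continuous_pi fun i => ?_)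
  have h1 : ContMDiff (I.prod 𝓘(ℝ, F)) (I.prod 𝓘(ℝ, F)) ∞
      (fun z : TotalSpace F U => (⟨z.1, σ i z.1⟩ : TotalSpace F U)) :=
    (hσ.smooth i).comp (contMDiff_proj U)
  have h2 : ContMDiff (I.prod 𝓘(ℝ, F)) (I.prod 𝓘(ℝ, F)) ∞
      (fun z : TotalSpace F U => (⟨z.1, z.2⟩ : TotalSpace F U)) := contMDiff_id
  exact (ContMDiff.inner_bundle (b := fun z : TotalSpace F U => z.1)
    (v := fun z => σ i z.1) (w := fun z => z.2) h1 h2).continuous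

/-- A horizontal lift on `[0, s]`, read in the frame `σ`, is a bounded control. -/
theorem IsHorizontalLift.exists_control (hσ : IsFreePresentation I F σ) {s t : ℝ} (hst : s ≤ t)
    {γ : ℝ → M} {w : ∀ τ, U (γ τ)} (hw : IsHorizontalLift I F f s γ w) :
    ∃ b : ControlSpace k t, (∃ C, ∀ᵐ τ ∂(volume.restrict (Icc 0 t)), ‖b τ‖ ≤ C) ∧
      ∀ᵐ τ ∂(volume.restrict (Icc 0 t)), τ ∈ Icc 0 s →
        ‖b τ‖ = ‖w τ‖ ∧ ∑ i, b τ i • σ i (γ τ) = w τ := by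
  set b₀ : ℝ → EuclideanSpace ℝ (Fin k) :=
    indicator (Icc 0 s) fun τ => frameCoord σ (γ τ) (w τ) with hb₀
  obtain ⟨C, hC⟩ := hw.bounded
  have hbC : ∀ τ, ‖b₀ τ‖ ≤ max C 0 := by
    intro τ
    by_cases hτ : τ ∈ Icc 0 s
    · rw [hb₀, indicator_of_mem hτ, (hσ.sum_frameCoord _ _).2]
      exact (hC τ hτ).trans (le_max_left _ _)
    · rw [hb₀, indicator_of_notMem hτ, norm_zero]
      exact le_max_right _ _
  have hm : AEStronglyMeasurable b₀ (volume.restrict (Icc 0 t)) := by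
    refine AEMeasurable.aestronglyMeasurable ?_
    rw [hb₀, aemeasurable_indicator_iff measurableSet_Icc,
      Measure.restrict_restrict measurableSet_Icc,
      inter_eq_self_of_subset_left (Icc_subset_Icc le_rfl hst)]
    refine aemeasurable_restrict_of_measurable_subtype measurableSet_Icc ?_
    let _ : MeasurableSpace (TotalSpace F U) := borel _
    have : BorelSpace (TotalSpace F U) := ⟨rfl⟩
    exact hσ.continuous_frameCoord.measurable.comp hw.measurable
  have hmem : MemLp b₀ 2 (volume.restrict (Icc 0 t)) :=
    MemLp.of_bound hm (max C 0) (Eventually.of_forall hbC)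
  refine ⟨hmem.toLp b₀, ⟨max C 0, ?_⟩, ?_⟩
  · filter_upwards [hmem.coeFn_toLp] with τ hτ
    rw [hτ]; exact hbC τ
  · filter_upwards [hmem.coeFn_toLp] with τ hτ hτs
    have h1 := hσ.sum_frameCoord (γ τ) (w τ)
    rw [hτ, hb₀, indicator_of_mem hτs]
    exact ⟨h1.2, h1.1⟩

theorem IsLipschitzCurve.isAbsolutelyContinuousCurve {t : ℝ} {γ : ℝ → M}
    (h : IsLipschitzCurve I t γ) : IsAbsolutelyContinuousCurve I t γ := by
  refine ⟨h.1, fun τ₀ hτ => ?_⟩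
  obtain ⟨s, hs, K, hmap, hlip⟩ := h.2 τ₀ hτ
  obtain ⟨c, d, hcd, -, hN, hsub, -⟩ := exists_Icc_mem_nhdsWithin_Icc hτ hs
  refine ⟨c, d, hcd, hN, hmap.mono_left hsub, ?_⟩
  exact (hlip.mono (by rwa [uIcc_of_le hcd])).absolutelyContinuousOnInterval

theorem HasVelocityWithinAt.unique {a b c d τ : ℝ} {γ : ℝ → M} {ξ ξ' : TangentSpace I (γ τ)}
    (h : HasVelocityWithinAt I γ (Icc a b) τ ξ) (h' : HasVelocityWithinAt I γ (Icc c d) τ ξ')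
    (hτ : τ ∈ Ioo a b) (hτ' : τ ∈ Ioo c d) : ξ = ξ' := by
  have h1 := HasMFDerivWithinAt.hasMFDerivAt h (Icc_mem_nhds hτ.1 hτ.2)
  have h2 := HasMFDerivWithinAt.hasMFDerivAt h' (Icc_mem_nhds hτ'.1 hτ'.2)
  have h3 := DFunLike.congr_fun (hasMFDerivAt_unique h1 h2) (1 : ℝ)
  exact (one_smul ℝ ξ).symm.trans (h3.trans (one_smul ℝ ξ'))

/-- The kernel of `a ↦ ∑ aᵢ Xᵢ(q)`. -/
def fieldKernel (X : Fin k → ∀ q : M, TangentSpace I q) (q : M) :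
    Submodule ℝ (EuclideanSpace ℝ (Fin k)) where
  carrier := {a | fieldSum X q a = 0}
  zero_mem' := by simp [fieldSum]
  add_mem' := by
    intro a b (ha : fieldSum X q a = 0) (hb : fieldSum X q b = 0)
    change fieldSum X q (a + b) = 0
    have : fieldSum X q (a + b) = fieldSum X q a + fieldSum X q b := by
      simp [fieldSum, add_smul, Finset.sum_add_distrib]
    rw [this, ha, hb, add_zero]
  smul_mem' := by
    intro c a (ha : fieldSum X q a = 0)
    change fieldSum X q (c • a) = 0
    have : fieldSum X q (c • a) = c • fieldSum X q a := by
      simp [fieldSum, Finset.smul_sum, smul_smul]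
    rw [this, ha, smul_zero]

theorem sub_mem_fieldKernel {X : Fin k → ∀ q : M, TangentSpace I q} {q : M}
    {a b : EuclideanSpace ℝ (Fin k)} :
    a - b ∈ fieldKernel X q ↔ fieldSum X q a = fieldSum X q b := by
  have : fieldSum X q (a - b) = fieldSum X q a - fieldSum X q b := by
    simp [fieldSum, sub_smul, Finset.sum_sub_distrib]
  change fieldSum X q (a - b) = 0 ↔ _
  rw [this, sub_eq_zero]

/-- A shortest path parameterized by the length is generated by a control of norm one. -/
theorem IsShortestPath.exists_control (hf : IsSubriemannianStructure I F f)
    (hσ : IsFreePresentation I F σ) {q₀ : M} {t : ℝ} (ht : 0 < t) {γ : ℝ → M}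
    (hγ : IsShortestPath I F f q₀ t γ) :
    ∃ u : ControlSpace k t, (∀ᵐ s ∂(volume.restrict (Icc 0 t)), ‖u s‖ = 1) ∧
      IsSol (fun i q => f q (σ i q)) u 0 t γ := by
  have hX := hf.isSmoothVectorField hσ
  set X : Fin k → ∀ q : M, TangentSpace I q := fun i q => f q (σ i q) with hXdef
  obtain ⟨hlip, w, hw⟩ := hγ.horizontal
  obtain ⟨b₀, ⟨C, hC⟩, hb₀⟩ := hw.exists_control hσ le_rfl
  obtain ⟨a, hab₀, hmin⟩ := exists_minimal_representative (fun τ => fieldKernel X (γ τ)) b₀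
  have hI : ∀ᵐ τ ∂(volume.restrict (Icc 0 t)), τ ∈ Icc 0 t := ae_restrict_mem measurableSet_Icc
  have hvel : ∀ᵐ τ ∂(volume.restrict (Icc 0 t)),
      HasVelocityWithinAt I γ (Icc 0 t) τ (fieldSum X (γ τ) (a τ)) := by
    filter_upwards [hI, hw.velocity, hb₀, hab₀] with τ h1 h2 h3 h4
    rw [← sub_mem_fieldKernel.1 h4, hXdef, fieldSum_comp, (h3 h1).2]
    exact h2
  have hsol : IsSol X a 0 t γ :=
    IsTrajectory.isSol hX ⟨hlip.isAbsolutelyContinuousCurve, hγ.start, hvel⟩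
  have haC : ∀ᵐ τ ∂(volume.restrict (Icc 0 t)), ‖a τ‖ ≤ C := by
    have h1 := hmin b₀ univ MeasurableSet.univ (hab₀.mono fun τ h _ => h)
    filter_upwards [h1, hC] with τ h1 h2
    exact (h1 (mem_univ τ)).trans h2
  have h0t : (0 : ℝ) ∈ Icc 0 t := left_mem_Icc.2 ht.le
  have hne0 : ∀ x : ℝ, ∀ᵐ τ ∂(volume.restrict (Icc 0 t)), τ ≠ x := fun x =>
    ae_restrict_of_ae (by simp [ae_iff, measure_singleton])
  have hlen : ∀ s ∈ Icc 0 t, ∫ τ in (0:ℝ)..s, ‖a τ‖ = s := by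
    intro s hs
    have hai := ControlSpace.intervalIntegrable a h0t hs
    have hconv : ∫⁻ τ in Icc 0 s, ‖a τ‖ₑ = ENNReal.ofReal (∫ τ in (0:ℝ)..s, ‖a τ‖) := by
      rw [intervalIntegral.integral_of_le hs.1, ← integral_Icc_eq_integral_Ioc,
        ofReal_integral_norm_eq_lintegral_enorm
          ((ControlSpace.integrableOn a).mono_set (Icc_subset_Icc le_rfl hs.2))]
    have hint0 : 0 ≤ ∫ τ in (0:ℝ)..s, ‖a τ‖ :=
      intervalIntegral.integral_nonneg hs.1 fun _ _ => norm_nonneg _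
    have hsubm : volume.restrict (Icc 0 s) ≤ volume.restrict (Icc (0:ℝ) t) :=
      Measure.restrict_mono_set _ (Icc_subset_Icc le_rfl hs.2)
    refine le_antisymm ?_ ?_
    · rw [← ENNReal.ofReal_le_ofReal_iff hs.1, ← hγ.arclength s hs, ← hconv]
      refine le_iInf₂ fun w' hw' => ?_
      obtain ⟨b, -, hb⟩ := hw'.exists_control hσ hs.2
      have hvel' := (ae_restrict_iff' measurableSet_Icc).1 hw'.velocity
      have h1 := hmin b (Icc 0 s) measurableSet_Icc (by
        filter_upwards [hvel, ae_restrict_of_ae hvel', hb, hne0 0, hne0 s] with τ h1 h2 h3 h4 h5 h6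
        have hτ : τ ∈ Ioo 0 s := ⟨lt_of_le_of_ne h6.1 (Ne.symm h4), lt_of_le_of_ne h6.2 h5⟩
        rw [sub_mem_fieldKernel, hXdef, fieldSum_comp, (h3 h6).2]
        exact (h2 h6).unique h1 hτ ⟨hτ.1, hτ.2.trans_le hs.2⟩)
      refine lintegral_mono_ae ?_
      filter_upwards [ae_restrict_mem measurableSet_Icc, h1.filter_mono (ae_mono hsubm),
        hb.filter_mono (ae_mono hsubm)] with τ h2 h3 h4
      rw [enorm_le_iff_norm_le, ← (h4 h2).1]
      exact h3 h2
    · rw [← ENNReal.ofReal_le_ofReal_iff hint0, ← hγ.arclength s hs, ← hconv]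
      obtain ⟨w', hw', hle⟩ := (hsol.restrict hX (ControlSpace.intervalIntegrable a h0t
        (right_mem_Icc.2 ht.le)) h0t hs).exists_isHorizontalLift hf hσ hai
        (Lp.stronglyMeasurable a).measurable (haC.filter_mono (ae_mono hsubm))
      exact (iInf₂_le w' hw').trans hle
  refine ⟨a, ?_, hsol⟩
  rw [ae_restrict_iff' measurableSet_Icc]
  have hd := ae_hasDerivAt_of_eq_integral (x := fun s => s) (a := 0) (b := t)
    (ControlSpace.intervalIntegrable a h0t (right_mem_Icc.2 ht.le)).norm
    (fun s hs => by rw [hlen s hs, zero_add])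
  have hne : ∀ x : ℝ, ∀ᵐ τ : ℝ, τ ≠ x := fun x => by simp [ae_iff, measure_singleton]
  filter_upwards [hd, hne 0, hne t] with τ h1 h2 h3 h4
  exact (h1 ⟨lt_of_le_of_ne h4.1 (Ne.symm h2), lt_of_le_of_ne h4.2 h3⟩).unique (hasDerivAt_id τ)

end ShortestPath

/-! ### Controls supported in an interval -/

section Cutoff

variable {k : ℕ} {t a b : ℝ}

/-- The control equal to `v` on `(a, b]` and to `0` elsewhere. -/
def ControlSpace.cutoff (v : ControlSpace k t) (a b : ℝ) : ControlSpace k t :=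
  ((Lp.memLp v).indicator (measurableSet_Ioc (a := a) (b := b))).toLp _

theorem ControlSpace.coeFn_cutoff (v : ControlSpace k t) (a b : ℝ) :
    ∀ᵐ s, s ∈ Icc 0 t → v.cutoff a b s = indicator (Ioc a b) v s :=
  (ae_restrict_iff' measurableSet_Icc).1
    ((Lp.memLp v).indicator (measurableSet_Ioc (a := a) (b := b))).coeFn_toLp

theorem ControlSpace.inner_cutoff (u v : ControlSpace k t) (ha : 0 ≤ a) (hab : a ≤ b)
    (hb : b ≤ t) : inner ℝ u (v.cutoff a b) = ∫ s in a..b, inner ℝ (u s) (v s) := by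
  have hsub : Ioc a b ⊆ Icc 0 t := fun s hs => ⟨ha.trans hs.1.le, hs.2.trans hb⟩
  have h1 : ∀ᵐ s ∂(volume.restrict (Icc 0 t)), inner ℝ (u s) (v.cutoff a b s) =
      indicator (Ioc a b) (fun s => (inner ℝ (u s) (v s) : ℝ)) s := by
    rw [ae_restrict_iff' measurableSet_Icc]
    filter_upwards [v.coeFn_cutoff a b] with s hs hs'
    rw [hs hs']
    by_cases h : s ∈ Ioc a b
    · rw [indicator_of_mem h, indicator_of_mem h]
    · rw [indicator_of_notMem h, indicator_of_notMem h, inner_zero_right]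
  rw [L2.inner_def, integral_congr_ae h1, integral_indicator measurableSet_Ioc,
    Measure.restrict_restrict measurableSet_Ioc, inter_eq_self_of_subset_left hsub,
    intervalIntegral.integral_of_le hab]

theorem ControlSpace.cutoff_eq_on (v : ControlSpace k t) (ha : 0 ≤ a) (hb : b ≤ t) :
    ∀ᵐ s, s ∈ Ioc a b → v.cutoff a b s = v s := by
  filter_upwards [v.coeFn_cutoff a b] with s hs hs'
  rw [hs ⟨ha.trans hs'.1.le, hs'.2.trans hb⟩, indicator_of_mem hs']

theorem ControlSpace.cutoff_eq_zero (v : ControlSpace k t) (a b : ℝ) :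
    ∀ᵐ s, s ∈ Icc 0 t → s ∉ Ioc a b → v.cutoff a b s = 0 := by
  filter_upwards [v.coeFn_cutoff a b] with s hs hs' hs''
  rw [hs hs', indicator_of_notMem hs'']

theorem ControlSpace.norm_sq_cutoff (v : ControlSpace k t) (ha : 0 ≤ a) (hab : a ≤ b)
    (hb : b ≤ t) : ‖v.cutoff a b‖ ^ 2 = inner ℝ v (v.cutoff a b) := by
  rw [← real_inner_self_eq_norm_sq, inner_cutoff _ _ ha hab hb, inner_cutoff _ _ ha hab hb]
  refine intervalIntegral.integral_congr_ae ?_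
  rw [uIoc_of_le hab]
  filter_upwards [v.cutoff_eq_on ha hb] with s hs hs'
  rw [hs hs']

end Cutoff

/-! ### The tangent functional at the end of a trajectory -/

section EndpointDerivative

variable {E : Type*} [NormedAddCommGroup E] [NormedSpace ℝ E] [FiniteDimensional ℝ E]
  {H : Type*} [TopologicalSpace H] {I : ModelWithCorners ℝ E H} [I.Boundaryless]
  {M : Type*} [TopologicalSpace M] [ChartedSpace H M] [IsManifold I ∞ M] [T2Space M]
  {k : ℕ} {X : Fin k → ∀ q : M, TangentSpace I q} {t C : ℝ} {q₀ q₁ : M} {γ γ' : ℝ → M}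

theorem fderiv_tailMap_self (t : ℝ) (u : ℝ → EuclideanSpace ℝ (Fin k)) (hX : ∀ i, IsSmoothVectorField I (X i)) (q₁ : M) :
    fderiv ℝ (tailMap X t t u q₁ q₁) (extChartAt I q₁ q₁) = ContinuousLinearMap.id ℝ E := by
  have h1 : tailMap X t t u q₁ q₁ =ᶠ[𝓝 (extChartAt I q₁ q₁)] id := by
    filter_upwards [extChartAt_target_mem_nhds (I := I) q₁] with z hz
    have hu : IntervalIntegrable u volume t t := IntervalIntegrable.refl
    rw [tailMap, flowMap_eq hX hu le_rfl (isSol_const t u ((extChartAt I q₁).symm z)) rfl,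
      (extChartAt I q₁).right_inv hz, id]
  rw [h1.fderiv_eq, fderiv_id]

/-- To first order, a variation of the control near the final time moves the endpoint by the
integral of the fields at the endpoint. -/
theorem IsSol.eventually_norm_fderiv_cutoff_sub_le (hX : ∀ i, IsSmoothVectorField I (X i))
    (ht : 0 < t) {u : ControlSpace k t} (hγ : IsSol X u 0 t γ) (h0 : γ 0 = q₀) (h1 : γ t = q₁)
    (hu : ∀ᵐ s, s ∈ Icc 0 t → ‖u s‖ ≤ 1) (f : SmoothBumpFunction I q₁)
    (hC : IsC2Bound (chartField X f) C) :
    ∀ᶠ h in 𝓝[>] (0 : ℝ), h ≤ t ∧ ∀ v : ControlSpace k t,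
      ‖fderiv ℝ (endpointChart X q₀ t q₁) u (v.cutoff (t - h) t) -
        chartField X f (extChartAt I q₁ q₁) (∫ s in (t - h)..t, v s)‖ ≤
      3 * C ^ 2 * h * ∫ s in (t - h)..t, ‖v s‖ := by
  have htI : t ∈ Icc 0 t := right_mem_Icc.2 ht.le
  have hN : ∀ᶠ s in 𝓝[Icc 0 t] t, γ s ∈ bumpNhd f :=
    hγ.continuousOn t htI ((isOpen_bumpNhd f).mem_nhds (by rw [h1]; exact mem_bumpNhd f))
  obtain ⟨ε, hε, hball⟩ := Metric.mem_nhdsWithin_iff.1 hN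
  have e1 : ∀ᶠ h in 𝓝[>] (0 : ℝ), h < t := nhdsWithin_le_nhds (gt_mem_nhds ht)
  have e2 : ∀ᶠ h in 𝓝[>] (0 : ℝ), h < ε := nhdsWithin_le_nhds (gt_mem_nhds hε)
  have e3 : ∀ᶠ h in 𝓝[>] (0 : ℝ), C * h < 1 / 2 := by
    have hc : ContinuousAt (fun h : ℝ => C * h) 0 := by fun_prop
    exact nhdsWithin_le_nhds (hc.eventually_lt_const (by norm_num))
  filter_upwards [e1, e2, e3, self_mem_nhdsWithin] with h h1t h2 h3 h4
  have h4 : 0 < h := h4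
  refine ⟨h1t.le, fun v => ?_⟩
  have ha : 0 ≤ t - h := by linarith
  have hab : t - h ≤ t := by linarith
  have hmem : ∀ s ∈ Icc (t - h) t, γ s ∈ bumpNhd f := fun s hs => hball ⟨by
    rw [Metric.mem_ball, Real.dist_eq, abs_lt]; constructor <;> linarith [hs.1, hs.2],
    ha.trans hs.1, hs.2⟩
  have hi : ∀ w : ControlSpace k t, IntervalIntegrable w volume (t - h) t := fun w =>
    w.intervalIntegrable ⟨ha, hab⟩ htI
  have hu1 : ∀ᵐ s, s ∈ Ioc (t - h) t → ‖u s‖ ≤ 1 := by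
    filter_upwards [hu] with s hs hs'
    exact hs ⟨ha.trans hs'.1.le, hs'.2⟩
  have hint : ∫ s in (t - h)..t, ‖u s‖ ≤ h := by
    calc ∫ s in (t - h)..t, ‖u s‖ ≤ ∫ s in (t - h)..t, (1 : ℝ) := by
          refine intervalIntegral.integral_mono_ae_restrict hab (hi u).norm
            intervalIntegrable_const ?_
          have hne : ∀ᵐ s : ℝ, s ≠ t - h := by simp [ae_iff, measure_singleton]
          rw [EventuallyLE, ae_restrict_iff' measurableSet_Icc]
          filter_upwards [hu1, hne] with s hs hs1 hs2
          exact hs ⟨lt_of_le_of_ne hs2.1 (Ne.symm hs1), hs2.2⟩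
      _ = h := by simp
  have hsmall : (∫ s in (t - h)..t, ‖u s‖) * C < 1 := by
    nlinarith [hC.nonneg]
  obtain ⟨y, hy, hyd⟩ := exists_isVariation_fderiv_endpointChart hX ha hab le_rfl hγ h0 h1 f hC hmem
    hsmall (v.cutoff (t - h) t) (v.cutoff_eq_zero _ _)
  have hx := (hγ.restrict hX (u.intervalIntegrable (left_mem_Icc.2 ht.le) htI) ⟨ha, hab⟩
    htI).isIntegralSolution_chart hX (hi u) f hmem
  have key := hy.norm_endpoint_sub_le hC hx hab (hi u) (hi _) hu1 (by
    rw [sub_sub_cancel]; exact h3.le)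
  rw [h1, fderiv_tailMap_self t u hX q₁, ContinuousLinearMap.id_apply] at hyd
  have hc1 : ∫ s in (t - h)..t, v.cutoff (t - h) t s = ∫ s in (t - h)..t, v s := by
    refine intervalIntegral.integral_congr_ae ?_
    rw [uIoc_of_le hab]
    exact v.cutoff_eq_on ha le_rfl
  have hc2 : ∫ s in (t - h)..t, ‖v.cutoff (t - h) t s‖ = ∫ s in (t - h)..t, ‖v s‖ := by
    refine intervalIntegral.integral_congr_ae ?_
    rw [uIoc_of_le hab]
    filter_upwards [v.cutoff_eq_on (a := t - h) ha le_rfl] with s hs hs'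
    rw [hs hs']
  rw [hc1, hc2, sub_sub_cancel, Function.comp, h1] at key
  rw [hyd]
  exact key

/-- The multiplier of the control is determined by the tangent functional and the fields at the
endpoint. -/
theorem IsSol.multiplier_eq_norm (hX : ∀ i, IsSmoothVectorField I (X i))
    (ht : 0 < t) {u : ControlSpace k t} (hγ : IsSol X u 0 t γ) (h0 : γ 0 = q₀) (h1 : γ t = q₁)
    (hu : ∀ᵐ s, s ∈ Icc 0 t → ‖u s‖ = 1) (f : SmoothBumpFunction I q₁) {α : E →L[ℝ] ℝ} {c : ℝ}
    (hc : 0 ≤ c) (hα : ∀ v, α (fderiv ℝ (endpointChart X q₀ t q₁) u v) = c * inner ℝ u v) :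
    c = ‖(InnerProductSpace.toDual ℝ (EuclideanSpace ℝ (Fin k))).symm
      (α.comp (chartField X f (extChartAt I q₁ q₁)))‖ := by
  obtain ⟨C, hC⟩ := exists_isC2Bound (contDiff_chartField hX f) (hasCompactSupport_chartField f)
  set B := (InnerProductSpace.toDual ℝ (EuclideanSpace ℝ (Fin k))).symm
      (α.comp (chartField X f (extChartAt I q₁ q₁))) with hB
  have hBe : ∀ e, inner ℝ B e = α (chartField X f (extChartAt I q₁ q₁) e) := fun e => by
    rw [hB, InnerProductSpace.toDual_symm_apply]; rfl
  set K := 3 * C ^ 2 * ‖α‖ with hK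
  have hK0 : 0 ≤ K := by positivity
  have htI : t ∈ Icc 0 t := right_mem_Icc.2 ht.le
  have key : ∀ᶠ h in 𝓝[>] (0 : ℝ), |c ^ 2 - ‖B‖ ^ 2| ≤ (c + ‖B‖) * K * h := by
    filter_upwards [hγ.eventually_norm_fderiv_cutoff_sub_le hX ht h0 h1
      (hu.mono fun s hs hs' => (hs hs').le) f hC, self_mem_nhdsWithin] with h hh hpos
    have hpos : 0 < h := hpos
    obtain ⟨hht, hh⟩ := hh
    have ha : 0 ≤ t - h := by linarith
    have hab : t - h ≤ t := by linarith
    have hui : IntervalIntegrable u volume (t - h) t := u.intervalIntegrable ⟨ha, hab⟩ htI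
    have est : ∀ v : ControlSpace k t,
        |c * (∫ s in (t - h)..t, inner ℝ (u s) (v s)) - inner ℝ B (∫ s in (t - h)..t, v s)| ≤
          K * h * ∫ s in (t - h)..t, ‖v s‖ := by
      intro v
      rw [← u.inner_cutoff v ha hab le_rfl, ← hα, hBe, ← map_sub, ← Real.norm_eq_abs]
      refine (α.le_opNorm _).trans ?_
      refine (mul_le_mul_of_nonneg_left (hh v) (norm_nonneg α)).trans (le_of_eq ?_)
      rw [hK]; ring
    set m := ∫ s in (t - h)..t, u s with hm
    have hu' : ∀ᵐ s, s ∈ uIoc (t - h) t → ‖u s‖ = 1 := by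
      rw [uIoc_of_le hab]
      filter_upwards [hu] with s hs hs'
      exact hs ⟨ha.trans hs'.1.le, hs'.2⟩
    have est1 : |c * h - inner ℝ B m| ≤ K * h * h := by
      have e1 : ∫ s in (t - h)..t, inner ℝ (u s) (u s) = h := by
        rw [intervalIntegral.integral_congr_ae (g := fun _ => (1 : ℝ))
          (hu'.mono fun s hs hs' => by rw [real_inner_self_eq_norm_sq, hs hs', one_pow])]
        simp
      have e2 : ∫ s in (t - h)..t, ‖u s‖ = h := by
        rw [intervalIntegral.integral_congr_ae (g := fun _ => (1 : ℝ)) hu']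
        simp
      have := est u
      rwa [e1, e2] at this
    have est2 : ∀ e, |c * inner ℝ m e - h * inner ℝ B e| ≤ K * h * (h * ‖e‖) := by
      intro e
      have hmem : MemLp (fun _ : ℝ => e) 2 (volume.restrict (Icc 0 t)) := memLp_const e
      have hce : ∀ᵐ s, s ∈ uIoc (t - h) t → hmem.toLp _ s = e := by
        rw [uIoc_of_le hab]
        filter_upwards [(ae_restrict_iff' measurableSet_Icc).1 hmem.coeFn_toLp] with s hs hs'
        exact hs ⟨ha.trans hs'.1.le, hs'.2⟩
      have e1 : ∫ s in (t - h)..t, inner ℝ (u s) (hmem.toLp _ s) = inner ℝ m e := by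
        rw [intervalIntegral.integral_congr_ae (g := fun s => inner ℝ (u s) e)
          (hce.mono fun s hs hs' => by rw [hs hs'])]
        simp only [real_inner_comm e]
        exact (innerSL ℝ e).intervalIntegral_comp_comm hui
      have e2 : ∫ s in (t - h)..t, hmem.toLp _ s = h • e := by
        rw [intervalIntegral.integral_congr_ae hce]
        simp
      have e3 : ∫ s in (t - h)..t, ‖hmem.toLp _ s‖ = h * ‖e‖ := by
        rw [intervalIntegral.integral_congr_ae (g := fun _ => ‖e‖)
          (hce.mono fun s hs hs' => by rw [hs hs'])]
        simp
      have := est (hmem.toLp _)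
      rwa [e1, e2, e3, inner_smul_right] at this
    have est3 : ‖c • m - h • B‖ ≤ K * h * h := by
      have e1 := est2 (c • m - h • B)
      have e2 : c * inner ℝ m (c • m - h • B) - h * inner ℝ B (c • m - h • B) =
          ‖c • m - h • B‖ ^ 2 := by
        rw [← real_inner_self_eq_norm_sq, inner_sub_left (c • m), real_inner_smul_left,
          real_inner_smul_left]
      rw [e2, abs_of_nonneg (sq_nonneg _)] at e1
      by_contra! hlt
      have : 0 ≤ K * h * h := by positivity
      nlinarith
    have est4 : |inner ℝ B (c • m - h • B)| ≤ ‖B‖ * (K * h * h) :=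
      (abs_real_inner_le_norm _ _).trans (mul_le_mul_of_nonneg_left est3 (norm_nonneg _))
    have e5 : (c ^ 2 - ‖B‖ ^ 2) * h = c * (c * h - inner ℝ B m) + inner ℝ B (c • m - h • B) := by
      rw [inner_sub_right, inner_smul_right, inner_smul_right, real_inner_self_eq_norm_sq]
      ring
    have e6 : |c ^ 2 - ‖B‖ ^ 2| * h ≤ (c + ‖B‖) * K * h * h := by
      rw [← abs_of_pos hpos, ← abs_mul, abs_of_pos hpos, e5]
      refine (abs_add_le _ _).trans ?_
      rw [abs_mul, abs_of_nonneg hc]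
      nlinarith
    exact le_of_mul_le_mul_right e6 hpos
  have hlim : Tendsto (fun h : ℝ => (c + ‖B‖) * K * h) (𝓝[>] 0) (𝓝 ((c + ‖B‖) * K * 0)) :=
    ((continuous_const.mul continuous_id).tendsto 0).mono_left nhdsWithin_le_nhds
  rw [mul_zero] at hlim
  have h2 : |c ^ 2 - ‖B‖ ^ 2| ≤ 0 := ge_of_tendsto hlim key
  have h3 := sub_eq_zero.1 (abs_nonpos_iff.1 h2)
  exact (sq_eq_sq₀ hc (norm_nonneg _)).1 h3

/-- A functional that vanishes on the fields at the endpoint vanishes on the final velocity. -/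
theorem IsSol.apply_velocity_eq_zero (hX : ∀ i, IsSmoothVectorField I (X i))
    (ht : 0 < t) {u : ControlSpace k t} (hγ : IsSol X u 0 t γ)
    (hu : ∀ᵐ s, s ∈ Icc 0 t → ‖u s‖ ≤ 1) (f : SmoothBumpFunction I (γ t)) {α : E →L[ℝ] ℝ}
    (hα : α.comp (chartField X f (extChartAt I (γ t) (γ t))) = 0) {ξ : TangentSpace I (γ t)}
    (hξ : HasVelocityWithinAt I γ (Icc 0 t) t ξ) : α (ξ : E) = 0 := by
  obtain ⟨C, hC⟩ := exists_isC2Bound (contDiff_chartField hX f) (hasCompactSupport_chartField f)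
  have htI : t ∈ Icc 0 t := right_mem_Icc.2 ht.le
  have hui := u.intervalIntegrable (left_mem_Icc.2 ht.le) htI
  obtain ⟨c, d, hcd, htcd, hN, hsub, hmem, hud, hx⟩ := hγ.exists_chart hX hui htI f
  obtain rfl : d = t := le_antisymm (hsub (right_mem_Icc.2 hcd)).2 htcd.2
  set x : ℝ → E := extChartAt I (γ d) ∘ γ with hxdef
  have hXc := (contDiff_chartField hX f).continuous
  have hxt : ∀ s ∈ Icc c d, ‖x s - x d‖ ≤ C * (d - s) := by
    intro s hs
    rw [norm_sub_rev, hx.sub_eq hXc hud hs htcd]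
    refine (intervalIntegral.norm_integral_le_of_norm_le_const_ae (C := C) ?_).trans
      (by rw [abs_of_nonneg (by linarith [hs.2])])
    filter_upwards [hu] with r hr hr'
    rw [uIoc_of_le hs.2] at hr'
    have := (chartField X f (x r)).le_of_opNorm_le_of_le (hC.norm_le _)
      (hr (hsub ⟨hs.1.trans hr'.1.le, hr'.2⟩))
    rwa [mul_one] at this
  have hbound : ∀ s ∈ Icc c d, ‖α (x s) - α (x d)‖ ≤ ‖α‖ * C ^ 2 * ‖s - d‖ ^ 2 := by
    intro s hs
    have hsd : 0 ≤ d - s := by linarith [hs.2]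
    have hint := intervalIntegrable_field hXc hx.1 hud hs htcd
    rw [norm_sub_rev, ← map_sub, hx.sub_eq hXc hud hs htcd, ← α.intervalIntegral_comp_comm hint]
    refine (intervalIntegral.norm_integral_le_of_norm_le_const_ae
      (C := ‖α‖ * C ^ 2 * (d - s)) ?_).trans (le_of_eq ?_)
    · filter_upwards [hu] with r hr hr'
      rw [uIoc_of_le hs.2] at hr'
      have hrI : r ∈ Icc c d := ⟨hs.1.trans hr'.1.le, hr'.2⟩
      have h1 : α (chartField X f (x r) (u r)) =
          α ((chartField X f (x r) - chartField X f (x d)) (u r)) := by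
        have h2 : α (chartField X f (x d) (u r)) = 0 := DFunLike.congr_fun hα (u r)
        rw [sub_apply, map_sub, h2, sub_zero]
      rw [h1]
      have h3 : ‖chartField X f (x r) - chartField X f (x d)‖ ≤ C * (C * (d - s)) :=
        (hC.norm_sub_le _ _).trans (mul_le_mul_of_nonneg_left
          ((hxt r hrI).trans (mul_le_mul_of_nonneg_left (by linarith [hr'.1]) hC.nonneg)) hC.nonneg)
      have h4 := (chartField X f (x r) - chartField X f (x d)).le_of_opNorm_le_of_le h3
        (hr (hsub hrI))
      refine (α.le_opNorm _).trans ((mul_le_mul_of_nonneg_left h4 (norm_nonneg α)).trans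
        (le_of_eq ?_))
      ring
    · rw [abs_of_nonneg hsd, Real.norm_eq_abs, abs_sub_comm, abs_of_nonneg hsd]
      ring
  have hd1 : HasDerivWithinAt x (ξ : E) (Icc 0 d) d := by
    refine hξ.hasDerivWithinAt_comp (mdifferentiableAt_extChartAt (mem_chart_source H (γ d))) ?_
    rw [mfderiv_extChartAt_self]
    rfl
  have hd2 : HasDerivWithinAt (fun s => α (x s) - α (x d)) (α (ξ : E)) (Icc 0 d) d :=
    (α.hasFDerivAt.comp_hasDerivWithinAt d hd1).sub_const _
  have hO : (fun s => α (x s) - α (x d)) =O[𝓝[Icc 0 d] d] fun s => ‖s - d‖ ^ 2 := by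
    refine Asymptotics.IsBigO.of_bound (‖α‖ * C ^ 2) ?_
    filter_upwards [hN] with s hs
    rw [norm_pow, norm_norm]
    exact hbound s hs
  have hd3 : HasDerivWithinAt (fun s => α (x s) - α (x d)) 0 (Icc 0 d) d := by
    have := (hO.hasFDerivWithinAt htI (by norm_num)).hasDerivWithinAt
    simpa using this
  exact (uniqueDiffOn_Icc ht d htI).eq_deriv _ hd2 hd3

/-- Two trajectories with the same endpoint, the same tangent functional and the same positive
multiplier, that agree on `[T, t]`, agree on a larger interval. -/
theorem IsSol.exists_lt_eqOn (hX : ∀ i, IsSmoothVectorField I (X i)) {u u' : ControlSpace k t}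
    (hγ : IsSol X u 0 t γ) (h0 : γ 0 = q₀) (h1 : γ t = q₁)
    (hγ' : IsSol X u' 0 t γ') (h0' : γ' 0 = q₀) (h1' : γ' t = q₁)
    (hu : ∀ᵐ s, s ∈ Icc 0 t → ‖u s‖ ≤ 1) (hu' : ∀ᵐ s, s ∈ Icc 0 t → ‖u' s‖ ≤ 1)
    {α : E →L[ℝ] ℝ} {c : ℝ} (hc : 0 < c)
    (hα : ∀ v, α (fderiv ℝ (endpointChart X q₀ t q₁) u v) = c * inner ℝ u v)
    (hα' : ∀ v, α (fderiv ℝ (endpointChart X q₀ t q₁) u' v) = c * inner ℝ u' v)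
    {T : ℝ} (hT0 : 0 < T) (hTt : T ≤ t) (hT : γ T = γ' T)
    (huu : ∀ᵐ s, s ∈ Ioc T t → u s = u' s) :
    ∃ a, 0 ≤ a ∧ a < T ∧ EqOn γ γ' (Icc a T) ∧ ∀ᵐ s, s ∈ Ioc a T → u s = u' s := by
  have htI : t ∈ Icc 0 t := right_mem_Icc.2 (hT0.le.trans hTt)
  have h0I : (0 : ℝ) ∈ Icc 0 t := left_mem_Icc.2 (hT0.le.trans hTt)
  have hTI : T ∈ Icc 0 t := ⟨hT0.le, hTt⟩
  obtain ⟨f⟩ : Nonempty (SmoothBumpFunction I (γ T)) := inferInstance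
  obtain ⟨C, hC⟩ := exists_isC2Bound (contDiff_chartField hX f) (hasCompactSupport_chartField f)
  have hC0 := hC.nonneg
  set ζ : E →L[ℝ] ℝ := α.comp (fderiv ℝ (tailMap X T t u (γ T) q₁) (extChartAt I (γ T) (γ T)))
    with hζ
  have hN : ∀ᶠ s in 𝓝[Icc 0 t] T, γ s ∈ bumpNhd f ∧ γ' s ∈ bumpNhd f :=
    inter_mem (hγ.continuousOn T hTI ((isOpen_bumpNhd f).mem_nhds (mem_bumpNhd f)))
      (hγ'.continuousOn T hTI ((isOpen_bumpNhd f).mem_nhds (by rw [← hT]; exact mem_bumpNhd f)))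
  obtain ⟨ε, hε, hball⟩ := Metric.mem_nhdsWithin_iff.1 hN
  -- the length of the interval
  obtain ⟨h, hpos, hhT, hhε, hhC, hhc⟩ : ∃ h : ℝ, 0 < h ∧ h ≤ T ∧ h < ε ∧ C * h ≤ 1 / 2 ∧
      ‖ζ‖ * (2 * (6 * C ^ 2)) * h < c := by
    have e1 : ∀ᶠ h in 𝓝[>] (0 : ℝ), h < T := nhdsWithin_le_nhds (gt_mem_nhds hT0)
    have e2 : ∀ᶠ h in 𝓝[>] (0 : ℝ), h < ε := nhdsWithin_le_nhds (gt_mem_nhds hε)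
    have e3 : ∀ᶠ h in 𝓝[>] (0 : ℝ), C * h < 1 / 2 := by
      have hc : ContinuousAt (fun h : ℝ => C * h) 0 := by fun_prop
      exact nhdsWithin_le_nhds (hc.eventually_lt_const (by norm_num))
    have e4 : ∀ᶠ h in 𝓝[>] (0 : ℝ), ‖ζ‖ * (2 * (6 * C ^ 2)) * h < c := by
      have hcont : ContinuousAt (fun h : ℝ => ‖ζ‖ * (2 * (6 * C ^ 2)) * h) 0 := by fun_prop
      exact nhdsWithin_le_nhds (hcont.eventually_lt_const (by simpa using hc))
    obtain ⟨h, e5⟩ := (e1.and (e2.and (e3.and (e4.and self_mem_nhdsWithin)))).exists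
    exact ⟨h, e5.2.2.2.2, e5.1.le, e5.2.1, e5.2.2.1.le, e5.2.2.2.1⟩
  set a := T - h with hadef
  have ha : 0 ≤ a := by linarith
  have haT : a ≤ T := by linarith
  have hTa : T - a = h := by linarith
  have hmem : ∀ s ∈ Icc a T, γ s ∈ bumpNhd f ∧ γ' s ∈ bumpNhd f := fun s hs => hball ⟨by
    rw [Metric.mem_ball, Real.dist_eq, abs_lt]; constructor <;> linarith [hs.1, hs.2],
    ha.trans hs.1, hs.2.trans hTt⟩
  have haI : a ∈ Icc 0 t := ⟨ha, haT.trans hTt⟩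
  have hi : ∀ w : ControlSpace k t, IntervalIntegrable w volume a T := fun w =>
    w.intervalIntegrable haI hTI
  have hle : ∀ v : ControlSpace k t, (∀ᵐ s, s ∈ Icc 0 t → ‖v s‖ ≤ 1) →
      (∀ᵐ s, s ∈ Ioc a T → ‖v s‖ ≤ 1) ∧ (∫ s in a..T, ‖v s‖) * C < 1 := by
    intro v hv
    have hv1 : ∀ᵐ s, s ∈ Ioc a T → ‖v s‖ ≤ 1 := by
      filter_upwards [hv] with s hs hs'
      exact hs ⟨ha.trans hs'.1.le, hs'.2.trans hTt⟩
    refine ⟨hv1, ?_⟩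
    have h2 : ‖∫ s in a..T, ‖v s‖‖ ≤ 1 * |T - a| := by
      refine intervalIntegral.norm_integral_le_of_norm_le_const_ae ?_
      rw [uIoc_of_le haT]
      filter_upwards [hv1] with s hs hs'
      rw [norm_norm]
      exact hs hs'
    rw [one_mul, hTa, abs_of_pos hpos] at h2
    have h3 := (le_abs_self _).trans h2
    nlinarith
  obtain ⟨hu1, hus⟩ := hle u hu
  obtain ⟨hu1', hus'⟩ := hle u' hu'
  set w : ControlSpace k t := (u - u').cutoff a T with hw
  obtain ⟨y, hy, hyd⟩ := exists_isVariation_fderiv_endpointChart hX ha haT hTt hγ h0 h1 f hC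
    (fun s hs => (hmem s hs).1) hus w (ControlSpace.cutoff_eq_zero _ _ _)
  obtain ⟨y', hy', hyd'⟩ := exists_isVariation_fderiv_endpointChart hX ha haT hTt hγ' h0' h1' f hC
    (fun s hs => (hmem s hs).2) hus' w (ControlSpace.cutoff_eq_zero _ _ _)
  have htail : tailMap X T t u' (γ T) q₁ = tailMap X T t u (γ T) q₁ := by
    unfold tailMap
    rw [flowMap_congr huu]
  rw [htail, ← hT] at hyd'
  have hwe : ∀ᵐ s, s ∈ Ioc a T → w s = u s - u' s := by
    filter_upwards [(u - u').cutoff_eq_on ha hTt,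
      (ae_restrict_iff' measurableSet_Icc).1 (Lp.coeFn_sub u u')] with s h1 h2 h3
    rw [hw, h1 h3, h2 ⟨ha.trans h3.1.le, h3.2.trans hTt⟩, Pi.sub_apply]
  have hx := (hγ.restrict hX (u.intervalIntegrable h0I htI) haI hTI).isIntegralSolution_chart hX
    (hi u) f fun s hs => (hmem s hs).1
  have hx' := (hγ'.restrict hX (u'.intervalIntegrable h0I htI) haI hTI).isIntegralSolution_chart hX
    (hi u') f fun s hs => (hmem s hs).2
  have hxT : (extChartAt I (γ T) ∘ γ) T = (extChartAt I (γ T) ∘ γ') T := by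
    simp only [Function.comp, ← hT]
  have hCT : C * (T - a) ≤ 1 / 2 := by rwa [hTa]
  have hyy := IsVariation.norm_sub_le hC hx hx' hxT (hi u) (hi u') hu1 hu1' hCT hwe hy hy' T
    (right_mem_Icc.2 haT)
  have hwint : ∫ s in a..T, ‖u s - u' s‖ = ∫ s in a..T, ‖w s‖ := by
    refine intervalIntegral.integral_congr_ae ?_
    rw [uIoc_of_le haT]
    filter_upwards [hwe] with s hs hs'
    rw [hs hs']
  have hwn : (∫ s in a..T, ‖u s - u' s‖) ^ 2 ≤ h * ‖w‖ ^ 2 := by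
    have e1 := w.integral_norm_le haI hTI haT
    rw [hTa] at e1
    rw [hwint]
    calc (∫ s in a..T, ‖w s‖) ^ 2 ≤ (√h * ‖w‖) ^ 2 := by
          refine pow_le_pow_left₀ ?_ e1 2
          exact intervalIntegral.integral_nonneg haT fun _ _ => norm_nonneg _
      _ = h * ‖w‖ ^ 2 := by rw [mul_pow, Real.sq_sqrt hpos.le]
  have hnorm : c * ‖w‖ ^ 2 = ζ (y T - y' T) := by
    rw [hw, ControlSpace.norm_sq_cutoff _ ha haT hTt, ← hw, inner_sub_left, mul_sub, ← hα, ← hα',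
      hyd, hyd', map_sub]
    rfl
  have hw0 : w = 0 := by
    by_contra hne
    have hwpos : 0 < ‖w‖ ^ 2 := by
      have := norm_pos_iff.2 hne
      positivity
    have e1 : ζ (y T - y' T) ≤ ‖ζ‖ * (2 * (6 * C ^ 2)) * h * ‖w‖ ^ 2 := by
      calc ζ (y T - y' T) ≤ ‖ζ‖ * ‖y T - y' T‖ := (le_abs_self _).trans (ζ.le_opNorm _)
        _ ≤ ‖ζ‖ * (2 * (6 * C ^ 2 * (h * ‖w‖ ^ 2))) := by
            refine mul_le_mul_of_nonneg_left (hyy.trans ?_) (norm_nonneg _)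
            gcongr
        _ = ‖ζ‖ * (2 * (6 * C ^ 2)) * h * ‖w‖ ^ 2 := by ring
    rw [← hnorm] at e1
    nlinarith
  have hwz : ∀ᵐ s, s ∈ Icc 0 t → w s = 0 := by
    rw [hw0]
    filter_upwards [(ae_restrict_iff' (measurableSet_Icc (a := (0:ℝ)) (b := t))).1
      (Lp.coeFn_zero (EuclideanSpace ℝ (Fin k)) 2 (volume.restrict (Icc 0 t)))] with s hs hs'
    exact hs hs'
  have huT : ∀ᵐ s, s ∈ Ioc a T → u s = u' s := by
    filter_upwards [hwe, hwz] with s h1 h2 h3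
    rw [← sub_eq_zero, ← h1 h3, h2 ⟨ha.trans h3.1.le, h3.2.trans hTt⟩]
  refine ⟨a, ha, by linarith, fun s hs => ?_, huT⟩
  have e1 := IsIntegralSolution.norm_sub_le hC hx hx' hxT (hi u) (hi u') hu1' hCT s hs
  have e2 : ∫ s in a..T, ‖u s - u' s‖ = 0 := by
    rw [intervalIntegral.integral_congr_ae (g := fun _ => (0 : ℝ))]
    · simp
    · rw [uIoc_of_le haT]
      filter_upwards [huT] with s h1 h2
      rw [h1 h2, sub_self, norm_zero]
  rw [e2, mul_zero, mul_zero] at e1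
  have m1 : γ s ∈ (extChartAt I (γ T)).source := by
    rw [extChartAt_source]; exact (hmem s hs).1.1
  have m2 : γ' s ∈ (extChartAt I (γ T)).source := by
    rw [extChartAt_source]; exact (hmem s hs).2.1
  exact (extChartAt I (γ T)).injOn m1 m2 (sub_eq_zero.1 (norm_le_zero_iff.1 e1))

/-- Two trajectories with the same endpoint, the same tangent functional and the same positive
multiplier coincide. -/
theorem IsSol.eqOn_of_multiplier (hX : ∀ i, IsSmoothVectorField I (X i)) {u u' : ControlSpace k t}
    (ht : 0 ≤ t) (hγ : IsSol X u 0 t γ) (h0 : γ 0 = q₀) (h1 : γ t = q₁)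
    (hγ' : IsSol X u' 0 t γ') (h0' : γ' 0 = q₀) (h1' : γ' t = q₁)
    (hu : ∀ᵐ s, s ∈ Icc 0 t → ‖u s‖ ≤ 1) (hu' : ∀ᵐ s, s ∈ Icc 0 t → ‖u' s‖ ≤ 1)
    {α : E →L[ℝ] ℝ} {c : ℝ} (hc : 0 < c)
    (hα : ∀ v, α (fderiv ℝ (endpointChart X q₀ t q₁) u v) = c * inner ℝ u v)
    (hα' : ∀ v, α (fderiv ℝ (endpointChart X q₀ t q₁) u' v) = c * inner ℝ u' v) :
    EqOn γ γ' (Icc 0 t) := by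
  set S := {b | b ∈ Icc 0 t ∧ EqOn γ γ' (Icc b t) ∧ ∀ᵐ s, s ∈ Ioc b t → u s = u' s} with hS
  have htS : t ∈ S := by
    refine ⟨right_mem_Icc.2 ht, ?_, Eventually.of_forall fun s hs => ?_⟩
    · rw [Icc_self, eqOn_singleton, h1, h1']
    · rw [Ioc_self] at hs; exact hs.elim
  have hSb : BddBelow S := ⟨0, fun b hb => hb.1.1⟩
  set T := sInf S with hT
  have hT0 : 0 ≤ T := le_csInf ⟨t, htS⟩ fun b hb => hb.1.1
  have hTt : T ≤ t := csInf_le hSb htS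
  have hlt : ∀ s, T < s → ∃ b ∈ S, b < s := fun s hs => exists_lt_of_csInf_lt ⟨t, htS⟩ hs
  have heq : EqOn γ γ' (Ioc T t) := by
    intro s hs
    obtain ⟨b, hb, hbs⟩ := hlt s hs.1
    exact hb.2.1 ⟨hbs.le, hs.2⟩
  have heqT : EqOn γ γ' (Icc T t) := by
    rcases hTt.eq_or_lt with h | h
    · rw [h, Icc_self, eqOn_singleton, h1, h1']
    · have hsub : Icc T t ⊆ Icc 0 t := Icc_subset_Icc hT0 le_rfl
      exact heq.of_subset_closure (hγ.continuousOn.mono hsub) (hγ'.continuousOn.mono hsub)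
        Ioc_subset_Icc_self (by rw [closure_Ioc h.ne])
  have huT : ∀ᵐ s, s ∈ Ioc T t → u s = u' s := by
    have h2 : ∀ n : ℕ, ∀ᵐ s, s ∈ Ioc (T + 1 / ((n : ℝ) + 1)) t → u s = u' s := by
      intro n
      obtain ⟨b, hb, hbs⟩ := hlt (T + 1 / ((n : ℝ) + 1)) (by
        have : (0 : ℝ) < 1 / ((n : ℝ) + 1) := by positivity
        linarith)
      filter_upwards [hb.2.2] with s hs hs'
      exact hs ⟨hbs.trans hs'.1, hs'.2⟩
    filter_upwards [ae_all_iff.2 h2] with s hs hs'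
    obtain ⟨n, hn⟩ := exists_nat_one_div_lt (sub_pos.2 hs'.1)
    exact hs n ⟨by linarith, hs'.2⟩
  rcases hT0.eq_or_lt with h | h
  · rwa [← h] at heqT
  · exfalso
    obtain ⟨a, ha0, haT, hae, hau⟩ := hγ.exists_lt_eqOn hX h0 h1 hγ' h0' h1' hu hu' hc hα hα' h hTt
      (heqT (left_mem_Icc.2 hTt)) huT
    refine absurd (csInf_le hSb (?_ : a ∈ S)) (not_le.2 haT)
    refine ⟨⟨ha0, haT.le.trans hTt⟩, ?_, ?_⟩
    · rw [← Icc_union_Icc_eq_Icc haT.le hTt]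
      exact hae.union heqT
    · filter_upwards [hau, huT] with s h1 h2 hs
      rcases le_or_gt s T with h3 | h3
      · exact h1 ⟨hs.1, h3⟩
      · exact h2 ⟨h3, hs.2⟩

end EndpointDerivative

/-! ### Normal paths -/

theorem apply_ne_zero_of_notMem {E : Type*} [NormedAddCommGroup E] [NormedSpace ℝ E]
    [FiniteDimensional ℝ E] {S : Submodule ℝ E} {α : E →ₗ[ℝ] ℝ} (hα : α ≠ 0)
    (hS : S ≤ LinearMap.ker α) (h1 : Module.finrank ℝ (E ⧸ S) = 1) {ξ : E} (hξ : ξ ∉ S) :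
    α ξ ≠ 0 := by
  have h2 := S.finrank_quotient_add_finrank
  have h3 := Module.Dual.finrank_ker_add_one_of_ne_zero (f := α) hα
  have h4 : S = LinearMap.ker α := Submodule.eq_of_le_of_finrank_eq hS (by omega)
  intro h
  exact hξ (by rw [h4]; exact h)

section Normal

variable {E : Type*} [NormedAddCommGroup E] [NormedSpace ℝ E] [FiniteDimensional ℝ E]
  {H : Type*} [TopologicalSpace H] {I : ModelWithCorners ℝ E H} [I.Boundaryless]
  {M : Type*} [TopologicalSpace M] [ChartedSpace H M] [IsManifold I ∞ M] [T2Space M]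
  {k : ℕ} {X : Fin k → ∀ q : M, TangentSpace I q} {t : ℝ} {q₀ : M} {γ : ℝ → M}

/-- If all geodesics have corank one, the tangent functional does not vanish on the final velocity
of a normal path. -/
theorem apply_velocity_ne_zero (hX : ∀ i, IsSmoothVectorField I (X i))
    (hcorank : AllGeodesicsHaveCorankOne I X) (ht : 0 < t) {u : ControlSpace k t}
    (hu : ∀ᵐ s ∂(volume.restrict (Icc 0 t)), ‖u s‖ = 1) (hγ : IsTrajectory I X q₀ t u γ)
    {ξ : TangentSpace I (γ t)} (hξ : HasVelocityWithinAt I γ (Icc 0 t) t ξ)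
    (hξu : ∀ η ∈ endpointSubspace I X q₀ t u,
      (⟨γ t, ξ⟩ : TangentBundle I M) ≠ ⟨endpointMap I X q₀ t u, η⟩)
    {α : E →L[ℝ] ℝ} (hα0 : α.toLinearMap ≠ 0) {c : ℝ}
    (hα : ∀ v, α (fderiv ℝ (endpointChart X q₀ t (γ t)) u v) = c * inner ℝ u v) :
    α (ξ : E) ≠ 0 := by
  have hsol := hγ.isSol hX
  have hend : endpointMap I X q₀ t u = γ t := endpointMap_eq_of_isSol hX ht.le hsol hγ.start
  set S : Submodule ℝ E := endpointSubspace I X q₀ t u with hS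
  have hξS : (ξ : E) ∉ S := fun h => hξu ξ h (totalSpace_mk_eq_of_eq hend.symm rfl)
  have hker : S ≤ LinearMap.ker α.toLinearMap := by
    rintro η hη
    obtain ⟨v, hv, hvη⟩ : ∃ v ∈ (ℝ ∙ u)ᗮ,
      (mfderiv 𝓘(ℝ, ControlSpace k t) I (endpointMap I X q₀ t) u v : E) = η := hη
    rw [mfderiv_endpointMap_apply hX ht.le hsol hγ.start hend] at hvη
    have h1 : inner ℝ u v = (0 : ℝ) := Submodule.mem_orthogonal_singleton_iff_inner_right.1 hv
    change α η = 0
    rw [← hvη, hα, h1, mul_zero]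
  have hconst : ∃ τ ∈ Icc (0 : ℝ) t, γ τ ≠ q₀ := by
    by_contra! hc
    have htI : t ∈ Icc 0 t := right_mem_Icc.2 ht.le
    have hd1 : HasDerivWithinAt (extChartAt I (γ t) ∘ γ) (ξ : E) (Icc 0 t) t := by
      refine hξ.hasDerivWithinAt_comp (mdifferentiableAt_extChartAt (mem_chart_source H (γ t))) ?_
      rw [mfderiv_extChartAt_self]
      rfl
    have hd2 : HasDerivWithinAt (extChartAt I (γ t) ∘ γ) 0 (Icc 0 t) t :=
      (hasDerivWithinAt_const t (Icc 0 t) (extChartAt I (γ t) q₀)).congr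
        (fun s hs => by rw [Function.comp, hc s hs]) (by rw [Function.comp, hc t htI])
    have hz : ∀ ξ' : E, HasDerivWithinAt (extChartAt I (γ t) ∘ γ) ξ' (Icc 0 t) t → ξ' ∈ S :=
      fun ξ' h => by
        rw [(uniqueDiffOn_Icc ht t htI).eq_deriv _ h hd2]
        exact S.zero_mem
    exact hξS (hz _ hd1)
  have hgeo : GeneratesGeodesic I X q₀ t u := by
    refine ⟨⟨1, hu.mono fun s hs => hs.le⟩, ⟨γ, hγ, hconst⟩, fun htop => hα0 ?_⟩
    have hS' : S = ⊤ := htop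
    rw [hS', top_le_iff, LinearMap.ker_eq_top] at hker
    exact hker
  exact apply_ne_zero_of_notMem hα0 hker (hcorank q₀ t u ht hgeo) hξS

end Normal

end

theorem corollary1
    {E : Type*} [NormedAddCommGroup E] [NormedSpace ℝ E] [FiniteDimensional ℝ E]
    {H : Type*} [TopologicalSpace H] (I : ModelWithCorners ℝ E H) [I.Boundaryless]
    {M : Type*} [TopologicalSpace M] [ChartedSpace H M] [IsManifold I ∞ M]
    [T2Space M] [SecondCountableTopology M]
    (F : Type*) [NormedAddCommGroup F] [NormedSpace ℝ F] [FiniteDimensional ℝ F]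
    {U : M → Type*} [TopologicalSpace (TotalSpace F U)]
    [∀ q, NormedAddCommGroup (U q)] [∀ q, InnerProductSpace ℝ (U q)]
    [FiberBundle F U] [VectorBundle ℝ F U] [ContMDiffVectorBundle ∞ F U I]
    [IsContMDiffRiemannianBundle I ∞ F U]
    (f : ∀ q, U q →ₗ[ℝ] TangentSpace I q) (hf : IsSubriemannianStructure I F f)
    {k : ℕ} (σ : Fin k → ∀ q, U q) (hσ : IsFreePresentation I F σ)
    (hcorank : AllGeodesicsHaveCorankOne I (fun i q => f q (σ i q)))
    (q₀ : M) (r : ℝ) (hr : IsCompact (subriemannianBall I F f q₀ r))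
    (t : ℝ) (ht : 0 < t) (htr : t ≤ r)
    (γ : ℝ → M) (hγ : IsShortestPath I F f q₀ t γ)
    (hnormal : IsNormalPath I (fun i q => f q (σ i q)) q₀ t γ)
    (γ' : ℝ → M) (hγ' : IsShortestPath I F f q₀ t γ')
    (hend : γ' t = γ t) (hne : ∃ τ ∈ Icc (0 : ℝ) t, γ' τ ≠ γ τ) :
    ¬ AdmitsTangentHyperplane I (subriemannianBall I F f q₀ t) (γ t) := by
  rintro ⟨α₀, hα₀⟩
  have hX := hf.isSmoothVectorField hσ
  obtain ⟨u, hu, htraj, -, ξ, hξ, hξu⟩ := hnormal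
  obtain ⟨u', hu', hsol'⟩ := hγ'.exists_control hf hσ ht
  have hsol := htraj.isSol hX
  let α : E →L[ℝ] ℝ := LinearMap.toContinuousLinearMap (α₀ : E →ₗ[ℝ] ℝ)
  have hα : IsTangentHyperplane I (subriemannianBall I F f q₀ t) (γ t)
      (α.toLinearMap : TangentSpace I (γ t) →ₗ[ℝ] ℝ) := hα₀
  obtain ⟨c, hc, hcu⟩ := hα.exists_eq_const_mul_inner hf hσ ht hsol htraj.start rfl hu
  obtain ⟨c', hc', hcu'⟩ := hα.exists_eq_const_mul_inner hf hσ ht hsol' hγ'.start hend hu'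
  have hu1 := (ae_restrict_iff' measurableSet_Icc).1 hu
  have hu1' := (ae_restrict_iff' measurableSet_Icc).1 hu'
  obtain ⟨b⟩ : Nonempty (SmoothBumpFunction I (γ t)) := inferInstance
  have hcB := hsol.multiplier_eq_norm hX ht htraj.start rfl hu1 b hc hcu
  have hcB' := hsol'.multiplier_eq_norm hX ht hγ'.start hend hu1' b hc' hcu'
  obtain rfl : c' = c := hcB'.trans hcB.symm
  have hξ0 : α (ξ : E) ≠ 0 :=
    apply_velocity_ne_zero hX hcorank ht hu htraj hξ hξu hα.1 hcu
  have hcpos : 0 < c' := by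
    refine lt_of_le_of_ne hc fun h0 => hξ0 ?_
    rw [← h0] at hcB
    have h1 := norm_eq_zero.1 hcB.symm
    rw [LinearIsometryEquiv.map_eq_zero_iff] at h1
    exact hsol.apply_velocity_eq_zero hX ht (hu1.mono fun s hs hs' => (hs hs').le) b h1 hξ
  obtain ⟨τ, hτ, hτne⟩ := hne
  exact hτne (hsol.eqOn_of_multiplier hX ht.le htraj.start rfl hsol' hγ'.start hend
    (hu1.mono fun s hs hs' => (hs hs').le) (hu1'.mono fun s hs hs' => (hs hs').le) hcpos
    hcu hcu' hτ).symm
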